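/- **Setting.** Let $q\in\mathbb C\setminus\{0,\pm1\}$, $\mu\in\mathbb C\setminus\{0,q,-q^{-1}\}$, $i_q:=\frac{q^i-q^{-i}}{q-q^{-1}}$ and $\eta:=\frac{(q-\mu)(q^{-1}+\mu)}{\mu(q-q^{-1})}$. Let $V=\mathbb C^N$. For $X\in\mathrm{End}(V^{\otimes2})$, $X_m$ denotes $X$ acting in the tensor factors $m,m+1$ (and $X_{ml}$ in the factors $m,l$), and $P$ is the permutation. $X$ is skew invertible if there is $\Psi_X\in\mathrm{End}(V^{\otimes2})$ with $\mathrm{Tr}_{(2)}X_{12}(\Psi_X)_{23}=\mathrm{Tr}_{(2)}(\Psi_X)_{12}X_{23}=P_{13}$; then $C_X:=\mathrm{Tr}_{(1)}\Psi_X$, $D_X:=\mathrm{Tr}_{(2)}\Psi_X$, and $X$ is strict skew invertible if moreover $C_X$ or $D_X$ is invertible. An R-matrix is an invertible $R\in\mathrm{End}(V^{\otimes2})$ with $R_1R_2R_1=R_2R_1R_2$. Let $R,F$ be R-matrices such that $R_1F_2F_1=F_2F_1R_2$ and $R_2F_1F_2=F_1F_2R_1$, $F$ is strict skew invertible, and $R$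 is skew invertible and of BMW type: its minimal polynomial is $(x-q)(x+q^{-1})(x-\mu)$, and $K:=\mu^{-1}(q-q^{-1})^{-1}(qI-R)(q^{-1}I+R)$ satisfies $K_2K_1=R_1^{\pm1}R_2^{\pm1}K_1$ (equal signs) and $K_1K_2K_1=K_1$. The BMW algebra $\mathcal W_n=\mathcal W_n(q,\mu)$ is the quotient of the group algebra of the braid group on $n$ strands (generators $\sigma_1,\dots,\sigma_{n-1}$) by $\sigma_i\kappa_i=\kappa_i\sigma_i=\mu\kappa_i$ and $\kappa_i\sigma_{i+1}^{\epsilon}\kappa_i=\mu^{-\epsilon}\kappa_i$ ($\epsilon=\pm1$), where $\kappa_i:=\frac{(q-\sigma_i)(q^{-1}+\sigma_i)}{\mu(q-q^{-1})}$; $\rho_R:\mathcal W_n\to\mathrm{End}(V^{\otimes n})$, $\sigma_i\mapsto R_i$, is its R-matrix representation, and $\alpha\mapsto\alpha^{\uparrow s}$ is the morphism $\mathcal W_n\to\mathcal W_{n+s}$, $\sigma_i\mapsto\sigma_{i+s}$. The antisymmetrizers are $a^{(1)}:=1$, $$a^{(i+1)}:=\frac{q^i}{(i+1)_q}\,a^{(i)}\sigma_i^-(q^{-2i})\,a^{(i)},\qquad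 \sigma^-_i(x):=1+\frac{x-1}{q-q^{-1}}\,\sigma_i+\frac{x-1}{q\mu^{-1}x+1}\,\kappa_i .$$ For a matrix $X$ with entries in an algebra put $X_{\overline1}:=X_1$, $X_{\overline{i+1}}:=F_iX_{\overline i}F_i^{-1}$. The quantum matrix algebra $\mathcal M(R,F)$ is the unital $\mathbb C$-algebra generated by the entries of an $N\times N$ matrix $M$ subject to $R_1M_{\overline1}M_{\overline2}=M_{\overline1}M_{\overline2}R_1$. The R-trace is $\mathrm{Tr}_R(X):=\mathrm{Tr}(D_RX)$; indices in parentheses name the factors in which it is taken. For $\alpha\in\mathcal W_n$, $n\ge 1$, let $$M^{\alpha}:=\mathrm{Tr}_{R(2,\dots,n)}\bigl(M_{\overline1}\cdots M_{\overline n}\,\rho_R(\alpha)\bigr),\qquad ch(\alpha):=\mathrm{Tr}_R(M^\alpha),$$ and put $a_0:=1$, $a_i:=ch(a^{(i)})$, $g:=\eta^{-1}ch(\kappa_1)$. Let $\mathcal C$ be the linear span of $1$ and all $ch(\alpha)$, and $\mathcal P$ the span of all matrices $M^{\alpha}$ and $I\,c$, $c\in\mathcal C$. On $\mathcal P$ there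 is the bilinear product $\star$ given by $$M^{\alpha}\star M^{\beta}:=M^{\alpha\,\beta^{\uparrow n}\,\sigma_n\cdots\sigma_2\sigma_1\sigma_2^{-1}\cdots\sigma_n^{-1}}\ (\alpha\in\mathcal W_n),\quad (Ic)\star M^\alpha=M^\alpha\star(Ic):=M^\alpha c,\quad (Ic)\star(Id):=I(cd).$$ Let $M^{\overline0}:=I$, $M^{\overline{m+1}}:=M\star M^{\overline m}$. For $N\times N$ matrices $X$ over $\mathcal M(R,F)$ put $$\phi(X)_1:=\mathrm{Tr}_{R(2)}(F_{12}X_1F_{12}^{-1}R_{12}),\quad \xi(X)_1:=\mathrm{Tr}_{R(2)}(F_{12}X_1F_{12}^{-1}K_{12}),\quad M^{\top}(X):=M\cdot\xi(X);$$ the map $\phi$ is invertible. **Descendants.** Let $n\ge1$ and assume $j_q\neq0$ and $\mu\neq-q^{3-2j}$ for $j=2,\dots,n$. For $1\le i\le n$ and $m\ge0$ define $$A^{(m,i)}:=i_q\,M^{\overline m}\star M^{a^{(i)}},\qquad B^{(m+1,i)}:=i_q\,M^{\overline m}\star M^{\top}(M^{a^{(i)}}),$$ $$A^{(-1,i)}:=i_q\,\phi^{-1}\bigl(\mathrm{Tr}_{R(2,\dots,i)}M_{\overline2}\cdots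 M_{\overline i}\,\rho_R(a^{(i)})\bigr),\qquad B^{(0,i)}:=i_q\,\phi^{-1}\bigl(\xi(M^{a^{(i)}})\bigr),$$ and $A^{(m,0)}:=0$, $B^{(m,0)}:=0$ for $m\ge0$. **Lemma.** For all $0\le i\le n-1$ and $m\ge0$, $$A^{(m-1,i+1)}=q^i\,M^{\overline m}a_i-A^{(m,i)}-\frac{\mu q^{2i-1}(q-q^{-1})}{1+\mu q^{2i-1}}\,B^{(m,i)},$$ $$B^{(m+1,i+1)}=\Bigl(\mu^{-1}q^{-i}\,M^{\overline m}a_i+\frac{q-q^{-1}}{1+\mu q^{2i-1}}\,A^{(m,i)}-B^{(m,i)}\Bigr)g .$$ (Elements of $\mathcal M(R,F)$ to the right of a matrix multiply its entries from the right. For $i=0$ the terms with $A^{(m,0)}$ and $B^{(m,0)}$ are $0$, whatever their coefficients.) -/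

import Mathlib

noncomputable section

namespace QMA

/-! ### Matrices on tensor powers

An operator on the tensor power of `n` copies of the space with basis `Fin N` is a matrix indexed
by `Fin n → Fin N`. -/

/-- Matrices of operators on the `n`-th tensor power, with entries in `A`. -/
abbrev TMat (N n : ℕ) (A : Type*) := Matrix (Fin n → Fin N) (Fin n → Fin N) A

section legs

variable {N : ℕ} {A : Type*} [Semiring A]

/-- The operator on `n` tensor factors that acts as `X` on the factors `e 0, …, e (k - 1)` and as
the identity on the other ones. -/
def leg {k n : ℕ} (e : Fin k ↪ Fin n) (X : TMat N k A) : TMat N n A :=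
  Matrix.of fun f g =>
    open Classical in if ∀ j, j ∉ Set.range e → f j = g j then X (f ∘ e) (g ∘ e) else 0

/-- The embedding `j ↦ s + j`. -/
def shiftEmb {k n : ℕ} (s : ℕ) (h : s + k ≤ n) : Fin k ↪ Fin n where
  toFun j := ⟨s + j, by omega⟩
  inj' := by
    intro a b hab
    simp only [Fin.mk.injEq] at hab
    exact Fin.ext (by omega)

theorem shiftEmb_val {k n : ℕ} (s : ℕ) (h : s + k ≤ n) (j : Fin k) :
    (shiftEmb s h j : ℕ) = s + j := rfl

/-- `X` acting on the `k` consecutive factors that follow the first `s` ones. For `k = 2` this is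
the operator written `X_{s+1}` when factors are numbered from `1`. -/
def site {k : ℕ} (n s : ℕ) (h : s + k ≤ n) (X : TMat N k A) : TMat N n A :=
  leg (shiftEmb s h) X

theorem leg_apply {k n : ℕ} (e : Fin k ↪ Fin n) (X : TMat N k A) (f g : Fin n → Fin N)
    (h : ∀ j, j ∉ Set.range e → f j = g j) : leg e X f g = X (f ∘ e) (g ∘ e) := by
  simp only [leg, Matrix.of_apply]
  rw [if_pos h]

theorem leg_apply_zero {k n : ℕ} (e : Fin k ↪ Fin n) (X : TMat N k A) (f g : Fin n → Fin N)
    (h : ¬ ∀ j, j ∉ Set.range e → f j = g j) : leg e X f g = 0 := by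
  simp only [leg, Matrix.of_apply]
  rw [if_neg h]

theorem leg_one {k n : ℕ} (e : Fin k ↪ Fin n) : leg e (1 : TMat N k A) = 1 := by
  ext f g
  by_cases h : ∀ j, j ∉ Set.range e → f j = g j
  · rw [leg_apply e _ f g h, Matrix.one_apply, Matrix.one_apply]
    have : f ∘ e = g ∘ e ↔ f = g := by
      constructor
      · intro h'
        funext j
        by_cases hj : j ∈ Set.range e
        · obtain ⟨i, rfl⟩ := hj
          exact congrFun h' i
        · exact h j hj
      · rintro rfl; rfl
    simp only [this]
  · rw [leg_apply_zero e _ f g h, Matrix.one_apply, if_neg]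
    rintro rfl
    exact h fun _ _ => rfl

theorem extend_comp {k n : ℕ} (e : Fin k ↪ Fin n) (x : Fin k → Fin N) (f : Fin n → Fin N) :
    Function.extend e x f ∘ e = x := by
  funext i
  simp [e.injective.extend_apply]

theorem leg_mul {k n : ℕ} (e : Fin k ↪ Fin n) (X Y : TMat N k A) :
    leg e (X * Y) = leg e X * leg e Y := by
  ext f g
  rw [Matrix.mul_apply]
  have key : ∑ h, leg e X f h * leg e Y h g
      = ∑ x : Fin k → Fin N,
          leg e X f (Function.extend e x f) * leg e Y (Function.extend e x f) g := by
    symm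
    apply Finset.sum_of_injOn (fun x => Function.extend e x f)
    · intro x _ y _ hxy
      have := congrArg (fun z => z ∘ e) hxy
      simpa only [extend_comp] using this
    · intro x _
      simp
    · intro h _ hh
      rw [leg_apply_zero e X f h, zero_mul]
      intro h'
      apply hh
      refine ⟨h ∘ e, by simp, ?_⟩
      funext j
      by_cases hj : j ∈ Set.range e
      · obtain ⟨i, rfl⟩ := hj
        simp [e.injective.extend_apply]
      · dsimp only
        rw [Function.extend_apply' _ _ _ (by simpa using hj)]
        exact h' j hj
    · intro x _
      rfl
  rw [key]
  have hf : ∀ x : Fin k → Fin N, ∀ j, j ∉ Set.range e → f j = Function.extend e x f j := by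
    intro x j hj
    rw [Function.extend_apply' _ _ _ (by simpa using hj)]
  by_cases h : ∀ j, j ∉ Set.range e → f j = g j
  · rw [leg_apply e _ f g h, Matrix.mul_apply]
    refine Finset.sum_congr rfl fun x _ => ?_
    rw [leg_apply e X f _ (hf x), leg_apply e Y _ g, extend_comp]
    intro j hj
    rw [← hf x j hj, h j hj]
  · rw [leg_apply_zero e _ f g h]
    symm
    refine Finset.sum_eq_zero fun x _ => ?_
    rw [leg_apply_zero e Y _ g, mul_zero]
    intro h'
    apply h
    intro j hj
    rw [hf x j hj, h' j hj]

theorem leg_add {k n : ℕ} (e : Fin k ↪ Fin n) (X Y : TMat N k A) :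
    leg e (X + Y) = leg e X + leg e Y := by
  ext f g
  by_cases h : ∀ j, j ∉ Set.range e → f j = g j
  · simp only [Matrix.add_apply, leg_apply e _ f g h]
  · simp only [Matrix.add_apply, leg_apply_zero e _ f g h, add_zero]

theorem leg_leg {k m n : ℕ} (e : Fin m ↪ Fin n) (e' : Fin k ↪ Fin m) (X : TMat N k A) :
    leg e (leg e' X) = leg (e'.trans e) X := by
  ext f g
  by_cases h : ∀ j, j ∉ Set.range e → f j = g j
  · rw [leg_apply e _ f g h]
    by_cases h2 : ∀ j, j ∉ Set.range e' → (f ∘ e) j = (g ∘ e) j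
    · rw [leg_apply e' _ _ _ h2, leg_apply]
      · rfl
      · intro j hj
        by_cases hj2 : j ∈ Set.range e
        · obtain ⟨i, rfl⟩ := hj2
          apply h2 i
          rintro ⟨l, rfl⟩
          exact hj ⟨l, rfl⟩
        · exact h j hj2
    · rw [leg_apply_zero e' _ _ _ h2, leg_apply_zero]
      intro h3
      apply h2
      intro i hi
      apply h3
      rintro ⟨l, hl⟩
      exact hi ⟨l, e.injective hl⟩
  · rw [leg_apply_zero e _ f g h, leg_apply_zero]
    intro h3
    apply h
    intro j hj
    apply h3
    rintro ⟨l, rfl⟩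
    exact hj ⟨e' l, rfl⟩

theorem site_site {k m n : ℕ} (s t : ℕ) (h : s + m ≤ n) (h' : t + k ≤ m) (X : TMat N k A) :
    site n s h (site m t h' X) = site n (s + t) (by omega) X := by
  unfold site
  rw [leg_leg]
  congr 1
  ext j
  simp only [Function.Embedding.trans_apply, shiftEmb_val, add_assoc]

theorem site_mul {k : ℕ} (n s : ℕ) (h : s + k ≤ n) (X Y : TMat N k A) :
    site n s h (X * Y) = site n s h X * site n s h Y := leg_mul _ X Y

theorem site_one {k : ℕ} (n s : ℕ) (h : s + k ≤ n) : site n s h (1 : TMat N k A) = 1 :=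
  leg_one _

end legs

theorem site_smul {N k : ℕ} (n s : ℕ) (h : s + k ≤ n) (c : ℂ) (X : TMat N k ℂ) :
    site n s h (c • X) = c • site n s h X := by
  ext f g
  by_cases hh : ∀ j, j ∉ Set.range (shiftEmb s h) → f j = g j
  · simp only [site, Matrix.smul_apply, leg_apply _ _ f g hh]
  · simp only [site, Matrix.smul_apply, leg_apply_zero _ _ f g hh, smul_zero]

theorem site_add {N k : ℕ} (n s : ℕ) (h : s + k ≤ n) (X Y : TMat N k ℂ) :
    site n s h (X + Y) = site n s h X + site n s h Y := leg_add _ X Y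

theorem site_sub {N k : ℕ} (n s : ℕ) (h : s + k ≤ n) (X Y : TMat N k ℂ) :
    site n s h (X - Y) = site n s h X - site n s h Y := by
  rw [sub_eq_add_neg, sub_eq_add_neg, site_add, ← neg_one_smul ℂ Y, site_smul, neg_one_smul]

/-- Operators that act on disjoint sets of factors commute. -/
theorem leg_comm {N k l n : ℕ} (e : Fin k ↪ Fin n) (e' : Fin l ↪ Fin n)
    (hd : ∀ i j, e i ≠ e' j) (X : TMat N k ℂ) (Y : TMat N l ℂ) :
    leg e X * leg e' Y = leg e' Y * leg e X := by
  have aux : ∀ {k l : ℕ} (e : Fin k ↪ Fin n) (e' : Fin l ↪ Fin n)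
      (_ : ∀ i j, e i ≠ e' j) (X : TMat N k ℂ) (Y : TMat N l ℂ) (f g : Fin n → Fin N),
      (leg e X * leg e' Y) f g
        = open Classical in if ∀ j, j ∉ Set.range e → j ∉ Set.range e' → f j = g j then
            X (f ∘ e) (g ∘ e) * Y (f ∘ e') (g ∘ e') else 0 := by
    intro k l e e' hd X Y f g
    rw [Matrix.mul_apply, Finset.sum_eq_single (Function.extend e (g ∘ e) f)]
    · have h1 : ∀ j, j ∉ Set.range e → f j = Function.extend e (g ∘ e) f j := by
        intro j hj
        rw [Function.extend_apply' _ _ _ (by simpa using hj)]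
      have h2 : Function.extend e (g ∘ e) f ∘ e' = f ∘ e' := by
        funext i
        exact (h1 _ (by rintro ⟨a, ha⟩; exact hd a i ha)).symm
      rw [leg_apply e X f _ h1, extend_comp]
      split_ifs with h
      · rw [leg_apply e' Y _ g, h2]
        intro j hj
        by_cases hje : j ∈ Set.range e
        · obtain ⟨i, rfl⟩ := hje
          simp [e.injective.extend_apply]
        · rw [← h1 j hje, h j hje hj]
      · rw [leg_apply_zero e' Y _ g, mul_zero]
        intro h'
        apply h
        intro j hj hj'
        rw [h1 j hj, h' j hj']
    · intro b _ hb
      by_cases h1 : ∀ j, j ∉ Set.range e → f j = b j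
      · rw [leg_apply_zero e' Y b g, mul_zero]
        intro h2
        apply hb
        funext j
        by_cases hje : j ∈ Set.range e
        · obtain ⟨i, rfl⟩ := hje
          rw [e.injective.extend_apply]
          exact h2 _ (by rintro ⟨a, ha⟩; exact hd i a ha.symm)
        · rw [Function.extend_apply' _ _ _ (by simpa using hje), h1 j hje]
      · rw [leg_apply_zero e X f b h1, zero_mul]
    · simp
  ext f g
  rw [aux e e' hd, aux e' e (fun i j => (hd j i).symm)]
  congr 1
  · apply propext
    exact ⟨fun h j a b => h j b a, fun h j a b => h j b a⟩
  · ring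

/-! ### R-matrices -/

section rmatrices

variable {N : ℕ}

/-- The permutation operator `u ⊗ v ↦ v ⊗ u`. -/
def perm (N : ℕ) : TMat N 2 ℂ := Matrix.of fun f g => if f 0 = g 1 ∧ f 1 = g 0 then 1 else 0

/-- `Tr₍₂₎ X₁₂ Y₂₃ = P₁₃` on three factors. -/
def IsHalfSkew (X Y : TMat N 2 ℂ) : Prop :=
  ∀ a c a' c' : Fin N,
    ∑ b, (site 3 0 (by omega) X * site 3 1 (by omega) Y) ![a, b, c] ![a', b, c']
      = perm N ![a, c] ![a', c']

/-- `Ψ` is a skew inverse of `X`: `Tr₍₂₎ X₁₂ Ψ₂₃ = Tr₍₂₎ Ψ₁₂ X₂₃ = P₁₃`. -/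
def IsSkewInverse (X Ψ : TMat N 2 ℂ) : Prop := IsHalfSkew X Ψ ∧ IsHalfSkew Ψ X

/-- Skew invertibility. -/
def SkewInvertible (X : TMat N 2 ℂ) : Prop := ∃ Ψ, IsSkewInverse X Ψ

/-- The (unique) skew inverse `Ψ_X` of a skew invertible operator; `0` if there is none. -/
def skewInv (X : TMat N 2 ℂ) : TMat N 2 ℂ :=
  open Classical in if h : SkewInvertible X then h.choose else 0

/-- `C_X = Tr₍₁₎ Ψ_X`. -/
def opC (X : TMat N 2 ℂ) : Matrix (Fin N) (Fin N) ℂ :=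
  Matrix.of fun b b' => ∑ a, skewInv X ![a, b] ![a, b']

/-- `D_X = Tr₍₂₎ Ψ_X`. -/
def opD (X : TMat N 2 ℂ) : Matrix (Fin N) (Fin N) ℂ :=
  Matrix.of fun a a' => ∑ b, skewInv X ![a, b] ![a', b]

/-- Strict skew invertibility: skew invertible, with `C_X` or `D_X` invertible. -/
def StrictSkewInvertible (X : TMat N 2 ℂ) : Prop :=
  SkewInvertible X ∧ (IsUnit (opC X) ∨ IsUnit (opD X))

/-- `X₁` on three factors. -/
abbrev fst3 (X : TMat N 2 ℂ) : TMat N 3 ℂ := site 3 0 (by omega) X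

/-- `X₂` on three factors. -/
abbrev snd3 (X : TMat N 2 ℂ) : TMat N 3 ℂ := site 3 1 (by omega) X

/-- An R-matrix: an invertible solution of the Yang-Baxter equation. -/
def IsRMatrix (R : TMat N 2 ℂ) : Prop :=
  IsUnit R ∧ fst3 R * snd3 R * fst3 R = snd3 R * fst3 R * snd3 R

/-- Compatible pairs (twist relations). -/
def Compatible (R F : TMat N 2 ℂ) : Prop :=
  fst3 R * snd3 F * fst3 F = snd3 F * fst3 F * snd3 R ∧
  snd3 R * fst3 F * snd3 F = fst3 F * snd3 F * fst3 R

/-- `K = μ⁻¹ (q - q⁻¹)⁻¹ (q - X)(q⁻¹ + X)` in any algebra. -/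
def kap {B : Type*} [Ring B] [Algebra ℂ B] (q μ : ℂ) (X : B) : B :=
  (μ⁻¹ * (q - q⁻¹)⁻¹) • ((q • (1 : B) - X) * (q⁻¹ • (1 : B) + X))

open Polynomial in
/-- BMW type R-matrix with parameters `q`, `μ`: the minimal polynomial is
`(x - q)(x + q⁻¹)(x - μ)`, and `K₂K₁ = R₁^{±1}R₂^{±1}K₁`, `K₁K₂K₁ = K₁`. -/
def IsBMWType (q μ : ℂ) (R : TMat N 2 ℂ) : Prop :=
  minpoly ℂ R = (X - C q) * (X + C q⁻¹) * (X - C μ) ∧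
  snd3 (kap q μ R) * fst3 (kap q μ R) = fst3 R * snd3 R * fst3 (kap q μ R) ∧
  snd3 (kap q μ R) * fst3 (kap q μ R) = fst3 R⁻¹ * snd3 R⁻¹ * fst3 (kap q μ R) ∧
  fst3 (kap q μ R) * snd3 (kap q μ R) * fst3 (kap q μ R) = fst3 (kap q μ R)

end rmatrices

/-- The initial data: parameters `q ∉ {0, 1, -1}`, `μ ∉ {0, q, -q⁻¹}`, and a compatible pair of
R-matrices `{R, F}`, with `R` skew invertible of BMW type and `F` strict skew invertible. -/
structure BMWPair (N : ℕ) (q μ : ℂ) where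
  R : TMat N 2 ℂ
  F : TMat N 2 ℂ
  q_ne_zero : q ≠ 0
  q_ne_one : q ≠ 1
  q_ne_neg_one : q ≠ -1
  mu_ne_zero : μ ≠ 0
  mu_ne_q : μ ≠ q
  mu_ne_neg_q_inv : μ ≠ -q⁻¹
  R_isRMatrix : IsRMatrix R
  F_isRMatrix : IsRMatrix F
  compatible : Compatible R F
  R_skew : SkewInvertible R
  F_strict : StrictSkewInvertible F
  R_bmw : IsBMWType q μ R

/-! ### The Birman-Murakami-Wenzl algebras -/

section bmw

/-- Free generators `σ_j` (`Sum.inl`) and `σ_j⁻¹` (`Sum.inr`); the index is `0`-based, so that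
`j : Fin (n - 1)` stands for the generator usually numbered `j + 1`. -/
abbrev PreBMW (n : ℕ) := FreeAlgebra ℂ (Fin (n - 1) ⊕ Fin (n - 1))

/-- The generator `σ_j` in the free algebra. -/
abbrev preσ {n : ℕ} (j : Fin (n - 1)) : PreBMW n := FreeAlgebra.ι ℂ (Sum.inl j)

/-- The generator `σ_j⁻¹` in the free algebra. -/
abbrev preσi {n : ℕ} (j : Fin (n - 1)) : PreBMW n := FreeAlgebra.ι ℂ (Sum.inr j)

/-- Defining relations: those of the group algebra of the braid group on `n` strands, then the
relations `σ_j κ_j = κ_j σ_j = μ κ_j` and `κ_j σ_{j+1}^{±1} κ_j = μ^{∓1} κ_j`. -/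
inductive BMWRel (q μ : ℂ) (n : ℕ) : PreBMW n → PreBMW n → Prop
  | mul_inv (j) : BMWRel q μ n (preσ j * preσi j) 1
  | inv_mul (j) : BMWRel q μ n (preσi j * preσ j) 1
  | braid (i j : Fin (n - 1)) (h : (i : ℕ) + 1 = j) :
      BMWRel q μ n (preσ i * preσ j * preσ i) (preσ j * preσ i * preσ j)
  | far (i j : Fin (n - 1)) (h : (i : ℕ) + 1 < j) : BMWRel q μ n (preσ i * preσ j) (preσ j * preσ i)
  | sk (j) : BMWRel q μ n (preσ j * kap q μ (preσ j)) (μ • kap q μ (preσ j))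
  | ks (j) : BMWRel q μ n (kap q μ (preσ j) * preσ j) (μ • kap q μ (preσ j))
  | ksk (i j : Fin (n - 1)) (h : (i : ℕ) + 1 = j) :
      BMWRel q μ n (kap q μ (preσ i) * preσ j * kap q μ (preσ i)) (μ⁻¹ • kap q μ (preσ i))
  | ksik (i j : Fin (n - 1)) (h : (i : ℕ) + 1 = j) :
      BMWRel q μ n (kap q μ (preσ i) * preσi j * kap q μ (preσ i)) (μ • kap q μ (preσ i))

/-- The BMW algebra `W_n(q, μ)`. -/
abbrev W (q μ : ℂ) (n : ℕ) := RingQuot (BMWRel q μ n)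

variable {q μ : ℂ} {n : ℕ}

/-- The generator `σ_{j+1}` of `W_n` (index `j` from `0`). -/
def σ (j : Fin (n - 1)) : W q μ n := RingQuot.mkAlgHom ℂ (BMWRel q μ n) (preσ j)

/-- The inverse of the generator `σ j`. -/
def σinv (j : Fin (n - 1)) : W q μ n := RingQuot.mkAlgHom ℂ (BMWRel q μ n) (preσi j)

/-- The element `κ_{j+1}` of `W_n` (index `j` from `0`). -/
def κ (j : Fin (n - 1)) : W q μ n := kap q μ (σ j)

theorem map_kap {B C : Type*} [Ring B] [Algebra ℂ B] [Ring C] [Algebra ℂ C] (φ : B →ₐ[ℂ] C)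
    (x : B) : φ (kap q μ x) = kap q μ (φ x) := by
  simp [kap, map_smul, map_mul, map_sub, map_add]

/-- Universal property of `W_n`. -/
def bmwLift {B : Type*} [Ring B] [Algebra ℂ B] (s t : Fin (n - 1) → B)
    (hst : ∀ j, s j * t j = 1) (hts : ∀ j, t j * s j = 1)
    (hb : ∀ i j : Fin (n - 1), (i : ℕ) + 1 = j → s i * s j * s i = s j * s i * s j)
    (hf : ∀ i j : Fin (n - 1), (i : ℕ) + 1 < j → s i * s j = s j * s i)
    (hsk : ∀ j, s j * kap q μ (s j) = μ • kap q μ (s j))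
    (hks : ∀ j, kap q μ (s j) * s j = μ • kap q μ (s j))
    (hksk : ∀ i j : Fin (n - 1), (i : ℕ) + 1 = j →
      kap q μ (s i) * s j * kap q μ (s i) = μ⁻¹ • kap q μ (s i))
    (hksik : ∀ i j : Fin (n - 1), (i : ℕ) + 1 = j →
      kap q μ (s i) * t j * kap q μ (s i) = μ • kap q μ (s i)) :
    W q μ n →ₐ[ℂ] B :=
  RingQuot.liftAlgHom ℂ ⟨FreeAlgebra.lift ℂ (Sum.elim s t), by
    intro x y h
    induction h with
    | mul_inv j => simp [hst j]
    | inv_mul j => simp [hts j]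
    | braid i j h => simpa using hb i j h
    | far i j h => simpa using hf i j h
    | sk j => simpa [map_kap] using hsk j
    | ks j => simpa [map_kap] using hks j
    | ksk i j h => simpa [map_kap] using hksk i j h
    | ksik i j h => simpa [map_kap] using hksik i j h⟩

theorem W_rel {x y : PreBMW n} (h : BMWRel q μ n x y) :
    RingQuot.mkAlgHom ℂ (BMWRel q μ n) x = RingQuot.mkAlgHom ℂ (BMWRel q μ n) y :=
  RingQuot.mkAlgHom_rel ℂ h

/-- The morphism `W_n → W_m`, `σ_i ↦ σ_{i+s}`, `s + n ≤ m`. For `s = 0` it identifies `α ∈ W_n`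
with an element of `W_m`, and `α ↦ α^{↑s}` is the case `m = s + n`. -/
def up (s : ℕ) {n : ℕ} (m : ℕ) (h : s + n ≤ m) : W q μ n →ₐ[ℂ] W q μ m :=
  bmwLift (fun j => σ ⟨s + j, by omega⟩) (fun j => σinv ⟨s + j, by omega⟩)
    (fun j => by simpa [σ, σinv] using W_rel (BMWRel.mul_inv (q := q) (μ := μ) (n := m) _))
    (fun j => by simpa [σ, σinv] using W_rel (BMWRel.inv_mul (q := q) (μ := μ) (n := m) _))
    (fun i j hij => by
      simpa [σ] using W_rel (BMWRel.braid (q := q) (μ := μ) (n := m) ⟨s + i, by omega⟩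
        ⟨s + j, by omega⟩ (by simp; omega)))
    (fun i j hij => by
      simpa [σ] using W_rel (BMWRel.far (q := q) (μ := μ) (n := m) ⟨s + i, by omega⟩
        ⟨s + j, by omega⟩ (by simp; omega)))
    (fun j => by
      simpa [σ, map_kap] using W_rel (BMWRel.sk (q := q) (μ := μ) (n := m) _))
    (fun j => by
      simpa [σ, map_kap] using W_rel (BMWRel.ks (q := q) (μ := μ) (n := m) _))
    (fun i j hij => by
      simpa [σ, map_kap] using W_rel (BMWRel.ksk (q := q) (μ := μ) (n := m) ⟨s + i, by omega⟩
        ⟨s + j, by omega⟩ (by simp; omega)))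
    (fun i j hij => by
      simpa [σ, σinv, map_kap] using W_rel (BMWRel.ksik (q := q) (μ := μ) (n := m)
        ⟨s + i, by omega⟩ ⟨s + j, by omega⟩ (by simp; omega)))

/-- `q`-numbers `i_q = (q^i - q^{-i}) / (q - q⁻¹)`. -/
def qnum (q : ℂ) (i : ℕ) : ℂ := (q ^ i - (q ^ i)⁻¹) / (q - q⁻¹)

/-- `η = (q - μ)(q⁻¹ + μ) / (μ (q - q⁻¹))`. -/
def eta (q μ : ℂ) : ℂ := (q - μ) * (q⁻¹ + μ) / (μ * (q - q⁻¹))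

/-- The baxterized element `σ_{j+1}^-(x) = 1 + (x-1)/(q-q⁻¹) σ + (x-1)/(q μ⁻¹ x + 1) κ`. -/
def baxMinus (j : Fin (n - 1)) (x : ℂ) : W q μ n :=
  1 + ((x - 1) / (q - q⁻¹)) • σ j + ((x - 1) / (q * μ⁻¹ * x + 1)) • κ j

/-- `anti k` is the antisymmetrizer `a^{(k+1)} ∈ W_{k+1}`: `a^{(1)} = 1` and
`a^{(i+1)} = q^i / (i+1)_q • a^{(i)} σ_i^-(q^{-2i}) a^{(i)}`. -/
def anti (q μ : ℂ) : (k : ℕ) → W q μ (k + 1)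
  | 0 => 1
  | k + 1 =>
    (q ^ (k + 1) / qnum q (k + 2)) •
      (up 0 (k + 2) (by omega) (anti q μ k)
        * baxMinus ⟨k, by omega⟩ (q ^ (2 * (k + 1)))⁻¹
        * up 0 (k + 2) (by omega) (anti q μ k))

/-- The exponent `α ⋆ β = α β^{↑n} σ_n ⋯ σ_2 σ_1 σ_2⁻¹ ⋯ σ_n⁻¹` in `W_{n+i}`, for `α ∈ W_n`,
`β ∈ W_i`, where `n = a + 1` and `i = b + 1`. -/
def starExp {a b : ℕ} (α : W q μ (a + 1)) (β : W q μ (b + 1)) : W q μ (a + 1 + b + 1) :=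
  up 0 (a + 1 + b + 1) (by omega) α * up (a + 1) (a + 1 + b + 1) (by omega) β
    * ((List.ofFn fun j : Fin (a + 1) => σ ⟨a - j, by omega⟩).prod
      * (List.ofFn fun j : Fin a => σinv ⟨j + 1, by omega⟩).prod)

end bmw

namespace BMWPair

variable {N : ℕ} {q μ : ℂ} (D : BMWPair N q μ)

theorem R_mul_inv : D.R * D.R⁻¹ = 1 :=
  Matrix.mul_nonsing_inv _ ((Matrix.isUnit_iff_isUnit_det _).mp D.R_isRMatrix.1)

theorem R_inv_mul : D.R⁻¹ * D.R = 1 :=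
  Matrix.nonsing_inv_mul _ ((Matrix.isUnit_iff_isUnit_det _).mp D.R_isRMatrix.1)

/-- The operator `K`. -/
def K : TMat N 2 ℂ := kap q μ D.R

theorem kap_comm : D.R * D.K = D.K * D.R := by
  simp only [K, kap, mul_smul_comm, smul_mul_assoc]
  congr 1
  noncomm_ring

theorem K_mul_R : D.K * D.R = μ • D.K := by
  have h := minpoly.aeval ℂ D.R
  rw [D.R_bmw.1] at h
  simp only [map_mul, map_sub, map_add, Polynomial.aeval_X, Polynomial.aeval_C,
    Algebra.algebraMap_eq_smul_one] at h
  have h2 : (q • (1 : TMat N 2 ℂ) - D.R) * (q⁻¹ • (1 : TMat N 2 ℂ) + D.R)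
      * (D.R - μ • (1 : TMat N 2 ℂ)) = 0 := by
    have : (q • (1 : TMat N 2 ℂ) - D.R) * (q⁻¹ • (1 : TMat N 2 ℂ) + D.R)
      * (D.R - μ • (1 : TMat N 2 ℂ)) = - ((D.R - q • 1) * (D.R + q⁻¹ • 1) * (D.R - μ • 1)) := by
      rw [add_comm (q⁻¹ • (1 : TMat N 2 ℂ)), ← neg_sub D.R (q • 1), neg_mul, neg_mul]
    rw [this, h, neg_zero]
  have h3 : D.K * (D.R - μ • (1 : TMat N 2 ℂ)) = 0 := by
    rw [K, kap, smul_mul_assoc, h2, smul_zero]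
  rw [mul_sub, mul_smul_comm, mul_one, sub_eq_zero] at h3
  exact h3

theorem R_mul_K : D.R * D.K = μ • D.K := by rw [kap_comm, K_mul_R]

theorem K_mul_R_inv : D.K * D.R⁻¹ = μ⁻¹ • D.K := by
  have h : D.K = μ • (D.K * D.R⁻¹) := by
    rw [← smul_mul_assoc, ← D.K_mul_R, mul_assoc, D.R_mul_inv, mul_one]
  rw [h, smul_smul, inv_mul_cancel₀ D.mu_ne_zero, one_smul, ← h]

theorem kap_site (n s : ℕ) (h : s + 2 ≤ n) (X : TMat N 2 ℂ) :
    kap q μ (site n s h X) = site n s h (kap q μ X) := by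
  simp only [kap, site_smul, site_mul, site_sub, site_add, site_one]

theorem KRK : fst3 D.K * snd3 D.R * fst3 D.K = μ⁻¹ • fst3 D.K := by
  have h1 := D.R_bmw.2.1
  have h2 := D.R_bmw.2.2.2
  change snd3 D.K * fst3 D.K = fst3 D.R * snd3 D.R * fst3 D.K at h1
  change fst3 D.K * snd3 D.K * fst3 D.K = fst3 D.K at h2
  rw [mul_assoc, h1, ← mul_assoc, ← mul_assoc, fst3, ← site_mul, K_mul_R, site_smul,
    smul_mul_assoc, smul_mul_assoc] at h2
  have h3 := congrArg (fun x => μ⁻¹ • x) h2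
  simpa only [smul_smul, inv_mul_cancel₀ D.mu_ne_zero, one_smul] using h3

theorem KRinvK : fst3 D.K * snd3 D.R⁻¹ * fst3 D.K = μ • fst3 D.K := by
  have h1 := D.R_bmw.2.2.1
  have h2 := D.R_bmw.2.2.2
  change snd3 D.K * fst3 D.K = fst3 D.R⁻¹ * snd3 D.R⁻¹ * fst3 D.K at h1
  change fst3 D.K * snd3 D.K * fst3 D.K = fst3 D.K at h2
  rw [mul_assoc, h1, ← mul_assoc, ← mul_assoc, fst3, ← site_mul, K_mul_R_inv, site_smul,
    smul_mul_assoc, smul_mul_assoc] at h2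
  have h3 := congrArg (fun x => μ • x) h2
  simpa only [smul_smul, mul_inv_cancel₀ D.mu_ne_zero, one_smul] using h3

/-- The R-matrix representation `ρ_R` of `W_n(q, μ)`, `σ_i ↦ R_i`. -/
def rho (n : ℕ) : W q μ n →ₐ[ℂ] TMat N n ℂ :=
  bmwLift (fun j => site n j (by omega) D.R) (fun j => site n j (by omega) D.R⁻¹)
    (fun j => by rw [← site_mul, R_mul_inv, site_one])
    (fun j => by rw [← site_mul, R_inv_mul, site_one])
    (fun i j hij => by
      have h := congrArg (site n i (by omega)) D.R_isRMatrix.2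
      simp only [fst3, snd3, site_mul, site_site] at h
      obtain ⟨j, hj⟩ := j
      obtain rfl : (i : ℕ) + 1 = j := hij
      simpa only [Nat.add_zero] using h)
    (fun i j hij => by
      apply leg_comm
      intro a b hab
      have h := congrArg Fin.val hab
      rw [shiftEmb_val, shiftEmb_val] at h
      omega)
    (fun j => by
      have := D.R_mul_K
      rw [kap_site, ← site_mul, ← site_smul]
      exact congrArg _ this)
    (fun j => by
      have := D.K_mul_R
      rw [kap_site, ← site_mul, ← site_smul]
      exact congrArg _ this)
    (fun i j hij => by
      have h := congrArg (site n i (by omega)) D.KRK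
      simp only [fst3, snd3, site_mul, site_smul, site_site, K] at h
      rw [kap_site]
      obtain ⟨j, hj⟩ := j
      obtain rfl : (i : ℕ) + 1 = j := hij
      simpa only [Nat.add_zero] using h)
    (fun i j hij => by
      have h := congrArg (site n i (by omega)) D.KRinvK
      simp only [fst3, snd3, site_mul, site_smul, site_site, K] at h
      rw [kap_site]
      obtain ⟨j, hj⟩ := j
      obtain rfl : (i : ℕ) + 1 = j := hij
      simpa only [Nat.add_zero] using h)

end BMWPair

/-! ### Copies of a matrix, R-traces -/

section copies

variable {N : ℕ} {A : Type*} [Ring A] [Algebra ℂ A]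

/-- A complex matrix as a matrix over `A`. -/
def scal {n : ℕ} (X : TMat N n ℂ) : TMat N n A := X.map (algebraMap ℂ A)

/-- An `N × N` matrix as an operator on one tensor factor. -/
def toOne (M : Matrix (Fin N) (Fin N) A) : TMat N 1 A := Matrix.of fun f g => M (f 0) (g 0)

/-- `copy F M n i` is the matrix copy `M_{\overline{i+1}}` on `n` factors: `M_{\overline 1} = M₁`
and `M_{\overline{i+1}} = F_i M_{\overline i} F_i⁻¹`. -/
def copy (F : TMat N 2 ℂ) (M : Matrix (Fin N) (Fin N) A) (n : ℕ) : (i : ℕ) → i < n → TMat N n A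
  | 0, h => site n 0 (by omega) (toOne M)
  | i + 1, h => scal (site n i (by omega) F) * copy F M n i (by omega)
      * scal (site n i (by omega) F⁻¹)

/-- Trace over the factors `2, …, k + 1`, weighted by the matrix `D` in each of them. -/
def trTail (D : Matrix (Fin N) (Fin N) ℂ) {k : ℕ} (X : TMat N (k + 1) A) :
    Matrix (Fin N) (Fin N) A :=
  Matrix.of fun a b => ∑ f : Fin k → Fin N, ∑ g : Fin k → Fin N,
    (∏ j, D (f j) (g j)) • X (Fin.cons a g) (Fin.cons b f)

/-- `Tr (D M) = ∑ D_{ij} M_{ji}`. For `D = D_R` this is the R-trace. -/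
def wTr (D : Matrix (Fin N) (Fin N) ℂ) (M : Matrix (Fin N) (Fin N) A) : A :=
  ∑ i, ∑ j, D i j • M j i

/-- Right multiplication of all the entries of `X` by `c`. -/
def rmul (X : Matrix (Fin N) (Fin N) A) (c : A) : Matrix (Fin N) (Fin N) A := X.map (· * c)

end copies

/-! ### The quantum matrix algebra and its descendants -/

section algebra

variable {N : ℕ}

/-- The matrix of free generators. -/
def freeM (N : ℕ) : Matrix (Fin N) (Fin N) (FreeAlgebra ℂ (Fin N × Fin N)) :=
  Matrix.of fun a b => FreeAlgebra.ι ℂ (a, b)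

/-- The entries of the matrix relation `R₁ M_{\overline 1} M_{\overline 2} =
M_{\overline 1} M_{\overline 2} R₁`. -/
inductive QMRel (R F : TMat N 2 ℂ) :
    FreeAlgebra ℂ (Fin N × Fin N) → FreeAlgebra ℂ (Fin N × Fin N) → Prop
  | entry (f g : Fin 2 → Fin N) : QMRel R F
      ((scal R * copy F (freeM N) 2 0 (by omega) * copy F (freeM N) 2 1 (by omega) :
        TMat N 2 (FreeAlgebra ℂ (Fin N × Fin N))) f g)
      ((copy F (freeM N) 2 0 (by omega) * copy F (freeM N) 2 1 (by omega) * scal R :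
        TMat N 2 (FreeAlgebra ℂ (Fin N × Fin N))) f g)

end algebra

namespace BMWPair

variable {N : ℕ} {q μ : ℂ} (D : BMWPair N q μ)

/-- The quantum matrix algebra `M(R, F)`. -/
abbrev Alg := RingQuot (QMRel D.R D.F)

/-- `N × N` matrices over the quantum matrix algebra. -/
abbrev Mat := Matrix (Fin N) (Fin N) D.Alg

/-- The matrix of generators of the quantum matrix algebra. -/
def M : D.Mat := (freeM N).map (RingQuot.mkAlgHom ℂ (QMRel D.R D.F))

/-- The product `M_{\overline 1} ⋯ M_{\overline n}` on `n` factors. -/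
def string (n : ℕ) : TMat N n D.Alg :=
  (List.ofFn fun i : Fin n => copy D.F D.M n i i.2).prod

/-- The product `M_{\overline 2} ⋯ M_{\overline{k+1}}` on `k + 1` factors. -/
def stringTail (k : ℕ) : TMat N (k + 1) D.Alg :=
  (List.ofFn fun i : Fin k => copy D.F D.M (k + 1) (i + 1) (by omega)).prod

/-- `M^α = Tr_{R(2,…,n)} (M_{\overline 1} ⋯ M_{\overline n} ρ_R(α))`, for `α ∈ W_n`,
`n = k + 1`. -/
def matPow {k : ℕ} (α : W q μ (k + 1)) : D.Mat :=
  trTail (opD D.R) (D.string (k + 1) * scal (D.rho (k + 1) α))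

/-- `ch(α) = Tr_{R(1,…,n)} (M_{\overline 1} ⋯ M_{\overline n} ρ_R(α))`, for `α ∈ W_n`,
`n = k + 1`. -/
def ch {k : ℕ} (α : W q μ (k + 1)) : D.Alg := wTr (opD D.R) (D.matPow α)

/-- The characteristic subalgebra, as the linear span of `1` and of all `ch(α)`. -/
def charSpan : Submodule ℂ D.Alg :=
  Submodule.span ℂ ({1} ∪ {c | ∃ (k : ℕ) (α : W q μ (k + 1)), c = D.ch α})

/-- The 2-contraction `g = η⁻¹ ch(κ₁)`. -/
def g : D.Alg := (eta q μ)⁻¹ • D.ch (κ (0 : Fin (2 - 1)) : W q μ (1 + 1))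

/-- `a_0 = 1` and `a_i = ch(a^{(i)})`. -/
def a : ℕ → D.Alg
  | 0 => 1
  | k + 1 => D.ch (anti q μ k)

/-- An expression `∑ M^{α} + I c`: a finite list of exponents `α`, and an element `c`. Since
`α` ranges over the algebras `W_n`, these are all the linear combinations. -/
abbrev Expr := List (Σ k : ℕ, W q μ (k + 1)) × D.Alg

/-- The value of an expression. -/
def value (x : D.Expr) : D.Mat :=
  (x.1.map fun α => D.matPow α.2).sum + rmul 1 x.2

/-- `x` presents `X` as an element of the space `P(R, F)`, which is spanned by the matrices `M^α`
and by the multiples `I c` of the identity matrix by elements of the characteristic subalgebra. -/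
def Presents (x : D.Expr) (X : D.Mat) : Prop := x.2 ∈ D.charSpan ∧ D.value x = X

/-- The formulas `M^α ⋆ M^β = M^{α ⋆ β}`, `(I c) ⋆ M^α = M^α ⋆ (I c) = M^α c` and
`(I c) ⋆ (I d) = I (c d)`, extended by bilinearity to expressions. -/
def starValue (x y : D.Expr) : D.Mat :=
  (x.1.map fun α => (y.1.map fun β => D.matPow (starExp α.2 β.2)).sum).sum
    + (x.1.map fun α => rmul (D.matPow α.2) y.2).sum
    + (y.1.map fun β => rmul (D.matPow β.2) x.2).sum
    + rmul 1 (x.2 * y.2)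

/-- The `⋆`-product of elements `X`, `Y` of the space `P(R, F)`: the common value of
`starValue x y` over all presentations `x` of `X` and `y` of `Y` (and `0` if these values do not
agree). Outside `P(R, F)` it has no meaning. -/
def star (X Y : D.Mat) : D.Mat :=
  open Classical in
  if h : ∃ Z, ∀ x y, D.Presents x X → D.Presents y Y → D.starValue x y = Z then h.choose else 0

/-- The `⋆`-powers `M^{\overline m}` of `M`. -/
def starPow : ℕ → D.Mat
  | 0 => 1
  | m + 1 => D.star D.M (starPow m)

/-- `φ(X)₁ = Tr_{R(2)} (F₁₂ X₁ F₁₂⁻¹ R₁₂)`. -/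
def phi (X : D.Mat) : D.Mat :=
  trTail (k := 1) (opD D.R)
    (scal D.F * site 2 0 (by omega) (toOne X) * scal D.F⁻¹ * scal D.R)

/-- `ξ(X)₁ = Tr_{R(2)} (F₁₂ X₁ F₁₂⁻¹ K₁₂)`. -/
def xi (X : D.Mat) : D.Mat :=
  trTail (k := 1) (opD D.R)
    (scal D.F * site 2 0 (by omega) (toOne X) * scal D.F⁻¹ * scal D.K)

/-- The inverse map of `φ`. -/
def phiInv : D.Mat → D.Mat := Function.invFun D.phi

/-- The map `X ↦ M · ξ(X)`. -/
def Mt (X : D.Mat) : D.Mat := D.M * D.xi X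

/-- The descendants `A^{(m,i)}`, `m ≥ -1` (with the value `0` for `m < -1`):
`A^{(m,0)} = 0`, and for `i ≥ 1`, `A^{(m,i)} = i_q M^{\overline m} ⋆ M^{a^{(i)}}` if `m ≥ 0` and
`A^{(-1,i)} = i_q φ⁻¹(Tr_{R(2,…,i)} M_{\overline 2} ⋯ M_{\overline i} ρ_R(a^{(i)}))`. -/
def descA : ℤ → ℕ → D.Mat
  | _, 0 => 0
  | Int.ofNat m, k + 1 => qnum q (k + 1) • D.star (D.starPow m) (D.matPow (anti q μ k))
  | Int.negSucc 0, k + 1 => qnum q (k + 1) •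
      D.phiInv (trTail (opD D.R) (D.stringTail k * scal (D.rho (k + 1) (anti q μ k))))
  | Int.negSucc (_ + 1), _ + 1 => 0

/-- The descendants `B^{(m,i)}`, `m ≥ 0`: `B^{(m,0)} = 0`, and for `i ≥ 1`,
`B^{(m+1,i)} = i_q M^{\overline m} ⋆ Mt(M^{a^{(i)}})` and `B^{(0,i)} = i_q φ⁻¹(ξ(M^{a^{(i)}}))`. -/
def descB : ℕ → ℕ → D.Mat
  | _, 0 => 0
  | 0, k + 1 => qnum q (k + 1) • D.phiInv (D.xi (D.matPow (anti q μ k)))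
  | m + 1, k + 1 =>
      qnum q (k + 1) • D.star (D.starPow m) (D.Mt (D.matPow (anti q μ k)))

end BMWPair

end QMA

end

/-! Left ⋆-multiplication by M is the map X ↦ M · φ(X) (`mulM`), and φ is bijective. Applied to
φ⁻¹(Tr M_{\bar 2} ⋯ M_{\bar i} ρ(a^{(i)})) this map gives M^{a^{(i)}}, and applied to φ⁻¹(ξ(X)) it
gives M^⊤(X). So for fixed i the families m ↦ A^{(m-1,i)} and m ↦ B^{(m,i)} are orbits of one map,
and the exceptional members A^{(-1,i)}, B^{(0,i)} are their starting points. The map is linear and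
commutes with right multiplication of the entries, hence both formulas follow from the case m = 0.

For m = 0 the antisymmetrizer is expanded at its first strand: up to the factor q^i/(i+1)_q,
a^{(i+1)} is a^{(i)↑1} σ_1^-(q^{-2i}) a^{(i)↑1} (`anti_succ`). In φ(A^{(-1,i+1)}) the first strand
carries no M, the two copies of the idempotent merge under the trace, and the terms 1, σ_1, κ_1 give
I a_i, φ(M^{a^{(i)}}), ξ(M^{a^{(i)}}); applying φ⁻¹ yields the first formula. For B^{(1,i+1)} the
exponent is a^{(i+1)↑1} κ_1. After writing σ_2 = σ_2⁻¹ + (q - q⁻¹)(1 - κ_2), the exponents α κ_1, α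
κ_2 κ_1 and α σ_2⁻¹ κ_1 remain, with α = a^{(i)↑2}. The first two are evaluated by M_{\bar 1}
M_{\bar 2} K_1 = μ⁻² g K_1 (`M_M_K`), which holds because K has rank one; the third gives
φ⁻¹(ξ(M^{a^{(i)}})) g (`phi_matPow_up_σinv_κ`).

Three groups of facts support this. The antisymmetrizers absorb all generators by fusion, a
consequence of the Yang-Baxter equation for baxterized elements (`absorb_step`, `absorbs_anti`).
R-traces are not affected by conjugation with F^{±1} or R^{±1} and are cyclic for R-matrices
(`Twists.ptr_conj`, `Twists.ptr_cyclic`); with the invertibility of D_R this gives the inverse of φ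
(`twistTr_bijective`). Finally ⋆ does not depend on presentations, because right ⋆-multiplication by
M^β is the restriction of an additive map defined on all matrices (`starRight`, `star_eq`).

The calculations take place in one algebra of operators on infinitely many factors. There factors
are numbered from 0, so `opS 0 R` is R₁; subscripts in the comments count from 1. -/

noncomputable section
namespace QMA

/-! ### Operators on infinitely many tensor factors -/

/-- Operators on functions of infinitely many indices; all strand numbers act in this algebra. -/
def Op (N : ℕ) (A : Type*) [Ring A] [Algebra ℂ A] := Module.End ℂ ((ℕ → Fin N) → A)

section op

variable {N : ℕ} {A : Type*} [Ring A] [Algebra ℂ A]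

instance : Ring (Op N A) := inferInstanceAs (Ring (Module.End ℂ ((ℕ → Fin N) → A)))
instance : Algebra ℂ (Op N A) := inferInstanceAs (Algebra ℂ (Module.End ℂ ((ℕ → Fin N) → A)))
instance : FunLike (Op N A) ((ℕ → Fin N) → A) ((ℕ → Fin N) → A) :=
  inferInstanceAs (FunLike (Module.End ℂ ((ℕ → Fin N) → A)) _ _)

theorem Op.ext {X Y : Op N A} (h : ∀ v f, X v f = Y v f) : X = Y :=
  LinearMap.ext fun v => funext fun f => h v f

theorem Op.mul_apply (X Y : Op N A) (v : (ℕ → Fin N) → A) : (X * Y) v = X (Y v) := rfl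
theorem Op.one_apply (v : (ℕ → Fin N) → A) : (1 : Op N A) v = v := rfl
theorem Op.add_apply (X Y : Op N A) (v : (ℕ → Fin N) → A) (f) : (X + Y) v f = X v f + Y v f := rfl
theorem Op.smul_apply (c : ℂ) (X : Op N A) (v : (ℕ → Fin N) → A) (f) :
    (c • X) v f = c • X v f := rfl
theorem Op.sum_apply {ι : Type*} (s : Finset ι) (X : ι → Op N A) (v : (ℕ → Fin N) → A) (f) :
    (∑ i ∈ s, X i) v f = ∑ i ∈ s, X i v f := by
  change (LinearMap.applyₗ v (∑ i ∈ s, X i)) f = _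
  erw [map_sum]
  rw [Finset.sum_apply]
  rfl

theorem extend_extend {k : ℕ} (e : Fin k ↪ ℕ) (x y : Fin k → Fin N) (f : ℕ → Fin N) :
    Function.extend e y (Function.extend e x f) = Function.extend e y f := by
  funext j
  by_cases hj : ∃ i, e i = j
  · obtain ⟨i, rfl⟩ := hj
    simp [e.injective.extend_apply]
  · simp [Function.extend_apply' _ _ _ hj]

theorem extend_emb_comp {k : ℕ} (e : Fin k ↪ ℕ) (x : Fin k → Fin N) (f : ℕ → Fin N) :
    Function.extend e x f ∘ e = x := by
  funext i
  simp [e.injective.extend_apply]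

theorem extend_comp_self {k : ℕ} (e : Fin k ↪ ℕ) (f : ℕ → Fin N) :
    Function.extend e (f ∘ e) f = f := by
  funext j
  by_cases hj : ∃ i, e i = j
  · obtain ⟨i, rfl⟩ := hj
    simp [e.injective.extend_apply]
  · simp [Function.extend_apply' _ _ _ hj]

/-- The operator `X` acting in the factors `e 0, …, e (k - 1)`. -/
def opLegFun {k : ℕ} (e : Fin k ↪ ℕ) (X : TMat N k A) : Op N A :=
  ({ toFun := fun v f => ∑ x, X (f ∘ e) x * v (Function.extend e x f)
     map_add' := fun v w => by
      funext f
      simp [mul_add, Finset.sum_add_distrib]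
     map_smul' := fun c v => by
      funext f
      simp [Finset.smul_sum] } : Module.End ℂ ((ℕ → Fin N) → A))

theorem opLegFun_apply {k : ℕ} (e : Fin k ↪ ℕ) (X : TMat N k A) (v : (ℕ → Fin N) → A) (f) :
    opLegFun e X v f = ∑ x, X (f ∘ e) x * v (Function.extend e x f) := rfl

/-- `opLegFun` as a morphism of algebras. -/
def opLeg {k : ℕ} (e : Fin k ↪ ℕ) : TMat N k A →ₐ[ℂ] Op N A :=
  AlgHom.ofLinearMap
    { toFun := opLegFun e
      map_add' := fun X Y => Op.ext fun v f => by
        rw [Op.add_apply]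
        simp only [opLegFun_apply, Matrix.add_apply, add_mul, Finset.sum_add_distrib]
      map_smul' := fun c X => Op.ext fun v f => by
        rw [RingHom.id_apply, Op.smul_apply]
        simp only [opLegFun_apply, Matrix.smul_apply, smul_mul_assoc, Finset.smul_sum] }
    (Op.ext fun v f => by
      change opLegFun e 1 v f = v f
      rw [opLegFun_apply, Finset.sum_eq_single (f ∘ e)]
      · rw [Matrix.one_apply_eq, one_mul, extend_comp_self]
      · intro x _ hx
        rw [Matrix.one_apply_ne hx.symm, zero_mul]
      · simp)
    (fun X Y => Op.ext fun v f => by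
      change opLegFun e (X * Y) v f = opLegFun e X (opLegFun e Y v) f
      simp only [opLegFun_apply, Matrix.mul_apply, Finset.sum_mul, Finset.mul_sum,
        extend_emb_comp, extend_extend, mul_assoc]
      rw [Finset.sum_comm])

theorem opLeg_apply {k : ℕ} (e : Fin k ↪ ℕ) (X : TMat N k A) (v : (ℕ → Fin N) → A) (f) :
    opLeg e X v f = ∑ x, X (f ∘ e) x * v (Function.extend e x f) := rfl

/-- In the sum over the larger block `leg` vanishes unless the index agrees with `f ∘ e` outside the
range of `e'`; the surviving indices are parametrized by the smaller block. In this way tensor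
powers of all sizes meet in one algebra. -/
theorem opLeg_leg {k n : ℕ} (e : Fin n ↪ ℕ) (e' : Fin k ↪ Fin n) (X : TMat N k A) :
    opLeg e (leg e' X) = opLeg (e'.trans e) X := by
  refine Op.ext fun v f => ?_
  rw [opLeg_apply, opLeg_apply]
  symm
  apply Finset.sum_of_injOn (fun x => Function.extend e' x (f ∘ e))
  · intro x _ y _ hxy
    have := congrArg (fun z => z ∘ e') hxy
    simpa only [extend_comp] using this
  · intro x _
    simp
  · intro h _ hh
    rw [leg_apply_zero, zero_mul]
    intro h'
    apply hh
    refine ⟨h ∘ e', by simp, ?_⟩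
    funext j
    by_cases hj : j ∈ Set.range e'
    · obtain ⟨i, rfl⟩ := hj
      simp [e'.injective.extend_apply]
    · dsimp only
      rw [Function.extend_apply' _ _ _ (by simpa using hj)]
      exact h' j hj
  · intro x _
    rw [leg_apply, extend_comp]
    · congr 2
      funext j
      by_cases hj : ∃ i, e i = j
      · obtain ⟨i, rfl⟩ := hj
        rw [e.injective.extend_apply]
        by_cases hi : ∃ l, e' l = i
        · obtain ⟨l, rfl⟩ := hi
          rw [e'.injective.extend_apply]
          exact (e'.trans e).injective.extend_apply _ _ l
        · rw [Function.extend_apply' _ _ _ hi, Function.extend_apply']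
          · rfl
          · rintro ⟨l, hl⟩
            exact hi ⟨l, e.injective hl⟩
      · rw [Function.extend_apply' _ _ _ hj, Function.extend_apply']
        rintro ⟨l, hl⟩
        exact hj ⟨e' l, hl⟩
    · intro j hj
      rw [Function.extend_apply' _ _ _ (by simpa using hj)]

/-- Entries may fail to commute, so disjointness of the factors is not enough. In every use at least
one of the two operators has complex entries. -/
theorem opLeg_comm {k l : ℕ} (e : Fin k ↪ ℕ) (e' : Fin l ↪ ℕ) (hd : ∀ i j, e i ≠ e' j)
    (X : TMat N k A) (Y : TMat N l A) (hXY : ∀ a b c d, Commute (X a b) (Y c d)) :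
    Commute (opLeg e X) (opLeg e' Y) := by
  refine Op.ext fun v f => ?_
  rw [Op.mul_apply, Op.mul_apply]
  have h1 : ∀ x : Fin k → Fin N, Function.extend e x f ∘ e' = f ∘ e' := fun x => by
    funext i
    exact Function.extend_apply' _ _ _ (by rintro ⟨a, ha⟩; exact hd a i ha)
  have h2 : ∀ x : Fin l → Fin N, Function.extend e' x f ∘ e = f ∘ e := fun x => by
    funext i
    exact Function.extend_apply' _ _ _ (by rintro ⟨a, ha⟩; exact hd i a ha.symm)
  have h3 : ∀ x y, Function.extend e' y (Function.extend e x f)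
      = Function.extend e x (Function.extend e' y f) := fun x y => by
    funext j
    by_cases hj : ∃ i, e i = j
    · obtain ⟨i, rfl⟩ := hj
      rw [e.injective.extend_apply, Function.extend_apply', e.injective.extend_apply]
      rintro ⟨a, ha⟩
      exact hd i a ha.symm
    · rw [Function.extend_apply' x _ _ hj]
      by_cases hj' : ∃ i, e' i = j
      · obtain ⟨i, rfl⟩ := hj'
        rw [e'.injective.extend_apply, e'.injective.extend_apply]
      · rw [Function.extend_apply' _ _ _ hj', Function.extend_apply' _ _ _ hj',
          Function.extend_apply' _ _ _ hj]
  simp only [opLeg_apply, h1, h2, Finset.mul_sum]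
  rw [Finset.sum_comm]
  refine Finset.sum_congr rfl fun y _ => Finset.sum_congr rfl fun x _ => ?_
  rw [h3, ← mul_assoc, ← mul_assoc, (hXY _ _ _ _).eq]

/-- The embedding of consecutive factors starting with the factor `s`. -/
def at' (s k : ℕ) : Fin k ↪ ℕ := ⟨fun j => s + j, fun a b h => Fin.ext (by simpa using h)⟩

theorem at'_apply (s k : ℕ) (j : Fin k) : at' s k j = s + j := rfl

theorem opLeg_site {k n : ℕ} (t s : ℕ) (h : s + k ≤ n) (X : TMat N k A) :
    opLeg (at' t n) (site n s h X) = opLeg (at' (t + s) k) X := by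
  have h' : (shiftEmb s h).trans (at' t n) = at' (t + s) k :=
    Function.Embedding.ext fun j => (add_assoc t s (j : ℕ)).symm
  rw [site, opLeg_leg, h']

/-- Scalar matrices as a morphism of algebras. -/
def scalHom {n : ℕ} : TMat N n ℂ →ₐ[ℂ] TMat N n A := (Algebra.ofId ℂ A).mapMatrix

/-- A complex operator acting in consecutive factors. -/
def opS (s : ℕ) {k : ℕ} : TMat N k ℂ →ₐ[ℂ] Op N A := (opLeg (at' s k)).comp scalHom

theorem opS_apply (s : ℕ) {k : ℕ} (X : TMat N k ℂ) :
    (opS s X : Op N A) = opLeg (at' s k) (scal X) := rfl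

theorem scal_leg {k n : ℕ} (e : Fin k ↪ Fin n) (X : TMat N k ℂ) :
    (scal (leg e X) : TMat N n A) = leg e (scal X) := by
  ext f g
  by_cases h : ∀ j, j ∉ Set.range e → f j = g j
  · simp only [scal, Matrix.map_apply, leg_apply e _ f g h]
  · simp only [scal, Matrix.map_apply, leg_apply_zero e _ f g h, map_zero]

theorem opS_site {k n : ℕ} (t s : ℕ) (h : s + k ≤ n) (X : TMat N k ℂ) :
    (opS t (site n s h X) : Op N A) = opS (t + s) X := by
  rw [opS_apply, site, scal_leg, ← site, opLeg_site, opS_apply]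

/-- Left multiplication by an element of the algebra. -/
def opA : A →ₐ[ℂ] Op N A :=
  AlgHom.ofLinearMap
    { toFun := fun a => ({ toFun := fun v f => a * v f
                           map_add' := fun v w => funext fun f => by simp [mul_add]
                           map_smul' := fun c v => funext fun f => by simp } :
                           Module.End ℂ ((ℕ → Fin N) → A))
      map_add' := fun a b => Op.ext fun v f => add_mul a b (v f)
      map_smul' := fun c a => Op.ext fun v f => smul_mul_assoc c a (v f) }
    (Op.ext fun v f => one_mul (v f))
    (fun a b => Op.ext fun v f => mul_assoc a b (v f))

theorem opA_apply (a : A) (v : (ℕ → Fin N) → A) (f) : opA a v f = a * v f := rfl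

theorem opA_comm_opS (a : A) (s : ℕ) {k : ℕ} (X : TMat N k ℂ) :
    Commute (opA a : Op N A) (opS s X) := by
  refine Op.ext fun v f => ?_
  rw [Op.mul_apply, Op.mul_apply, opA_apply, opS_apply, opLeg_apply, opLeg_apply, Finset.mul_sum]
  refine Finset.sum_congr rfl fun x _ => ?_
  rw [opA_apply, ← mul_assoc, ← mul_assoc]
  congr 1
  exact (Algebra.commutes _ _).symm

/-- Matrix units in the factor `j`. -/
def eu (j : ℕ) (a b : Fin N) : Op N A := opS j (toOne (Matrix.single a b (1 : ℂ)))

theorem eu_apply (j : ℕ) (a b : Fin N) (v : (ℕ → Fin N) → A) (f) :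
    eu j a b v f = if f j = a then v (Function.update f j b) else 0 := by
  rw [eu, opS_apply, opLeg_apply, Finset.sum_eq_single (fun _ => b)]
  · have : Function.extend (at' j 1) (fun _ => b) f = Function.update f j b := by
      funext l
      by_cases hl : l = j
      · subst hl
        rw [Function.update_self]
        exact (at' l 1).injective.extend_apply _ _ (0 : Fin 1)
      · rw [Function.update_of_ne hl, Function.extend_apply']
        rintro ⟨i, hi⟩
        apply hl
        rw [← hi, at'_apply]
        omega
    rw [this]
    simp [scal, toOne, Matrix.single_apply, at'_apply, eq_comm]
  · intro x _ hx
    have : x 0 ≠ b := fun h => hx (by funext i; rw [Subsingleton.elim i 0, h])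
    simp [scal, toOne, Matrix.single_apply, this.symm]
  · simp

theorem opS_comm (s t : ℕ) {k l : ℕ} (h : s + k ≤ t ∨ t + l ≤ s) (X : TMat N k ℂ)
    (Y : TMat N l ℂ) : Commute (opS s X : Op N A) (opS t Y) := by
  apply opLeg_comm
  · intro i j
    rw [at'_apply, at'_apply]
    omega
  · intro a b c d
    exact Algebra.commutes _ _

theorem toOne_mul {B : Type*} [Ring B] (X Y : Matrix (Fin N) (Fin N) B) : toOne (X * Y) = toOne X * toOne Y := by
  ext f g
  simp only [toOne, Matrix.of_apply, Matrix.mul_apply]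
  exact (Equiv.sum_comp (Equiv.funUnique (Fin 1) (Fin N)) fun x => X (f 0) x * Y x (g 0)).symm

theorem toOne_one {B : Type*} [Ring B] : toOne (1 : Matrix (Fin N) (Fin N) B) = 1 := by
  ext f g
  simp only [toOne, Matrix.of_apply, Matrix.one_apply]
  congr 1
  apply propext
  exact ⟨fun h => funext fun i => by rw [Subsingleton.elim i 0, h], fun h => congrFun h 0⟩

theorem eu_mul (j : ℕ) (a b c d : Fin N) :
    (eu j a b * eu j c d : Op N A) = if b = c then eu j a d else 0 := by
  rw [eu, eu, ← map_mul, ← toOne_mul]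
  by_cases h : b = c
  · subst h
    rw [Matrix.single_mul_single_same, one_mul, if_pos rfl, eu]
  · rw [Matrix.single_mul_single_of_ne _ _ _ _ h, if_neg h]
    have : toOne (0 : Matrix (Fin N) (Fin N) ℂ) = 0 := rfl
    rw [this, map_zero]

theorem eu_sum (j : ℕ) : (∑ a, eu j a a : Op N A) = 1 := by
  refine Op.ext fun v f => ?_
  rw [Op.sum_apply]
  simp [eu_apply, Op.one_apply]

theorem eu_comm {i j : ℕ} (h : i ≠ j) (a b c d : Fin N) :
    Commute (eu i a b : Op N A) (eu j c d) := opS_comm _ _ (by omega) _ _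

/-- A matrix over `A` acting in the factor `0`. -/
def iota (X : Matrix (Fin N) (Fin N) A) : Op N A := opLeg (at' 0 1) (toOne X)

theorem iota_apply (X : Matrix (Fin N) (Fin N) A) (v : (ℕ → Fin N) → A) (f) :
    iota X v f = ∑ b, X (f 0) b * v (Function.update f 0 b) := by
  rw [iota, opLeg_apply, ← Equiv.sum_comp (Equiv.funUnique (Fin 1) (Fin N)).symm]
  refine Finset.sum_congr rfl fun b _ => ?_
  have : Function.extend (at' 0 1) ((Equiv.funUnique (Fin 1) (Fin N)).symm b) f
      = Function.update f 0 b := by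
    funext l
    by_cases hl : l = 0
    · subst hl
      rw [Function.update_self]
      exact (at' 0 1).injective.extend_apply _ _ (0 : Fin 1)
    · rw [Function.update_of_ne hl, Function.extend_apply']
      rintro ⟨i, hi⟩
      apply hl
      rw [← hi, at'_apply]
      omega
  rw [this]
  rfl

theorem iota_eq_sum (X : Matrix (Fin N) (Fin N) A) :
    iota X = ∑ a, ∑ b, opA (X a b) * eu 0 a b := by
  refine Op.ext fun v f => ?_
  simp only [iota_apply, Op.sum_apply, Op.mul_apply, opA_apply, eu_apply]
  rw [Finset.sum_comm]
  simp

/-- A matrix is determined by its action in the factor 0. Identities of matrices are therefore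
proved after applying `iota`. -/
theorem iota_injective : Function.Injective (iota : Matrix (Fin N) (Fin N) A → Op N A) := by
  intro X Y h
  ext a b
  -- The entry at (a, b) is recovered by applying the operator to the indicator function of `f 0 =
  -- b` and evaluating at the constant index a.
  have := congrArg (fun Z : Op N A => Z (fun f => if f 0 = b then 1 else 0) (fun _ => a)) h
  simpa [iota_apply] using this

theorem iota_mul (X Y : Matrix (Fin N) (Fin N) A) : iota (X * Y) = iota X * iota Y := by
  rw [iota, toOne_mul, map_mul, iota, iota]

theorem iota_one : iota (1 : Matrix (Fin N) (Fin N) A) = 1 := by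
  rw [iota, toOne_one, map_one]

theorem iota_add (X Y : Matrix (Fin N) (Fin N) A) : iota (X + Y) = iota X + iota Y :=
  map_add (opLeg (at' 0 1)) (toOne X) (toOne Y)

theorem iota_sub (X Y : Matrix (Fin N) (Fin N) A) : iota (X - Y) = iota X - iota Y :=
  map_sub (opLeg (at' 0 1)) (toOne X) (toOne Y)

theorem iota_smul (c : ℂ) (X : Matrix (Fin N) (Fin N) A) : iota (c • X) = c • iota X :=
  map_smul (opLeg (at' 0 1)) c (toOne X)

theorem iota_zero : iota (0 : Matrix (Fin N) (Fin N) A) = 0 :=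
  map_zero (opLeg (at' 0 1))

/-- `opA c` acts on the function first, so `c` ends up to the right of the entries of `X`. -/
theorem iota_rmul (X : Matrix (Fin N) (Fin N) A) (c : A) : iota (rmul X c) = iota X * opA c := by
  refine Op.ext fun v f => ?_
  simp only [iota_apply, Op.mul_apply, opA_apply, rmul, Matrix.map_apply, mul_assoc]

theorem iota_comm_eu (X : Matrix (Fin N) (Fin N) A) {j : ℕ} (hj : j ≠ 0) (a b : Fin N) :
    Commute (iota X) (eu j a b) := by
  rw [iota, eu, opS_apply]
  apply opLeg_comm
  · intro i l
    rw [at'_apply, at'_apply]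
    omega
  · intro a b c d
    exact (Algebra.commutes _ _).symm

end op
end QMA
end

noncomputable section
namespace QMA

/-! ### Weighted partial traces -/

section ptrace

variable {N : ℕ} {A : Type*} [Ring A] [Algebra ℂ A]

/-- Operators that act as the identity in the factor `j`. -/
def cm (N : ℕ) (A : Type*) [Ring A] [Algebra ℂ A] (j : ℕ) : Subalgebra ℂ (Op N A) :=
  Subalgebra.centralizer ℂ {x | ∃ a b, x = eu j a b}

theorem mem_cm {j : ℕ} {X : Op N A} : X ∈ cm N A j ↔ ∀ a b, Commute (eu j a b) X := by
  rw [cm, Subalgebra.mem_centralizer_iff]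
  constructor
  · intro h a b
    exact h _ ⟨a, b, rfl⟩
  · rintro h _ ⟨a, b, rfl⟩
    exact h a b

theorem opS_mem_cm {j s k : ℕ} (h : j < s ∨ s + k ≤ j) (X : TMat N k ℂ) : opS s X ∈ cm N A j :=
  mem_cm.2 fun _ _ => opS_comm _ _ (by omega) _ _

theorem eu_mem_cm {i j : ℕ} (h : i ≠ j) (a b : Fin N) : eu i a b ∈ cm N A j :=
  opS_mem_cm (by omega) _

theorem opA_mem_cm (j : ℕ) (a : A) : opA a ∈ cm N A j :=
  mem_cm.2 fun _ _ => (opA_comm_opS _ _ _).symm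

theorem iota_mem_cm (X : Matrix (Fin N) (Fin N) A) {j : ℕ} (hj : j ≠ 0) : iota X ∈ cm N A j :=
  mem_cm.2 fun _ _ => (iota_comm_eu X hj _ _).symm

/-- The trace over the factor `j`, weighted by `D`; the result acts as the identity there. -/
def ptr (D : Matrix (Fin N) (Fin N) ℂ) (j : ℕ) : Op N A →ₗ[ℂ] Op N A where
  toFun X := ∑ a, ∑ b, ∑ c, D a b • (eu j c b * X * eu j a c)
  map_add' X Y := by simp only [mul_add, add_mul, smul_add, Finset.sum_add_distrib]
  map_smul' r X := by
    simp only [mul_smul_comm, smul_mul_assoc, Finset.smul_sum, RingHom.id_apply]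
    simp only [smul_comm r]

theorem ptr_apply (D : Matrix (Fin N) (Fin N) ℂ) (j : ℕ) (X : Op N A) :
    ptr D j X = ∑ a, ∑ b, ∑ c, D a b • (eu j c b * X * eu j a c) := rfl

variable (D : Matrix (Fin N) (Fin N) ℂ)

theorem ptr_mul_left {j : ℕ} {X : Op N A} (hX : X ∈ cm N A j) (Y : Op N A) :
    ptr D j (X * Y) = X * ptr D j Y := by
  rw [mem_cm] at hX
  simp only [ptr_apply, Finset.mul_sum, mul_smul_comm]
  refine Finset.sum_congr rfl fun a _ => Finset.sum_congr rfl fun b _ =>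
    Finset.sum_congr rfl fun c _ => ?_
  rw [← mul_assoc, (hX c b).eq]
  simp only [mul_assoc]

theorem ptr_mul_right {j : ℕ} {X : Op N A} (hX : X ∈ cm N A j) (Y : Op N A) :
    ptr D j (Y * X) = ptr D j Y * X := by
  rw [mem_cm] at hX
  simp only [ptr_apply, Finset.sum_mul, smul_mul_assoc]
  refine Finset.sum_congr rfl fun a _ => Finset.sum_congr rfl fun b _ =>
    Finset.sum_congr rfl fun c _ => ?_
  rw [mul_assoc, mul_assoc, ← (hX a c).eq]
  simp only [mul_assoc]

/-- The sum over `c` puts the identity back into the traced factor. Multiplication by `eu j p r`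
selects `c = r` from the left and `c = p` from the right, with the same result. -/
theorem ptr_mem_cm_self (j : ℕ) (X : Op N A) : ptr D j X ∈ cm N A j := by
  rw [mem_cm]
  intro p r
  rw [Commute, SemiconjBy, ptr_apply]
  simp only [Finset.mul_sum, Finset.sum_mul, mul_smul_comm, smul_mul_assoc]
  refine Finset.sum_congr rfl fun a _ => Finset.sum_congr rfl fun b _ => ?_
  rw [Finset.sum_eq_single r, Finset.sum_eq_single p]
  · rw [← mul_assoc, ← mul_assoc, eu_mul, if_pos rfl, mul_assoc _ (eu j a p), eu_mul, if_pos rfl]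
  · intro c _ hc
    rw [mul_assoc _ (eu j a c), eu_mul, if_neg hc, mul_zero, smul_zero]
  · simp
  · intro c _ hc
    rw [← mul_assoc, ← mul_assoc, eu_mul, if_neg (Ne.symm hc), zero_mul, zero_mul, smul_zero]
  · simp

theorem ptr_mem_cm {i j : ℕ} {X : Op N A} (hX : X ∈ cm N A i) : ptr D j X ∈ cm N A i := by
  by_cases h : i = j
  · subst h
    exact ptr_mem_cm_self D i X
  · rw [ptr_apply]
    refine sum_mem fun a _ => sum_mem fun b _ => sum_mem fun c _ => ?_
    exact Subalgebra.smul_mem _ (mul_mem (mul_mem (eu_mem_cm (Ne.symm h) _ _) hX)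
      (eu_mem_cm (Ne.symm h) _ _)) _

theorem ptr_eu (j : ℕ) (p r : Fin N) : ptr D j (eu j p r : Op N A) = D r p • 1 := by
  rw [ptr_apply, Finset.sum_eq_single r, Finset.sum_eq_single p]
  · simp only [eu_mul, if_pos]
    rw [← Finset.smul_sum, eu_sum]
  · intro b _ hb
    simp only [eu_mul, if_neg hb, zero_mul, smul_zero, Finset.sum_const_zero]
  · simp
  · intro a _ ha
    refine Finset.sum_eq_zero fun b _ => Finset.sum_eq_zero fun c _ => ?_
    rw [mul_assoc, eu_mul j p, if_neg (Ne.symm ha), mul_zero, smul_zero]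
  · simp

theorem ptr_one (j : ℕ) : ptr D j (1 : Op N A) = D.trace • 1 := by
  rw [← eu_sum j, map_sum]
  simp only [ptr_eu, ← Finset.sum_smul, Matrix.trace, Matrix.diag, eu_sum]

theorem ptr_of_mem {j : ℕ} {X : Op N A} (hX : X ∈ cm N A j) : ptr D j X = D.trace • X := by
  rw [← mul_one X, ptr_mul_left D hX, ptr_one, mul_smul_comm, mul_one]

/-- The coefficient of `eu j a b` in the expansion of `X`. -/
def coeffAt (j : ℕ) (a b : Fin N) (X : Op N A) : Op N A := ∑ c, eu j c a * X * eu j b c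

theorem coeffAt_mem_self (j : ℕ) (a b : Fin N) (X : Op N A) : coeffAt j a b X ∈ cm N A j := by
  have : coeffAt j a b X = ptr (Matrix.single b a 1) j X := by
    rw [ptr_apply, Finset.sum_eq_single b, Finset.sum_eq_single a]
    · simp [coeffAt]
    · intro c _ hc
      simp [Ne.symm hc]
    · simp
    · intro c _ hc
      simp [Ne.symm hc]
    · simp
  rw [this]
  exact ptr_mem_cm_self _ _ _

theorem coeffAt_mem {i j : ℕ} (a b : Fin N) {X : Op N A} (hX : X ∈ cm N A i) (h : i ≠ j) :
    coeffAt j a b X ∈ cm N A i :=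
  sum_mem fun _ _ => mul_mem (mul_mem (eu_mem_cm h.symm _ _) hX) (eu_mem_cm h.symm _ _)

theorem eq_sum_coeffAt (j : ℕ) (X : Op N A) : X = ∑ a, ∑ b, eu j a b * coeffAt j a b X := by
  have h1 : ∀ a b, eu j a b * coeffAt j a b X = eu j a a * X * eu j b b := by
    intro a b
    rw [coeffAt, Finset.mul_sum, Finset.sum_eq_single b]
    · rw [← mul_assoc, ← mul_assoc, eu_mul, if_pos rfl]
    · intro c _ hc
      rw [← mul_assoc, ← mul_assoc, eu_mul, if_neg (Ne.symm hc), zero_mul, zero_mul]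
    · simp
  simp only [h1]
  simp only [← Finset.mul_sum, eu_sum, mul_one]
  rw [← Finset.sum_mul, eu_sum, one_mul]

/-- Together with `eq_sum_coeffAt` this exhibits operators as N × N matrices over the commutant of
the matrix units in the factor j. Coefficients can thus be compared, and trace formulas need to be
checked on matrix units only. -/
theorem coeffAt_sum (j : ℕ) (Y : Fin N → Fin N → Op N A) (hY : ∀ a b, Y a b ∈ cm N A j)
    (a b : Fin N) : coeffAt j a b (∑ a, ∑ b, eu j a b * Y a b) = Y a b := by
  rw [coeffAt]
  have : ∀ c, eu j c a * (∑ a, ∑ b, eu j a b * Y a b) * eu j b c = eu j c c * Y a b := by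
    intro c
    simp only [Finset.mul_sum, Finset.sum_mul]
    rw [Finset.sum_eq_single a, Finset.sum_eq_single b]
    · rw [← mul_assoc, eu_mul, if_pos rfl, mul_assoc, ← (mem_cm.1 (hY a b) b c).eq, ← mul_assoc,
        eu_mul, if_pos rfl]
    · intro d _ hd
      rw [← mul_assoc, eu_mul, if_pos rfl, mul_assoc, ← (mem_cm.1 (hY a d) b c).eq, ← mul_assoc,
        eu_mul, if_neg hd, zero_mul]
    · simp
    · intro d _ hd
      refine Finset.sum_eq_zero fun b _ => ?_
      rw [← mul_assoc, eu_mul, if_neg (Ne.symm hd), zero_mul, zero_mul]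
    · simp
  simp only [this]
  rw [← Finset.sum_mul, eu_sum, one_mul]

theorem opS_one_eq (j : ℕ) (X : Matrix (Fin N) (Fin N) ℂ) :
    (opS j (toOne X) : Op N A) = ∑ a, ∑ b, X a b • eu j a b := by
  have h : (toOne X : TMat N 1 ℂ)
      = ∑ a, ∑ b, X a b • toOne (Matrix.single a b (1 : ℂ)) := by
    ext f g
    simp only [toOne, Matrix.sum_apply, Matrix.smul_apply, Matrix.of_apply, Matrix.single_apply]
    rw [Finset.sum_eq_single (f 0), Finset.sum_eq_single (g 0)]
    · simp
    · intro b _ hb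
      simp [hb]
    · simp
    · intro b _ hb
      simp [hb]
    · simp
  rw [h]
  simp only [map_sum, map_smul]
  rfl

theorem extend_at'_two (j : ℕ) (x : Fin 2 → Fin N) (f : ℕ → Fin N) :
    Function.extend (at' j 2) x f = Function.update (Function.update f j (x 0)) (j + 1) (x 1) := by
  funext l
  by_cases hl : l = j + 1
  · subst hl
    rw [Function.update_self]
    exact (at' j 2).injective.extend_apply _ _ (1 : Fin 2)
  · rw [Function.update_of_ne hl]
    by_cases hl' : l = j
    · subst hl'
      rw [Function.update_self]
      exact (at' l 2).injective.extend_apply _ _ (0 : Fin 2)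
    · rw [Function.update_of_ne hl', Function.extend_apply']
      rintro ⟨i, hi⟩
      rw [at'_apply] at hi
      omega

theorem opS_two_eq (j : ℕ) (X : TMat N 2 ℂ) :
    (opS j X : Op N A) = ∑ a, ∑ c, ∑ a', ∑ c', X ![a, c] ![a', c'] •
      (eu j a a' * eu (j + 1) c c') := by
  refine Op.ext fun v f => ?_
  simp only [Op.sum_apply, Op.smul_apply, Op.mul_apply, eu_apply]
  rw [opS_apply, opLeg_apply, Finset.sum_eq_single (f j), Finset.sum_eq_single (f (j + 1))]
  · rw [← Equiv.sum_comp (finTwoArrowEquiv (Fin N)).symm, Fintype.sum_prod_type]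
    refine Finset.sum_congr rfl fun a' _ => Finset.sum_congr rfl fun c' _ => ?_
    rw [if_pos rfl, Function.update_of_ne (by omega), if_pos rfl, extend_at'_two, Algebra.smul_def]
    congr 2
    have : f ∘ (at' j 2) = ![f j, f (j + 1)] := by
      funext i
      fin_cases i <;> rfl
    rw [this]
  · intro c _ hc
    refine Finset.sum_eq_zero fun a' _ => Finset.sum_eq_zero fun c' _ => ?_
    rw [if_pos rfl, Function.update_of_ne (by omega), if_neg (Ne.symm hc), smul_zero]
  · simp
  · intro a _ ha
    refine Finset.sum_eq_zero fun c _ => Finset.sum_eq_zero fun a' _ =>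
      Finset.sum_eq_zero fun c' _ => ?_
    rw [if_neg (Ne.symm ha), smul_zero]
  · simp

theorem ptr_one_apply (j : ℕ) (X : Op N A) :
    ptr 1 j X = ∑ a, ∑ c, eu j c a * X * eu j a c := by
  rw [ptr_apply]
  refine Finset.sum_congr rfl fun a _ => ?_
  rw [Finset.sum_eq_single a]
  · simp
  · intro b _ hb
    simp [Matrix.one_apply_ne (Ne.symm hb)]
  · simp

theorem ptr_one_eu_mul (j : ℕ) (a b : Fin N) (X : Op N A) :
    ptr 1 j (eu j a b * X) = ∑ c, eu j c b * X * eu j a c := by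
  rw [ptr_one_apply, Finset.sum_eq_single a]
  · refine Finset.sum_congr rfl fun c _ => ?_
    rw [← mul_assoc, eu_mul, if_pos rfl]
  · intro d _ hd
    refine Finset.sum_eq_zero fun c _ => ?_
    rw [← mul_assoc, eu_mul, if_neg hd, zero_mul, zero_mul]
  · simp

theorem ptr_one_eu_comm (j : ℕ) (a b : Fin N) (X : Op N A) :
    ptr 1 j (eu j a b * X) = ptr 1 j (X * eu j a b) := by
  symm
  rw [ptr_one_eu_mul, ptr_one_apply, Finset.sum_eq_single b]
  · refine Finset.sum_congr rfl fun c _ => ?_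
    rw [mul_assoc, mul_assoc X, eu_mul, if_pos rfl, mul_assoc]
  · intro d _ hd
    refine Finset.sum_eq_zero fun c _ => ?_
    rw [mul_assoc, mul_assoc, eu_mul, if_neg (Ne.symm hd), mul_zero, mul_zero]
  · simp

theorem ptr_eq_ptr_one (j : ℕ) (X : Op N A) :
    ptr D j X = ptr 1 j (opS j (toOne D) * X) := by
  rw [opS_one_eq]
  simp only [Finset.sum_mul, map_sum, smul_mul_assoc, map_smul, ptr_one_eu_mul]
  simp only [ptr_apply, Finset.smul_sum]

/-- By linearity S may be a product of two matrix units; the inner trace cycles the unit in the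
factor j + 1 and the outer one the unit in the factor j. -/
theorem ptr_one_two_comm (j : ℕ) (S : TMat N 2 ℂ) (X : Op N A) :
    ptr 1 j (ptr 1 (j + 1) (opS j S * X)) = ptr 1 j (ptr 1 (j + 1) (X * opS j S)) := by
  rw [opS_two_eq]
  simp only [Finset.sum_mul, Finset.mul_sum, map_sum, smul_mul_assoc, mul_smul_comm, map_smul]
  refine Finset.sum_congr rfl fun a _ => Finset.sum_congr rfl fun c _ =>
    Finset.sum_congr rfl fun a' _ => Finset.sum_congr rfl fun c' _ => ?_
  have h := eu_mem_cm (N := N) (A := A) (i := j) (j := j + 1) (by omega) a a'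
  rw [mul_assoc, ptr_mul_left 1 h, ptr_one_eu_comm, ptr_one_eu_comm, (eu_comm (by omega) _ _ _ _).eq,
    ← mul_assoc, ptr_mul_right 1 h]

/-- The weighted trace of Y is the plain trace of (D ⊗ D) Y. The plain trace is cyclic, so it
suffices that S commutes with D ⊗ D. -/
theorem ptr_two_comm (j : ℕ) (S : TMat N 2 ℂ)
    (hS : Commute (opS j S : Op N A) (opS j (toOne D) * opS (j + 1) (toOne D))) (X : Op N A) :
    ptr D j (ptr D (j + 1) (opS j S * X)) = ptr D j (ptr D (j + 1) (X * opS j S)) := by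
  have h := opS_mem_cm (A := A) (j := j + 1) (s := j) (k := 1) (by omega) (toOne D)
  have key : ∀ Y : Op N A, ptr D j (ptr D (j + 1) Y)
      = ptr 1 j (ptr 1 (j + 1) (opS j (toOne D) * opS (j + 1) (toOne D) * Y)) := by
    intro Y
    rw [ptr_eq_ptr_one, ptr_eq_ptr_one D (j + 1), ← ptr_mul_left 1 h, mul_assoc]
  rw [key, key, ← mul_assoc, ← hS.eq, mul_assoc, ptr_one_two_comm, mul_assoc]

/-! ### Comparison with traces of matrices -/

/-- The trace over the last factor. -/
def lastTr {n : ℕ} (X : TMat N (n + 1) A) : TMat N n A := Matrix.of fun f g =>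
  ∑ a, ∑ b, D a b • X (Fin.snoc (α := fun _ => Fin N) f b) (Fin.snoc (α := fun _ => Fin N) g a)

theorem extend_at'_snoc (n : ℕ) (y : Fin n → Fin N) (a : Fin N) (f : ℕ → Fin N) :
    Function.extend (at' 0 (n + 1)) (Fin.snoc (α := fun _ => Fin N) y a) f
      = Function.update (Function.extend (at' 0 n) y f) n a := by
  funext l
  by_cases hl : l = n
  · subst hl
    rw [Function.update_self]
    have := (at' 0 (l + 1)).injective.extend_apply (Fin.snoc (α := fun _ => Fin N) y a) f
      (Fin.last l)
    simpa [at'_apply] using this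
  · rw [Function.update_of_ne hl]
    by_cases hl' : l < n
    · have h1 := (at' 0 (n + 1)).injective.extend_apply (Fin.snoc (α := fun _ => Fin N) y a) f
        (Fin.castSucc ⟨l, hl'⟩)
      have h2 := (at' 0 n).injective.extend_apply y f ⟨l, hl'⟩
      rw [Fin.snoc_castSucc] at h1
      simp only [at'_apply, Nat.zero_add] at h1 h2
      exact h1.trans h2.symm
    · rw [Function.extend_apply', Function.extend_apply']
      · rintro ⟨i, hi⟩
        rw [at'_apply] at hi
        omega
      · rintro ⟨i, hi⟩
        rw [at'_apply] at hi
        omega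

theorem opLeg_lastTr {n : ℕ} (X : TMat N (n + 1) A) :
    opLeg (at' 0 n) (lastTr D X) = ptr D n (opLeg (at' 0 (n + 1)) X) := by
  refine Op.ext fun v f => ?_
  have h1 : ∀ b, Function.update f n b ∘ at' 0 (n + 1)
      = Fin.snoc (α := fun _ => Fin N) (f ∘ at' 0 n) b := by
    intro b
    funext i
    refine Fin.lastCases ?_ (fun i => ?_) i
    · rw [Fin.snoc_last]
      simp [at'_apply]
    · rw [Fin.snoc_castSucc]
      have : (i : ℕ) ≠ n := by omega
      simp [at'_apply, this]
  have h2 : ∀ (y : Fin n → Fin N) b, Function.extend (at' 0 n) y (Function.update f n b)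
      = Function.update (Function.extend (at' 0 n) y f) n b := by
    intro y b
    funext l
    by_cases hl : ∃ i, at' 0 n i = l
    · obtain ⟨i, rfl⟩ := hl
      rw [(at' 0 n).injective.extend_apply, Function.update_of_ne,
        (at' 0 n).injective.extend_apply]
      rw [at'_apply]
      omega
    · rw [Function.extend_apply' _ _ _ hl]
      by_cases hl' : l = n
      · subst hl'
        simp
      · rw [Function.update_of_ne hl', Function.update_of_ne hl', Function.extend_apply' _ _ _ hl]
  have h3 : ∀ y : Fin n → Fin N, Function.extend (at' 0 n) y f n = f n := by
    intro y
    rw [Function.extend_apply']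
    rintro ⟨i, hi⟩
    rw [at'_apply] at hi
    omega
  have h0 : ∀ (c : Fin N) (y : Fin n → Fin N), (Fin.snocEquiv fun _ => Fin N) (c, y)
      = Fin.snoc (α := fun _ => Fin N) y c := fun _ _ => rfl
  rw [ptr_apply]
  simp only [Op.sum_apply, Op.smul_apply, Op.mul_apply, eu_apply, opLeg_apply]
  simp only [lastTr, Matrix.of_apply, Finset.sum_mul]
  rw [Finset.sum_comm]
  refine Finset.sum_congr rfl fun a _ => ?_
  rw [Finset.sum_comm]
  refine Finset.sum_congr rfl fun b _ => ?_
  rw [Finset.sum_eq_single (f n)]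
  · rw [if_pos rfl, ← Equiv.sum_comp (Fin.snocEquiv fun _ : Fin (n + 1) => Fin N),
      Fintype.sum_prod_type, Finset.sum_eq_single a, Finset.smul_sum]
    · refine Finset.sum_congr rfl fun y _ => ?_
      simp only [h0, h1, extend_at'_snoc, h2, Function.update_self, if_true, Function.update_idem]
      rw [← h3 y, Function.update_eq_self, smul_mul_assoc]
    · intro c _ hc
      refine Finset.sum_eq_zero fun y _ => ?_
      simp only [h0, extend_at'_snoc, Function.update_self, if_neg hc, mul_zero]
    · simp
  · intro c _ hc
    rw [if_neg (Ne.symm hc), smul_zero]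
  · simp

theorem trTail_succ {k : ℕ} (X : TMat N (k + 2) A) :
    trTail D X = trTail D (k := k) (lastTr D X) := by
  ext a b
  simp only [trTail, lastTr, Matrix.of_apply]
  rw [← Equiv.sum_comp (Fin.snocEquiv fun _ : Fin (k + 1) => Fin N), Fintype.sum_prod_type,
    Finset.sum_comm]
  refine Finset.sum_congr rfl fun f _ => ?_
  simp only [← Equiv.sum_comp (Fin.snocEquiv fun _ : Fin (k + 1) => Fin N),
    Fintype.sum_prod_type, Finset.smul_sum, smul_smul]
  rw [Finset.sum_comm]
  conv_lhs =>
    enter [2, x]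
    rw [Finset.sum_comm]
  rw [Finset.sum_comm]
  refine Finset.sum_congr rfl fun g _ => ?_
  rw [Finset.sum_comm]
  refine Finset.sum_congr rfl fun c _ => Finset.sum_congr rfl fun d _ => ?_
  simp only [Fin.snocEquiv, Equiv.coe_fn_mk, Fin.prod_univ_castSucc, Fin.snoc_castSucc,
    Fin.snoc_last, Fin.cons_snoc_eq_snoc_cons]

theorem trTail_zero (X : TMat N 1 A) : toOne (trTail D (k := 0) X) = X := by
  ext f g
  simp only [toOne, trTail, Matrix.of_apply, Fintype.sum_unique, Finset.univ_eq_empty,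
    Finset.prod_empty, one_smul]
  congr 1
  · funext i
    rw [Subsingleton.elim (α := Fin 1) i 0]
    rfl
  · funext i
    rw [Subsingleton.elim (α := Fin 1) i 0]
    rfl

/-- The weighted trace over the factors `s + 1, …, s + k`. -/
def etr (s : ℕ) : ℕ → Op N A →ₗ[ℂ] Op N A
  | 0 => LinearMap.id
  | k + 1 => (etr s k).comp (ptr D (s + k + 1))

theorem etr_zero (s : ℕ) (X : Op N A) : etr D s 0 X = X := rfl

theorem etr_succ (s k : ℕ) (X : Op N A) :
    etr D s (k + 1) X = etr D s k (ptr D (s + k + 1) X) := rfl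

/-- The bridge from traces in coordinates to the algebra of operators: factors are traced out one by
one, the last one first. -/
theorem iota_trTail {k : ℕ} (X : TMat N (k + 1) A) :
    iota (trTail D X) = etr D 0 k (opLeg (at' 0 (k + 1)) X) := by
  induction k with
  | zero => rw [iota, trTail_zero, etr_zero]
  | succ k ih => rw [trTail_succ, ih, opLeg_lastTr, etr_succ, Nat.zero_add]

theorem ptr_iota (X : Matrix (Fin N) (Fin N) A) : ptr D 0 (iota X) = opA (wTr D X) := by
  rw [iota_eq_sum]
  simp only [map_sum, ptr_mul_left D (opA_mem_cm _ _), ptr_eu, mul_smul_comm, mul_one, wTr,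
    map_smul]
  rw [Finset.sum_comm]

end ptrace
end QMA
end

noncomputable section
namespace QMA

/-! ### Skew inverses and twists -/

section twist

variable {N : ℕ} {A : Type*} [Ring A] [Algebra ℂ A]

theorem site_mul_site_apply (X Y : TMat N 2 ℂ) (a b c a' b' c' : Fin N) :
    (site 3 0 (by omega) X * site 3 1 (by omega) Y) ![a, b, c] ![a', b', c']
      = ∑ x, X ![a, b] ![a', x] * Y ![x, c] ![b', c'] := by
  have e0 : ∀ f : Fin 3 → Fin N, f ∘ shiftEmb (k := 2) 0 (by omega) = ![f 0, f 1] := fun f => by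
    funext i
    fin_cases i <;> rfl
  have e1 : ∀ f : Fin 3 → Fin N,
      f ∘ shiftEmb (k := 2) (n := 3) 1 (by omega) = ![f 1, f 2] := fun f => by
    funext i
    fin_cases i <;> rfl
  rw [Matrix.mul_apply]
  symm
  apply Finset.sum_of_injOn (fun x => ![a', x, c])
  · intro x _ y _ h
    simpa using congrFun h 1
  · intro x _
    simp
  · intro h _ hh
    by_cases h2 : h 2 = c
    · rw [site, site, leg_apply_zero (shiftEmb 1 _), mul_zero]
      intro h'
      apply hh
      refine ⟨h 1, by simp, ?_⟩
      have := h' 0 (by rintro ⟨i, hi⟩; simpa [shiftEmb_val] using congrArg Fin.val hi)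
      funext i
      fin_cases i
      · exact this.symm
      · rfl
      · exact h2.symm
    · rw [site, leg_apply_zero, zero_mul]
      intro h'
      apply h2
      exact (h' 2 (by
        rintro ⟨i, hi⟩
        have := congrArg Fin.val hi
        simp [shiftEmb_val] at this
        omega)).symm
  · intro x _
    rw [site, site, leg_apply, leg_apply, e0, e0, e1, e1]
    · rfl
    · intro j hj
      fin_cases j
      · rfl
      · exact absurd ⟨0, rfl⟩ hj
      · exact absurd ⟨1, rfl⟩ hj
    · intro j hj
      fin_cases j
      · exact absurd ⟨0, rfl⟩ hj
      · exact absurd ⟨1, rfl⟩ hj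
      · rfl

theorem isHalfSkew_iff (X Y : TMat N 2 ℂ) : IsHalfSkew X Y ↔ ∀ a c a' c',
    ∑ b, ∑ x, X ![a, b] ![a', x] * Y ![x, c] ![b, c']
      = if a = c' ∧ c = a' then 1 else 0 := by
  simp only [IsHalfSkew, site_mul_site_apply]
  rfl

theorem skewInv_spec {X : TMat N 2 ℂ} (h : SkewInvertible X) : IsSkewInverse X (skewInv X) := by
  rw [skewInv, dif_pos h]
  exact h.choose_spec

/-- Tracing Tr₍₂₎ X₁₂ Ψ₂₃ = P₁₃ over the third factor turns Ψ into D_X and P into I, which gives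
Tr₍₂₎ X₁₂ (D_X)₂ = I. -/
theorem sum_mul_opD {X : TMat N 2 ℂ} (h : SkewInvertible X) (a a' : Fin N) :
    ∑ b, ∑ x, X ![a, b] ![a', x] * opD X x b = if a = a' then 1 else 0 := by
  have h1 := (isHalfSkew_iff _ _).1 (skewInv_spec h).1
  have h2 : ∀ b x, X ![a, b] ![a', x] * opD X x b
      = ∑ c, X ![a, b] ![a', x] * skewInv X ![x, c] ![b, c] := fun b x => by
    rw [opD, Matrix.of_apply, Finset.mul_sum]
  simp only [h2]
  conv_lhs =>
    enter [2, b]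
    rw [Finset.sum_comm]
  rw [Finset.sum_comm]
  simp only [h1]
  by_cases haa : a = a'
  · subst haa
    rw [if_pos rfl, Finset.sum_eq_single a]
    · simp
    · intro c _ hc
      rw [if_neg (fun h => hc h.2)]
    · simp
  · rw [if_neg haa]
    refine Finset.sum_eq_zero fun c _ => ?_
    rw [if_neg]
    rintro ⟨rfl, h⟩
    exact haa h

/-- Contraction with Ψ_X inverts contraction with X, so the system for Λ has at most one solution,
and up to transposed indices it is D_X times z. Values in a module are allowed since Λ will be a
family of operators. -/
theorem eq_opD_smul {X : TMat N 2 ℂ} (h : SkewInvertible X) {B : Type*} [AddCommGroup B]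
    [Module ℂ B] (Λ : Fin N → Fin N → B) (z : B)
    (hΛ : ∀ a a', ∑ c, ∑ c', X ![a, c] ![a', c'] • Λ c c' = if a = a' then z else 0)
    (d d' : Fin N) : Λ d d' = opD X d' d • z := by
  have h1 := (isHalfSkew_iff _ _).1 (skewInv_spec h).2
  have h2 : Λ d d' = ∑ c, ∑ c', (if d' = c' ∧ c = d then (1 : ℂ) else 0) • Λ c c' := by
    rw [Finset.sum_eq_single d, Finset.sum_eq_single d']
    · simp
    · intro c _ hc
      rw [if_neg (fun h => hc h.1.symm), zero_smul]
    · simp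
    · intro c _ hc
      refine Finset.sum_eq_zero fun c' _ => ?_
      rw [if_neg (fun h => hc h.2), zero_smul]
    · simp
  rw [h2]
  simp only [← h1, Finset.sum_smul]
  have h3 : ∀ b x, ∑ c, ∑ c', (skewInv X ![d', b] ![d, x] * X ![x, c] ![b, c']) • Λ c c'
      = if x = b then skewInv X ![d', b] ![d, x] • z else 0 := by
    intro b x
    simp only [mul_smul, ← Finset.smul_sum, hΛ]
    split_ifs <;> simp
  calc ∑ c, ∑ c', ∑ b, ∑ x, (skewInv X ![d', b] ![d, x] * X ![x, c] ![b, c']) • Λ c c'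
      = ∑ b, ∑ x, ∑ c, ∑ c', (skewInv X ![d', b] ![d, x] * X ![x, c] ![b, c']) • Λ c c' := by
        conv_lhs =>
          enter [2, c]
          rw [Finset.sum_comm]
          enter [2, b]
          rw [Finset.sum_comm]
        rw [Finset.sum_comm]
        refine Finset.sum_congr rfl fun b _ => ?_
        rw [Finset.sum_comm]
    _ = opD X d' d • z := by
        simp only [h3, Finset.sum_ite_eq', Finset.mem_univ, if_true]
        rw [← Finset.sum_smul]
        simp [opD]

theorem ptr_opS_two (D : Matrix (Fin N) (Fin N) ℂ) (j : ℕ) (X : TMat N 2 ℂ) :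
    ptr D (j + 1) (opS j X : Op N A)
      = ∑ a, ∑ a', (∑ c, ∑ c', X ![a, c] ![a', c'] * D c' c) • eu j a a' := by
  rw [opS_two_eq]
  simp only [map_sum, map_smul, ptr_mul_left D (eu_mem_cm (by omega : j ≠ j + 1) _ _), ptr_eu,
    Finset.sum_smul, mul_smul_comm, mul_one, smul_smul]
  refine Finset.sum_congr rfl fun a _ => ?_
  rw [Finset.sum_comm]

theorem ptr_opS_self {X : TMat N 2 ℂ} (h : SkewInvertible X) (j : ℕ) :
    ptr (opD X) (j + 1) (opS j X : Op N A) = 1 := by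
  rw [ptr_opS_two]
  simp only [sum_mul_opD h, ite_smul, one_smul, zero_smul, Finset.sum_ite_eq, Finset.mem_univ,
    if_true, eu_sum]

/-- `F` is invertible and both twist relations hold. -/
structure Twists (R F : TMat N 2 ℂ) : Prop where
  skew : SkewInvertible R
  isUnit : IsUnit F
  compatible : Compatible R F

namespace Twists

theorem mul_inv {R F : TMat N 2 ℂ} (T : Twists R F) : F * F⁻¹ = 1 :=
  Matrix.mul_nonsing_inv _ ((Matrix.isUnit_iff_isUnit_det _).mp T.isUnit)

theorem inv_mul {R F : TMat N 2 ℂ} (T : Twists R F) : F⁻¹ * F = 1 :=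
  Matrix.nonsing_inv_mul _ ((Matrix.isUnit_iff_isUnit_det _).mp T.isUnit)

theorem opS_mul_inv {R F : TMat N 2 ℂ} (T : Twists R F) (j : ℕ) : (opS j F * opS j F⁻¹ : Op N A) = 1 := by
  rw [← map_mul, T.mul_inv, map_one]

theorem opS_inv_mul {R F : TMat N 2 ℂ} (T : Twists R F) (j : ℕ) : (opS j F⁻¹ * opS j F : Op N A) = 1 := by
  rw [← map_mul, T.inv_mul, map_one]

theorem opS_up {R F : TMat N 2 ℂ} (T : Twists R F) (j : ℕ) : (opS j R * opS (j + 1) F * opS j F : Op N A)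
    = opS (j + 1) F * opS j F * opS (j + 1) R := by
  have := congrArg (opS (A := A) j) T.compatible.1
  simpa only [map_mul, fst3, snd3, opS_site, Nat.add_zero] using this

theorem opS_down {R F : TMat N 2 ℂ} (T : Twists R F) (j : ℕ) : (opS (j + 1) R * opS j F * opS (j + 1) F : Op N A)
    = opS j F * opS (j + 1) F * opS j R := by
  have := congrArg (opS (A := A) j) T.compatible.2
  simpa only [map_mul, fst3, snd3, opS_site, Nat.add_zero] using this

/-- Inverting the product of the two F in one twist relation produces the other twist relation for
F⁻¹. -/
theorem inv {R F : TMat N 2 ℂ} (T : Twists R F) : Twists R F⁻¹ := by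
  have h1 := T.mul_inv
  have h2 := T.inv_mul
  have hf : ∀ {j : ℕ} (h : j + 2 ≤ 3), site 3 j h F * site 3 j h F⁻¹ = 1 := fun h => by
    rw [← site_mul, h1, site_one]
  have hf' : ∀ {j : ℕ} (h : j + 2 ≤ 3), site 3 j h F⁻¹ * site 3 j h F = 1 := fun h => by
    rw [← site_mul, h2, site_one]
  have key : ∀ {B : Type} [Ring B] (r r' x x' y y' : B), x * x' = 1 → x' * x = 1 → y * y' = 1 →
      y' * y = 1 → r * y * x = y * x * r' → r' * x' * y' = x' * y' * r := by
    intro B _ r r' x x' y y' hx hx' hy hy' h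
    calc r' * x' * y' = x' * (y' * y) * x * r' * x' * y' := by rw [hy', mul_one, hx', one_mul]
      _ = x' * y' * (y * x * r') * x' * y' := by noncomm_ring
      _ = x' * y' * r * (y * (x * x') * y') := by rw [← h]; noncomm_ring
      _ = x' * y' * r := by rw [hx, mul_one, hy, mul_one]
  refine ⟨T.skew, ⟨⟨F⁻¹, F, h2, h1⟩, rfl⟩, ?_, ?_⟩
  · exact key _ _ _ _ _ _ (hf _) (hf' _) (hf _) (hf' _) T.compatible.2
  · exact key _ _ _ _ _ _ (hf _) (hf' _) (hf _) (hf' _) T.compatible.1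

end Twists

theorem commute_opS_two {j : ℕ} {y : Op N A} (h : y ∈ cm N A j) (h' : y ∈ cm N A (j + 1))
    (X : TMat N 2 ℂ) : Commute y (opS j X) := by
  rw [opS_two_eq]
  refine Commute.sum_right _ _ _ fun a _ => Commute.sum_right _ _ _ fun c _ =>
    Commute.sum_right _ _ _ fun a' _ => Commute.sum_right _ _ _ fun c' _ => ?_
  exact ((mem_cm.1 h _ _).symm.mul_right (mem_cm.1 h' _ _).symm).smul_right _

theorem trTail_one_apply (D : Matrix (Fin N) (Fin N) ℂ) (X : TMat N 2 A) (a b : Fin N) :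
    trTail D (k := 1) X a b = ∑ t, ∑ s, D t s • X ![a, s] ![b, t] := by
  rw [trTail, Matrix.of_apply, ← Equiv.sum_comp (Equiv.funUnique (Fin 1) (Fin N)).symm]
  refine Finset.sum_congr rfl fun t _ => ?_
  rw [← Equiv.sum_comp (Equiv.funUnique (Fin 1) (Fin N)).symm]
  refine Finset.sum_congr rfl fun s _ => ?_
  rw [Fintype.prod_unique]
  congr 2
  · funext i
    fin_cases i <;> rfl
  · funext i
    fin_cases i <;> rfl

theorem ptr_opS_eq_opS_trTail (D : Matrix (Fin N) (Fin N) ℂ) (j : ℕ) (X : TMat N 2 ℂ) :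
    ptr D (j + 1) (opS j X : Op N A) = opS j (toOne (trTail D (k := 1) X)) := by
  rw [ptr_opS_two, opS_one_eq]
  refine Finset.sum_congr rfl fun a _ => Finset.sum_congr rfl fun b _ => ?_
  rw [trTail_one_apply, Finset.sum_comm]
  simp only [smul_eq_mul, mul_comm]

theorem opS_one_injective (j : ℕ) {X Y : Matrix (Fin N) (Fin N) ℂ}
    (h : (opS j (toOne X) : Op N ℂ) = opS j (toOne Y)) : X = Y := by
  ext a b
  have := congrArg (fun Z : Op N ℂ => Z (fun f => if f j = b then 1 else 0) (fun _ => a)) h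
  simpa [opS_one_eq, Op.sum_apply, Op.smul_apply, eu_apply] using this

theorem opS_toOne_single (j : ℕ) (c c' : Fin N) :
    (opS j (site 2 0 (by omega) (toOne (Matrix.single c c' (1 : ℂ)))) : Op N A) = eu j c c' := by
  rw [opS_site]
  rfl

/-- In three factors F₂⁻¹ R₁ F₂ = F₁ R₂ F₁⁻¹, and the R-trace of the right side over the third
factor is I. Expanding R₁ in matrix units of the second factor makes the left side a contraction
with R, and `eq_opD_smul` then identifies the R-trace of each conjugated matrix unit. -/
theorem Twists.trTail_single {R F : TMat N 2 ℂ} (T : Twists R F) (c c' : Fin N) :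
    trTail (opD R) (k := 1) (F⁻¹ * site 2 0 (by omega) (toOne (Matrix.single c c' 1)) * F)
      = opD R c' c • 1 := by
  apply opS_one_injective 1
  rw [← ptr_opS_eq_opS_trTail]
  simp only [map_mul, opS_toOne_single]
  have h : opS 1 (toOne (opD R c' c • (1 : Matrix (Fin N) (Fin N) ℂ)))
      = opD R c' c • (1 : Op N ℂ) := by
    have : toOne (opD R c' c • (1 : Matrix (Fin N) (Fin N) ℂ)) = opD R c' c • toOne 1 := rfl
    rw [this, map_smul, toOne_one, map_one]
  rw [h]
  have hm : ∀ {X : TMat N 2 ℂ}, (opS 1 X : Op N ℂ) ∈ cm N ℂ 0 := fun {X} =>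
    opS_mem_cm (by omega) X
  apply eq_opD_smul T.skew
    (fun c c' => ptr (opD R) (1 + 1) (opS 1 F⁻¹ * eu 1 c c' * opS 1 F : Op N ℂ))
  have h1 : ptr (opD R) 2 (opS 1 F⁻¹ * opS 0 R * opS 1 F : Op N ℂ) = 1 := by
    have h2 : (opS 1 F⁻¹ * opS 0 R * opS 1 F : Op N ℂ) = opS 0 F * opS 1 R * opS 0 F⁻¹ := by
      have h3 := T.opS_up (A := ℂ) 0
      calc (opS 1 F⁻¹ * opS 0 R * opS 1 F : Op N ℂ)
          = opS 1 F⁻¹ * (opS 0 R * opS 1 F * opS 0 F) * opS 0 F⁻¹ := by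
            simp only [mul_assoc, T.opS_mul_inv, mul_one]
        _ = (opS 1 F⁻¹ * opS 1 F) * opS 0 F * opS 1 R * opS 0 F⁻¹ := by
            rw [h3]
            simp only [mul_assoc, Nat.zero_add]
        _ = _ := by rw [T.opS_inv_mul, one_mul]
    rw [h2, ptr_mul_right _ (opS_mem_cm (by omega) _), ptr_mul_left _ (opS_mem_cm (by omega) _),
      ptr_opS_self T.skew, mul_one, T.opS_mul_inv]
  have h4 : (opS 1 F⁻¹ * opS 0 R * opS 1 F : Op N ℂ)
      = ∑ a, ∑ a', eu 0 a a' * ∑ c, ∑ c', R ![a, c] ![a', c'] •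
          (opS 1 F⁻¹ * eu 1 c c' * opS 1 F) := by
    rw [opS_two_eq 0]
    simp only [Finset.mul_sum, Finset.sum_mul, mul_smul_comm, smul_mul_assoc]
    refine Finset.sum_congr rfl fun a _ => ?_
    rw [Finset.sum_comm]
    refine Finset.sum_congr rfl fun a' _ => Finset.sum_congr rfl fun c _ =>
      Finset.sum_congr rfl fun c' _ => ?_
    have := (mem_cm.1 (hm (X := F⁻¹)) a a').eq
    simp only [← mul_assoc]
    rw [this]
  rw [h4] at h1
  simp only [map_sum, ptr_mul_left _ (eu_mem_cm (by omega : 0 ≠ 2) _ _), map_smul] at h1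
  intro a a'
  have h5 := congrArg (coeffAt 0 a a') h1
  rw [coeffAt_sum] at h5
  · rw [h5]
    simp only [coeffAt, mul_one, eu_mul]
    by_cases haa : a = a'
    · simp [haa, eu_sum]
    · simp [haa]
  · intro a a'
    refine sum_mem fun c _ => sum_mem fun c' _ => Subalgebra.smul_mem _ (ptr_mem_cm _ ?_) _
    exact mul_mem (mul_mem hm (eu_mem_cm (by omega) _ _)) hm

/-- Expand Y in matrix units of the factor j. The coefficients act neither in the factor j nor in j
+ 1, hence pass through F, and `Twists.trTail_single` evaluates the rest. -/
theorem Twists.ptr_conj_inv {R F : TMat N 2 ℂ} (T : Twists R F) {j : ℕ} {Y : Op N A}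
    (hY : Y ∈ cm N A (j + 1)) :
    ptr (opD R) (j + 1) (opS j F⁻¹ * Y * opS j F) = ptr (opD R) j Y := by
  have h1 : ∀ c c', ptr (opD R) (j + 1) (opS j F⁻¹ * eu j c c' * opS j F : Op N A)
      = opD R c' c • 1 := by
    intro c c'
    rw [← opS_toOne_single, ← map_mul, ← map_mul, ptr_opS_eq_opS_trTail, T.trTail_single]
    have : toOne (opD R c' c • (1 : Matrix (Fin N) (Fin N) ℂ)) = opD R c' c • toOne 1 := rfl
    rw [this, map_smul, toOne_one, map_one]
  rw [eq_sum_coeffAt j Y]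
  simp only [Finset.mul_sum, Finset.sum_mul, map_sum]
  refine Finset.sum_congr rfl fun a _ => Finset.sum_congr rfl fun b _ => ?_
  have hc := coeffAt_mem_self j a b Y
  have hc' := coeffAt_mem a b hY (by omega : j + 1 ≠ j)
  rw [mul_assoc, mul_assoc, (commute_opS_two hc hc' F).eq, ← mul_assoc, ← mul_assoc,
    ptr_mul_right _ hc', h1, ptr_mul_right _ hc, ptr_eu]

theorem Twists.ptr_conj {R F : TMat N 2 ℂ} (T : Twists R F) {j : ℕ} {Y : Op N A}
    (hY : Y ∈ cm N A (j + 1)) :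
    ptr (opD R) (j + 1) (opS j F * Y * opS j F⁻¹) = ptr (opD R) j Y := by
  have := T.inv.ptr_conj_inv hY
  rwa [Matrix.nonsing_inv_nonsing_inv _ ((Matrix.isUnit_iff_isUnit_det _).mp T.isUnit)] at this

theorem mul_single_mul_apply (X Y : TMat N 2 ℂ) (c c' : Fin N) (f g : Fin 2 → Fin N) :
    (X * site 2 0 (by omega) (toOne (Matrix.single c c' 1)) * Y : TMat N 2 ℂ) f g
      = ∑ s, X f ![c, s] * Y ![c', s] g := by
  have h0 : ∀ h h' : Fin 2 → Fin N, (site 2 0 (by omega) (toOne (Matrix.single c c' (1 : ℂ))) :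
      TMat N 2 ℂ) h h' = if h 0 = c ∧ h' 0 = c' ∧ h 1 = h' 1 then 1 else 0 := by
    intro h h'
    by_cases h1 : h 1 = h' 1
    · rw [site, leg_apply]
      · simp only [toOne, Matrix.of_apply, Matrix.single_apply, h1, and_true]
        congr 1
        apply propext
        exact ⟨fun h => ⟨h.1.symm, h.2.symm⟩, fun h => ⟨h.1.symm, h.2.symm⟩⟩
      · intro j hj
        fin_cases j
        · exact absurd ⟨0, rfl⟩ hj
        · exact h1
    · rw [site, leg_apply_zero, if_neg (fun h => h1 h.2.2)]
      intro h2
      exact h1 (h2 1 (by rintro ⟨i, hi⟩; simpa [shiftEmb_val] using congrArg Fin.val hi))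
  rw [Matrix.mul_apply, ← Equiv.sum_comp (finTwoArrowEquiv (Fin N)).symm, Fintype.sum_prod_type,
    Finset.sum_eq_single c']
  · refine Finset.sum_congr rfl fun s _ => ?_
    congr 1
    rw [Matrix.mul_apply, Finset.sum_eq_single ![c, s]]
    · rw [h0]
      simp
    · intro h _ hh
      rw [h0, if_neg, mul_zero]
      rintro ⟨h1, -, h2⟩
      apply hh
      funext i
      fin_cases i
      · exact h1
      · exact h2
    · simp
  · intro d _ hd
    refine Finset.sum_eq_zero fun s _ => ?_
    rw [Matrix.mul_apply, Finset.sum_eq_zero, zero_mul]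
    intro h _
    rw [h0, if_neg, mul_zero]
    rintro ⟨-, h1, -⟩
    exact hd h1
  · simp

end twist
end QMA
end

noncomputable section
namespace QMA

/-! ### Relations in Birman-Murakami-Wenzl algebras -/

section bmwRelations

variable {B : Type*} [Ring B] [Algebra ℂ B] {q μ : ℂ}

/-- The parameters are admissible. -/
structure Generic (q μ : ℂ) : Prop where
  q_ne : q ≠ 0
  mu_ne : μ ≠ 0
  lam_ne : q - q⁻¹ ≠ 0

/-- Two neighbouring generators `s`, `t` of a Birman-Murakami-Wenzl algebra, with inverses. -/
structure IsBMW3 (q μ : ℂ) (s s' t t' : B) : Prop where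
  mul_inv : s * s' = 1
  inv_mul : s' * s = 1
  mul_inv' : t * t' = 1
  inv_mul' : t' * t = 1
  braid : s * t * s = t * s * t
  sk : s * kap q μ s = μ • kap q μ s
  ksk : kap q μ s * t * kap q μ s = μ⁻¹ • kap q μ s
  ksik : kap q μ s * t' * kap q μ s = μ • kap q μ s

theorem kap_commute (s : B) : Commute s (kap q μ s) := by
  rw [Commute, SemiconjBy]
  simp only [kap, mul_smul_comm, smul_mul_assoc]
  congr 1
  simp only [mul_add, add_mul, sub_mul, mul_sub, smul_mul_assoc, mul_smul_comm, one_mul, mul_one,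
    mul_assoc]

theorem kap_eq (hp : Generic q μ) (s : B) :
    kap q μ s = (μ⁻¹ * (q - q⁻¹)⁻¹) • (1 + (q - q⁻¹) • s - s * s) := by
  rw [kap]
  congr 1
  simp only [mul_add, sub_mul, smul_mul_assoc, mul_smul_comm, one_mul, mul_one]
  linear_combination (norm := module) inv_mul_cancel₀ hp.q_ne • (1 : B)

theorem mul_self_eq (hp : Generic q μ) (s : B) :
    s * s = 1 + (q - q⁻¹) • s - ((q - q⁻¹) * μ) • kap q μ s := by
  rw [kap_eq hp, smul_smul]
  have h1 := hp.mu_ne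
  have h2 := hp.lam_ne
  have : (q - q⁻¹) * μ * (μ⁻¹ * (q - q⁻¹)⁻¹) = 1 := by
    rw [mul_assoc, mul_inv_cancel_left₀ h1, mul_inv_cancel₀ h2]
  rw [this, one_smul]
  abel

theorem conj_kap {u s t : B} (h : u * s = t * u) : u * kap q μ s = kap q μ t * u := by
  simp only [kap, mul_smul_comm, smul_mul_assoc, mul_add, add_mul, mul_sub, sub_mul, one_mul,
    mul_one, ← mul_assoc, h]
  rw [mul_assoc t u s, h, mul_assoc t t u]

theorem eta_eq (hp : Generic q μ) : eta q μ = 1 + (μ⁻¹ - μ) / (q - q⁻¹) := by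
  have h1 := hp.mu_ne
  have h2 := hp.lam_ne
  have h3 : (q - μ) * (q⁻¹ + μ) = 1 + μ * (q - q⁻¹) - μ * μ := by
    linear_combination mul_inv_cancel₀ hp.q_ne
  rw [eta, h3]
  generalize q - q⁻¹ = l at *
  field_simp
  ring

namespace IsBMW3

theorem ks {s s' t t' : B} (h : IsBMW3 q μ s s' t t') : kap q μ s * s = μ • kap q μ s := by
  rw [← (kap_commute s).eq, h.sk]

theorem s'k (hp : Generic q μ) {s s' t t' : B} (h : IsBMW3 q μ s s' t t') :
    s' * kap q μ s = μ⁻¹ • kap q μ s := by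
  have h1 := hp.mu_ne
  calc s' * kap q μ s = μ⁻¹ • (s' * (s * kap q μ s)) := by
        rw [h.sk, mul_smul_comm, smul_smul, inv_mul_cancel₀ h1, one_smul]
    _ = _ := by rw [← mul_assoc, h.inv_mul, one_mul]

theorem ks' (hp : Generic q μ) {s s' t t' : B} (h : IsBMW3 q μ s s' t t') :
    kap q μ s * s' = μ⁻¹ • kap q μ s := by
  have h1 := hp.mu_ne
  calc kap q μ s * s' = μ⁻¹ • (kap q μ s * s * s') := by
        rw [h.ks, smul_mul_assoc, smul_smul, inv_mul_cancel₀ h1, one_smul]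
    _ = _ := by rw [mul_assoc, h.mul_inv, mul_one]

/-- The quadratic relation multiplied by s'. This skein relation trades generators for their
inverses throughout. -/
theorem inv_eq (hp : Generic q μ) {s s' t t' : B} (h : IsBMW3 q μ s s' t t') :
    s' = s - (q - q⁻¹) • 1 + (q - q⁻¹) • kap q μ s := by
  have h1 := congrArg (s' * ·) (mul_self_eq hp s)
  simp only [← mul_assoc, h.inv_mul, one_mul, mul_sub, mul_add, mul_one, mul_smul_comm,
    h.s'k hp, smul_smul] at h1
  rw [mul_assoc, mul_inv_cancel₀ hp.mu_ne, mul_one] at h1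
  linear_combination (norm := module) -h1

theorem kk (hp : Generic q μ) {s s' t t' : B} (h : IsBMW3 q μ s s' t t') :
    kap q μ s * kap q μ s = eta q μ • kap q μ s := by
  have h1 := congrArg (kap q μ s * ·) (h.inv_eq hp)
  simp only [mul_add, mul_sub, mul_smul_comm, mul_one, h.ks, h.ks' hp] at h1
  have h2 := hp.lam_ne
  have h3 : (q - q⁻¹) • (kap q μ s * kap q μ s) = ((q - q⁻¹) + (μ⁻¹ - μ)) • kap q μ s := by
    linear_combination (norm := module) -h1
  calc kap q μ s * kap q μ s = (q - q⁻¹)⁻¹ • ((q - q⁻¹) • (kap q μ s * kap q μ s)) := by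
        rw [smul_smul, inv_mul_cancel₀ h2, one_smul]
    _ = _ := by
        rw [h3, smul_smul, eta_eq hp]
        congr 1
        generalize q - q⁻¹ = l at *
        field_simp

theorem st_k {s s' t t' : B} (h : IsBMW3 q μ s s' t t') :
    s * t * kap q μ s = kap q μ t * (s * t) :=
  conj_kap (by rw [← mul_assoc, h.braid])

theorem t's't {s s' t t' : B} (h : IsBMW3 q μ s s' t t') : t' * s * t = s * t * s' := by
  calc t' * s * t = t' * (s * t * s) * s' := by
        simp only [mul_assoc, h.mul_inv, mul_one]
    _ = s * t * s' := by
        rw [h.braid]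
        simp only [← mul_assoc, h.inv_mul', one_mul]

/-- The neighbouring generators may be exchanged. -/
theorem symm (hp : Generic q μ) {s s' t t' : B} (h : IsBMW3 q μ s s' t t') :
    IsBMW3 q μ t t' s s' := by
  have hst : (s * t) * (t' * s') = 1 := by
    rw [mul_assoc, ← mul_assoc t, h.mul_inv', one_mul, h.mul_inv]
  have hl : kap q μ t = s * t * kap q μ s * (t' * s') := by
    rw [h.st_k, mul_assoc, hst, mul_one]
  -- `kap q μ t` is the conjugate of `kap q μ s` by `s * t`, so a sandwich between two copies of it
  -- reduces to one between copies of `kap q μ s` once the middle letter is conjugated back.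
  have hconj : ∀ x y : B, (t' * s') * x * (s * t) = y → kap q μ t * x * kap q μ t
      = s * t * (kap q μ s * y * kap q μ s) * (t' * s') := by
    rintro x _ rfl
    rw [hl]
    simp only [mul_assoc]
  have h1 : (t' * s') * s * (s * t) = s * t * s' := by
    rw [← h.t's't]
    simp only [mul_assoc]
    rw [← mul_assoc s' s, h.inv_mul, one_mul]
  have h2 : (t' * s') * s' * (s * t) = s * t' * s' := by
    calc (t' * s') * s' * (s * t) = t' * s' * t := by
          simp only [mul_assoc]
          rw [← mul_assoc s' s, h.inv_mul, one_mul]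
      _ = (s * t' * s') * (s * t * s') * (t' * s' * t) := by
          have : (s * t' * s') * (s * t * s') = 1 := by
            calc _ = s * (t' * (s' * s) * t) * s' := by simp only [mul_assoc]
              _ = 1 := by rw [h.inv_mul, mul_one, h.inv_mul', mul_one, h.mul_inv]
          rw [this, one_mul]
      _ = (s * t' * s') * (t' * (s * (t * t') * s') * t) := by
          rw [← h.t's't]
          simp only [mul_assoc]
      _ = _ := by rw [h.mul_inv', mul_one, h.mul_inv, mul_one, h.inv_mul', mul_one]
  have h3 := h.s'k hp
  have h4 := hp.mu_ne
  refine ⟨h.mul_inv', h.inv_mul', h.mul_inv, h.inv_mul, h.braid.symm, ?_, ?_, ?_⟩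
  · calc t * kap q μ t = t * (s * t * kap q μ s * (t' * s')) := by rw [← hl]
      _ = (t * s * t) * kap q μ s * (t' * s') := by simp only [mul_assoc]
      _ = s * t * (s * kap q μ s) * (t' * s') := by rw [← h.braid]; simp only [mul_assoc]
      _ = μ • kap q μ t := by
        rw [h.sk, hl]
        simp only [mul_smul_comm, smul_mul_assoc]
  · rw [hconj _ _ h1]
    have : kap q μ s * (s * t * s') * kap q μ s = μ⁻¹ • kap q μ s := by
      calc _ = (kap q μ s * s) * t * (s' * kap q μ s) := by simp only [mul_assoc]
        _ = _ := by
          rw [h.ks, h3]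
          simp only [smul_mul_assoc, mul_smul_comm, h.ksk, smul_smul]
          congr 1
          field_simp
    rw [this]
    simp only [mul_smul_comm, smul_mul_assoc]
    rw [← hl]
  · rw [hconj _ _ h2]
    have : kap q μ s * (s * t' * s') * kap q μ s = μ • kap q μ s := by
      calc _ = (kap q μ s * s) * t' * (s' * kap q μ s) := by simp only [mul_assoc]
        _ = _ := by
          rw [h.ks, h3]
          simp only [smul_mul_assoc, mul_smul_comm, h.ksik, smul_smul]
          congr 1
          field_simp
    rw [this]
    simp only [mul_smul_comm, smul_mul_assoc]
    rw [← hl]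

/-- Insert the skein relation for t' between two copies of κ_s: all terms other than κ_s κ_t κ_s are
known multiples of κ_s. -/
theorem klk (hp : Generic q μ) {s s' t t' : B} (h : IsBMW3 q μ s s' t t') :
    kap q μ s * kap q μ t * kap q μ s = kap q μ s := by
  have h1 := congrArg (fun x => kap q μ s * x * kap q μ s) ((h.symm hp).inv_eq hp)
  simp only [mul_add, mul_sub, add_mul, sub_mul, mul_smul_comm, smul_mul_assoc, mul_one, h.ksk,
    h.ksik, h.kk hp] at h1
  have h2 := hp.lam_ne
  have h3 : (q - q⁻¹) • (kap q μ s * kap q μ t * kap q μ s) = (q - q⁻¹) • kap q μ s := by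
    have h4 : (q - q⁻¹) * eta q μ = (q - q⁻¹) + (μ⁻¹ - μ) := by
      rw [eta_eq hp]
      generalize q - q⁻¹ = l at *
      field_simp
    linear_combination (norm := module) -h1 + h4 • kap q μ s
  have h5 := congrArg ((q - q⁻¹)⁻¹ • ·) h3
  simpa only [smul_smul, inv_mul_cancel₀ h2, one_smul] using h5

/-- Since κ_t = κ_t κ_s κ_t and s t κ_s = κ_t s t, the left side equals κ_t (κ_s s t κ_s), and the
bracket is κ_s because the factors μ and μ⁻¹ cancel. -/
theorem stk (hp : Generic q μ) {s s' t t' : B} (h : IsBMW3 q μ s s' t t') :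
    s * t * kap q μ s = kap q μ t * kap q μ s := by
  have h1 : kap q μ s * (s * t * kap q μ s) = kap q μ s := by
    rw [← mul_assoc, ← mul_assoc, h.ks, smul_mul_assoc, smul_mul_assoc, h.ksk, smul_smul,
      mul_inv_cancel₀ hp.mu_ne, one_smul]
  calc s * t * kap q μ s = kap q μ t * kap q μ s * kap q μ t * (s * t) := by
        rw [(h.symm hp).klk hp, h.st_k]
    _ = kap q μ t * (kap q μ s * (s * t * kap q μ s)) := by
        rw [h.st_k]
        simp only [mul_assoc]
    _ = _ := by rw [h1]

theorem lst (hp : Generic q μ) {s s' t t' : B} (h : IsBMW3 q μ s s' t t') :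
    kap q μ t * s * t = kap q μ t * kap q μ s := by
  rw [mul_assoc, ← h.st_k, h.stk hp]

/-- Inverse generators satisfy the same relations with inverse parameter, up to the form of
`kap`; here only the consequence that is needed is stated. -/
theorem s't'k (hp : Generic q μ) {s s' t t' : B} (h : IsBMW3 q μ s s' t t') :
    s' * t' * kap q μ s = kap q μ t * kap q μ s := by
  have h0 : s' * t' * s = t * (s' * t') := by
    have := (h.symm hp).t's't
    calc s' * t' * s = s' * t' * s * (t * (s * s') * t') := by
          rw [h.mul_inv, mul_one, h.mul_inv', mul_one]
      _ = s' * t' * (s * t * s) * s' * t' := by simp only [mul_assoc]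
      _ = s' * (t' * t) * s * t * s' * t' := by rw [h.braid]; simp only [mul_assoc]
      _ = _ := by rw [h.inv_mul', mul_one, h.inv_mul, one_mul, mul_assoc]
  have h1 : s' * t' * kap q μ s = kap q μ t * (s' * t') := conj_kap h0
  have h2 : kap q μ s * (s' * t' * kap q μ s) = kap q μ s := by
    rw [← mul_assoc, ← mul_assoc, h.ks' hp, smul_mul_assoc, smul_mul_assoc, h.ksik, smul_smul,
      inv_mul_cancel₀ hp.mu_ne, one_smul]
  calc s' * t' * kap q μ s = kap q μ t * kap q μ s * kap q μ t * (s' * t') := by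
        rw [(h.symm hp).klk hp, h1]
    _ = kap q μ t * (kap q μ s * (s' * t' * kap q μ s)) := by
        rw [h1]
        simp only [mul_assoc]
    _ = _ := by rw [h2]

theorem ls't' (hp : Generic q μ) {s s' t t' : B} (h : IsBMW3 q μ s s' t t') :
    kap q μ t * s' * t' = kap q μ t * kap q μ s := by
  have h1 : kap q μ t * (kap q μ s * s') = μ⁻¹ • (kap q μ t * kap q μ s) := by
    rw [h.ks' hp, mul_smul_comm]
  have h2 := h.lst hp
  have h3 : t' * s' * kap q μ t = kap q μ s * kap q μ t := (h.symm hp).s't'k hp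
  have h0 : s' * t' * s = t * (s' * t') := by
    calc s' * t' * s = s' * t' * s * (t * (s * s') * t') := by
          rw [h.mul_inv, mul_one, h.mul_inv', mul_one]
      _ = s' * t' * (s * t * s) * s' * t' := by simp only [mul_assoc]
      _ = s' * (t' * t) * s * t * s' * t' := by rw [h.braid]; simp only [mul_assoc]
      _ = _ := by rw [h.inv_mul', mul_one, h.inv_mul, one_mul, mul_assoc]
  rw [mul_assoc, ← conj_kap h0, h.s't'k hp]

theorem tk (hp : Generic q μ) {s s' t t' : B} (h : IsBMW3 q μ s s' t t') :
    t * kap q μ s = s' * kap q μ t * kap q μ s := by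
  rw [mul_assoc, ← h.stk hp, ← mul_assoc, ← mul_assoc, h.inv_mul, one_mul]

theorem t'k (hp : Generic q μ) {s s' t t' : B} (h : IsBMW3 q μ s s' t t') :
    t' * kap q μ s = s * kap q μ t * kap q μ s := by
  rw [mul_assoc, ← h.s't'k hp, ← mul_assoc, ← mul_assoc, h.mul_inv, one_mul]

theorem kt (hp : Generic q μ) {s s' t t' : B} (h : IsBMW3 q μ s s' t t') :
    kap q μ s * t = kap q μ s * kap q μ t * s' := by
  rw [← (h.symm hp).lst hp, mul_assoc _ s, h.mul_inv, mul_one]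

end IsBMW3

/-- The baxterized element built from `s`. -/
def bax (q μ : ℂ) (s : B) (x : ℂ) : B :=
  1 + ((x - 1) / (q - q⁻¹)) • s + ((x - 1) / (q * μ⁻¹ * x + 1)) • kap q μ s

/-- These are the scalar conditions to which the Yang-Baxter equation reduces, attached in order to
s - t, κ_s t - s κ_t, t κ_s - κ_t s and κ_s - κ_t. -/
theorem bax_coeff (hp : Generic q μ) {x y : ℂ} (hx : q * μ⁻¹ * x + 1 ≠ 0)
    (hy : q * μ⁻¹ * y + 1 ≠ 0) (hxy : q * μ⁻¹ * (x * y) + 1 ≠ 0) :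
    (x - 1) / (q - q⁻¹) + (y - 1) / (q - q⁻¹)
        + (q - q⁻¹) * ((x - 1) / (q - q⁻¹) * ((y - 1) / (q - q⁻¹))) = (x * y - 1) / (q - q⁻¹) ∧
    (x - 1) / (q * μ⁻¹ * x + 1) * ((x * y - 1) / (q - q⁻¹))
        + (x * y - 1) / (q * μ⁻¹ * (x * y) + 1) * ((x - 1) / (q * μ⁻¹ * x + 1))
          * ((y - 1) / (q - q⁻¹))
      = (x * y - 1) / (q * μ⁻¹ * (x * y) + 1) * ((x - 1) / (q - q⁻¹))
        + (q - q⁻¹) * ((x * y - 1) / (q * μ⁻¹ * (x * y) + 1) * ((y - 1) / (q - q⁻¹))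
          * ((x - 1) / (q - q⁻¹))) ∧
    (y - 1) / (q * μ⁻¹ * y + 1) * ((x * y - 1) / (q - q⁻¹))
        + (x * y - 1) / (q * μ⁻¹ * (x * y) + 1) * ((y - 1) / (q * μ⁻¹ * y + 1))
          * ((x - 1) / (q - q⁻¹))
      = (x * y - 1) / (q * μ⁻¹ * (x * y) + 1) * ((y - 1) / (q - q⁻¹))
        + (q - q⁻¹) * ((x * y - 1) / (q * μ⁻¹ * (x * y) + 1) * ((y - 1) / (q - q⁻¹))
          * ((x - 1) / (q - q⁻¹))) ∧
    (x - 1) / (q * μ⁻¹ * x + 1) + (y - 1) / (q * μ⁻¹ * y + 1)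
        - (q - q⁻¹) * μ * ((x - 1) / (q - q⁻¹) * ((y - 1) / (q - q⁻¹)))
        + μ * ((x - 1) / (q - q⁻¹) * ((y - 1) / (q * μ⁻¹ * y + 1))
          + (x - 1) / (q * μ⁻¹ * x + 1) * ((y - 1) / (q - q⁻¹)))
        + (x - 1) / (q * μ⁻¹ * x + 1) * ((y - 1) / (q * μ⁻¹ * y + 1)) * eta q μ
        + (x * y - 1) / (q - q⁻¹) * ((x - 1) / (q * μ⁻¹ * x + 1))
          * ((y - 1) / (q * μ⁻¹ * y + 1)) * μ⁻¹
        + (x * y - 1) / (q * μ⁻¹ * (x * y) + 1) * ((x - 1) / (q * μ⁻¹ * x + 1))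
          * ((y - 1) / (q * μ⁻¹ * y + 1))
        - (q - q⁻¹) * ((x * y - 1) / (q * μ⁻¹ * (x * y) + 1))
          * ((x - 1) / (q - q⁻¹) * ((y - 1) / (q * μ⁻¹ * y + 1))
            + (x - 1) / (q * μ⁻¹ * x + 1) * ((y - 1) / (q - q⁻¹)))
      = (x * y - 1) / (q * μ⁻¹ * (x * y) + 1)
        - (q - q⁻¹) * (q - q⁻¹) * ((x * y - 1) / (q * μ⁻¹ * (x * y) + 1))
          * ((y - 1) / (q - q⁻¹)) * ((x - 1) / (q - q⁻¹)) := by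
  have h0 := hp.q_ne
  have hm := hp.mu_ne
  have hl := hp.lam_ne
  have hν : q * μ⁻¹ ≠ 0 := mul_ne_zero h0 (inv_ne_zero hm)
  -- With ν = q μ⁻¹ as a variable in place of μ, the identities no longer need q q⁻¹ = 1: q⁻¹ may be
  -- treated as an independent p, with q = l + p.
  have h1 : μ = q / (q * μ⁻¹) := by field_simp
  have h2 : μ⁻¹ = q * μ⁻¹ * q⁻¹ := by field_simp
  rw [eta_eq hp]
  generalize hν' : q * μ⁻¹ = ν at *
  generalize hp' : q⁻¹ = p at *
  obtain ⟨dx, hdx⟩ : ∃ d, d = ν * x + 1 := ⟨_, rfl⟩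
  obtain ⟨dy, hdy⟩ : ∃ d, d = ν * y + 1 := ⟨_, rfl⟩
  obtain ⟨dz, hdz⟩ : ∃ d, d = ν * (x * y) + 1 := ⟨_, rfl⟩
  obtain ⟨l, hl'⟩ : ∃ l, l = q - p := ⟨_, rfl⟩
  rw [h2]
  nth_rewrite 1 2 3 [h1]
  rw [← hdx] at hx
  rw [← hdy] at hy
  rw [← hdz] at hxy
  rw [← hl'] at hl
  rw [← hdx, ← hdy, ← hdz, ← hl']
  have hq : q = l + p := by rw [hl']; ring
  rw [hq]
  clear h1 h2 hν' hp' hp h0 hl' hm hq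
  refine ⟨?_, ?_, ?_, ?_⟩
  · field_simp
    ring
  · field_simp
    rw [hdx, hdz]
    ring
  · field_simp
    rw [hdy, hdz]
    ring
  · field_simp
    rw [hdx, hdy, hdz]
    ring

/-- Expand both sides and reduce each word by the relations between two neighbouring generators.
What remains is a combination of four differences of words, whose coefficients vanish by
`bax_coeff`. -/
theorem IsBMW3.yang_baxter (hp : Generic q μ) {s s' t t' : B} (h : IsBMW3 q μ s s' t t')
    {x y : ℂ} (hx : q * μ⁻¹ * x + 1 ≠ 0) (hy : q * μ⁻¹ * y + 1 ≠ 0)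
    (hxy : q * μ⁻¹ * (x * y) + 1 ≠ 0) :
    bax q μ s x * bax q μ t (x * y) * bax q μ s y
      = bax q μ t y * bax q μ s (x * y) * bax q μ t x := by
  have hl := hp.lam_ne
  have hm := hp.mu_ne
  have hs := h.symm hp
  have e1 := mul_self_eq hp s
  have e2 := mul_self_eq hp t
  have e3 := h.stk hp
  have e4 := hs.lst hp
  have e5 := hs.stk hp
  have e6 := h.lst hp
  have si_l : s' * kap q μ t = s * kap q μ t - (q - q⁻¹) • kap q μ t
      + (q - q⁻¹) • (kap q μ s * kap q μ t) := by
    rw [h.inv_eq hp, add_mul, sub_mul, smul_mul_assoc, smul_mul_assoc, one_mul]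
  have l_si : kap q μ t * s' = kap q μ t * s - (q - q⁻¹) • kap q μ t
      + (q - q⁻¹) • (kap q μ t * kap q μ s) := by
    rw [h.inv_eq hp, mul_add, mul_sub, mul_smul_comm, mul_smul_comm, mul_one]
  have e7 : t * kap q μ s * kap q μ t = s' * kap q μ t := by
    rw [h.tk hp, mul_assoc, mul_assoc, ← mul_assoc (kap q μ t), hs.klk hp]
  have e8 : kap q μ t * kap q μ s * t = kap q μ t * s' := by
    rw [mul_assoc, h.kt hp, ← mul_assoc, ← mul_assoc, hs.klk hp]
  have e9 : s * kap q μ t * kap q μ s = t * kap q μ s + (q - q⁻¹) • (kap q μ t * kap q μ s)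
      - (q - q⁻¹) • kap q μ s := by
    rw [← h.t'k hp, hs.inv_eq hp, add_mul, sub_mul, smul_mul_assoc, smul_mul_assoc, one_mul]
    abel
  have e10 : kap q μ s * kap q μ t * s = kap q μ s * t + (q - q⁻¹) • (kap q μ s * kap q μ t)
      - (q - q⁻¹) • kap q μ s := by
    have : kap q μ s * kap q μ t * s = kap q μ s * t' := by
      rw [← hs.ls't' hp, mul_assoc _ s', h.inv_mul, mul_one]
    rw [this, hs.inv_eq hp, mul_add, mul_sub, mul_smul_comm, mul_smul_comm, mul_one]
    abel
  -- t κ_s t equals s' κ_t s', and the skein relation for s' expresses this through s κ_t s and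
  -- shorter words.
  have e11 : t * kap q μ s * t = s * kap q μ t * s - (q - q⁻¹) • (s * kap q μ t)
      - (q - q⁻¹) • (kap q μ t * s) + (q - q⁻¹) • (t * kap q μ s)
      + (q - q⁻¹) • (kap q μ s * t) - ((q - q⁻¹) * (q - q⁻¹)) • kap q μ s
      + ((q - q⁻¹) * (q - q⁻¹)) • kap q μ t := by
    have : t * kap q μ s * t = s' * kap q μ t * s' := by
      rw [h.tk hp, mul_assoc, h.kt hp, ← mul_assoc, ← mul_assoc, mul_assoc s', mul_assoc s',
        hs.klk hp]
    rw [this, mul_assoc, l_si, h.inv_eq hp]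
    simp only [mul_add, mul_sub, add_mul, sub_mul, smul_mul_assoc, mul_smul_comm, one_mul,
      ← mul_assoc, e9, e10, h.klk hp, smul_add, smul_sub, smul_smul]
    module
  have w1 := h.ks
  have w2 := h.sk
  have w3 := h.kk hp
  have w4 := hs.ks
  have w5 := hs.sk
  have w6 := hs.kk hp
  have w7 := h.ksk
  have w8 := hs.ksk
  have w9 := h.klk hp
  have w10 := hs.klk hp
  have w11 := h.braid
  rw [si_l] at e7
  rw [l_si] at e8
  clear si_l l_si
  simp only [bax]
  generalize hk : kap q μ s = k at *
  generalize hk' : kap q μ t = l at *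
  obtain ⟨a, ha⟩ : ∃ a, a = (x - 1) / (q - q⁻¹) := ⟨_, rfl⟩
  obtain ⟨a', ha'⟩ : ∃ a, a = (x - 1) / (q * μ⁻¹ * x + 1) := ⟨_, rfl⟩
  obtain ⟨c, hc⟩ : ∃ a, a = (x * y - 1) / (q - q⁻¹) := ⟨_, rfl⟩
  obtain ⟨c', hc'⟩ : ∃ a, a = (x * y - 1) / (q * μ⁻¹ * (x * y) + 1) := ⟨_, rfl⟩
  obtain ⟨e, he⟩ : ∃ a, a = (y - 1) / (q - q⁻¹) := ⟨_, rfl⟩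
  obtain ⟨e', he'⟩ : ∃ a, a = (y - 1) / (q * μ⁻¹ * y + 1) := ⟨_, rfl⟩
  have heta := eta_eq hp
  simp only [← ha, ← ha', ← hc, ← hc', ← he, ← he']
  simp only [mul_add, add_mul, one_mul, mul_one, smul_mul_assoc, mul_smul_comm]
  simp only [e1, e2, e3, e4, e5, e6, e7, e8, e9, e10, e11, w1, w2, w3, w4, w5, w6, w7, w8, w9,
    w10, w11]
  obtain ⟨f1, f2, f3, f4⟩ := bax_coeff hp hx hy hxy
  rw [← ha, ← he, ← hc] at f1
  rw [← ha, ← he, ← hc, ← hc', ← ha'] at f2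
  rw [← ha, ← he, ← hc, ← hc', ← he'] at f3
  rw [← ha, ← he, ← hc, ← hc', ← he', ← ha'] at f4
  linear_combination (norm := module) f1 • (s - t) + f2 • (k * t - s * l) + f3 • (t * k - l * s)
    + f4 • (k - l)

end bmwRelations
end QMA
end

noncomputable section
namespace QMA

/-! ### The antisymmetrizers -/

section antisymmetrizers

variable {q μ : ℂ} {n : ℕ}

theorem σ_mul_σinv (j : Fin (n - 1)) : (σ j * σinv j : W q μ n) = 1 := by
  simpa [σ, σinv] using W_rel (BMWRel.mul_inv (q := q) (μ := μ) (n := n) j)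

theorem σinv_mul_σ (j : Fin (n - 1)) : (σinv j * σ j : W q μ n) = 1 := by
  simpa [σ, σinv] using W_rel (BMWRel.inv_mul (q := q) (μ := μ) (n := n) j)

theorem isBMW3_σ (i j : Fin (n - 1)) (h : (i : ℕ) + 1 = j) :
    IsBMW3 q μ (σ i : W q μ n) (σinv i) (σ j) (σinv j) where
  mul_inv := σ_mul_σinv i
  inv_mul := σinv_mul_σ i
  mul_inv' := σ_mul_σinv j
  inv_mul' := σinv_mul_σ j
  braid := by simpa [σ] using W_rel (BMWRel.braid (q := q) (μ := μ) i j h)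
  sk := by simpa [σ, map_kap] using W_rel (BMWRel.sk (q := q) (μ := μ) i)
  ksk := by simpa [σ, map_kap] using W_rel (BMWRel.ksk (q := q) (μ := μ) i j h)
  ksik := by simpa [σ, σinv, map_kap] using W_rel (BMWRel.ksik (q := q) (μ := μ) i j h)

theorem σ_far (i j : Fin (n - 1)) (h : (i : ℕ) + 1 < j) :
    Commute (σ i : W q μ n) (σ j) := by
  have := W_rel (BMWRel.far (q := q) (μ := μ) i j h)
  simpa [σ, Commute, SemiconjBy] using this

theorem σ_sk (j : Fin (n - 1)) : (σ j * kap q μ (σ j) : W q μ n) = μ • kap q μ (σ j) := by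
  simpa [σ, map_kap] using W_rel (BMWRel.sk (q := q) (μ := μ) j)

theorem W_mem (S : Subalgebra ℂ (W q μ n)) (h : ∀ j, σ j ∈ S) (h' : ∀ j, σinv j ∈ S)
    (w : W q μ n) : w ∈ S := by
  obtain ⟨x, rfl⟩ := RingQuot.mkAlgHom_surjective ℂ (BMWRel q μ n) w
  induction x using FreeAlgebra.induction with
  | grade0 r => simp
  | grade1 x =>
    rcases x with j | j
    · exact h j
    · exact h' j
  | mul a b ha hb => simpa using mul_mem ha hb
  | add a b ha hb => simpa using add_mem ha hb

theorem W_hom_ext {B : Type*} [Ring B] [Algebra ℂ B] {f g : W q μ n →ₐ[ℂ] B}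
    (h : ∀ j, f (σ j) = g (σ j)) : f = g := by
  refine AlgHom.ext fun w => W_mem (AlgHom.equalizer f g) h (fun j => ?_) w
  change f (σinv j) = g (σinv j)
  have h1 : f (σinv j) * f (σ j) = 1 := by rw [← map_mul, σinv_mul_σ, map_one]
  have h2 : f (σ j) * g (σinv j) = 1 := by rw [h, ← map_mul, σ_mul_σinv, map_one]
  exact left_inv_eq_right_inv h1 h2

theorem bmwLift_σ {B : Type*} [Ring B] [Algebra ℂ B] (s t : Fin (n - 1) → B)
    (h1 h2 h3 h4 h5 h6 h7 h8) (j : Fin (n - 1)) :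
    bmwLift (q := q) (μ := μ) s t h1 h2 h3 h4 h5 h6 h7 h8 (σ j) = s j := by
  simp [bmwLift, σ, preσ]

theorem up_σ (s : ℕ) {n : ℕ} (m : ℕ) (h : s + n ≤ m) (j : Fin (n - 1)) :
    up s m h (σ j : W q μ n) = σ ⟨s + j, by omega⟩ := bmwLift_σ _ _ _ _ _ _ _ _ _ _ _

theorem up_up (s t : ℕ) {n m l : ℕ} (h : s + n ≤ m) (h' : t + m ≤ l) (w : W q μ n) :
    up t l h' (up s m h w) = up (t + s) l (by omega) w := by
  have : (up t l h').comp (up s m h) = up (q := q) (μ := μ) (t + s) (n := n) l (by omega) :=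
    W_hom_ext fun j => by
      rw [AlgHom.comp_apply, up_σ, up_σ, up_σ]
      congr 2
      simp only
      omega
  exact DFunLike.congr_fun this w

theorem map_bax {B C : Type*} [Ring B] [Algebra ℂ B] [Ring C] [Algebra ℂ C] (f : B →ₐ[ℂ] C)
    (s : B) (x : ℂ) : f (bax q μ s x) = bax q μ (f s) x := by
  simp only [bax, map_add, map_one, map_smul, map_kap]

theorem baxMinus_eq (j : Fin (n - 1)) (x : ℂ) : (baxMinus j x : W q μ n) = bax q μ (σ j) x := rfl

theorem kap_neg_q_inv : kap q μ (-q⁻¹ : ℂ) = 0 := by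
  simp [kap]

/-- The one-dimensional representation `σ_i ↦ -q⁻¹`. -/
def signChar (hp : Generic q μ) (n : ℕ) : W q μ n →ₐ[ℂ] ℂ :=
  bmwLift (fun _ => -q⁻¹) (fun _ => -q) (fun _ => by simp [hp.q_ne]) (fun _ => by simp [hp.q_ne])
    (fun _ _ _ => rfl) (fun _ _ _ => rfl) (fun _ => by simp [kap_neg_q_inv])
    (fun _ => by simp [kap_neg_q_inv]) (fun _ _ _ => by simp [kap_neg_q_inv])
    (fun _ _ _ => by simp [kap_neg_q_inv])

theorem signChar_σ (hp : Generic q μ) (j : Fin (n - 1)) : signChar hp n (σ j) = -q⁻¹ :=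
  bmwLift_σ _ _ _ _ _ _ _ _ _ _ _

theorem signChar_up (hp : Generic q μ) (s : ℕ) {m : ℕ} (h : s + n ≤ m) (w : W q μ n) :
    signChar hp m (up s m h w) = signChar hp n w := by
  have : (signChar hp m).comp (up s m h) = signChar hp n := W_hom_ext fun j => by
    rw [AlgHom.comp_apply, up_σ, signChar_σ, signChar_σ]
  exact DFunLike.congr_fun this w

/-- All generators act on `a` by `-q⁻¹`, from both sides. -/
def Absorbs (a : W q μ n) : Prop := ∀ j, σ j * a = (-q⁻¹) • a ∧ a * σ j = (-q⁻¹) • a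

theorem Absorbs.mul_left (hp : Generic q μ) {a : W q μ n} (ha : Absorbs a) (w : W q μ n) :
    w * a = signChar hp n w • a := by
  let S : Subalgebra ℂ (W q μ n) :=
    { carrier := {w | w * a = signChar hp n w • a}
      mul_mem' := fun {x y} hx hy => by
        simp only [Set.mem_ofPred_eq] at hx hy ⊢
        rw [mul_assoc, hy, mul_smul_comm, hx, smul_smul, map_mul, mul_comm]
      add_mem' := fun {x y} hx hy => by
        simp only [Set.mem_ofPred_eq] at hx hy ⊢
        rw [add_mul, hx, hy, map_add, add_smul]
      algebraMap_mem' := fun r => by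
        simp only [Set.mem_ofPred_eq]
        rw [AlgHom.commutes, Algebra.smul_def]
        rfl }
  refine W_mem S (fun j => ?_) (fun j => ?_) w
  · change σ j * a = _
    rw [signChar_σ, (ha j).1]
  · change σinv j * a = _
    have h1 : signChar hp n (σinv j) * (-q⁻¹) = 1 := by
      rw [← signChar_σ hp j, ← map_mul, σinv_mul_σ, map_one]
    have h2 : σinv j * a = (signChar hp n (σinv j) * (-q⁻¹)) • (σinv j * a) := by
      rw [h1, one_smul]
    rw [h2, mul_smul, ← mul_smul_comm, ← (ha j).1, ← mul_assoc, σinv_mul_σ, one_mul]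

theorem Absorbs.mul_right (hp : Generic q μ) {a : W q μ n} (ha : Absorbs a) (w : W q μ n) :
    a * w = signChar hp n w • a := by
  let S : Subalgebra ℂ (W q μ n) :=
    { carrier := {w | a * w = signChar hp n w • a}
      mul_mem' := fun {x y} hx hy => by
        simp only [Set.mem_ofPred_eq] at hx hy ⊢
        rw [← mul_assoc, hx, smul_mul_assoc, hy, smul_smul, map_mul]
      add_mem' := fun {x y} hx hy => by
        simp only [Set.mem_ofPred_eq] at hx hy ⊢
        rw [mul_add, hx, hy, map_add, add_smul]
      algebraMap_mem' := fun r => by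
        simp only [Set.mem_ofPred_eq]
        rw [AlgHom.commutes, Algebra.smul_def, ← Algebra.commutes]
        rfl }
  refine W_mem S (fun j => ?_) (fun j => ?_) w
  · change a * σ j = _
    rw [signChar_σ, (ha j).2]
  · change a * σinv j = _
    have h1 : signChar hp n (σinv j) * (-q⁻¹) = 1 := by
      rw [← signChar_σ hp j, ← map_mul, σinv_mul_σ, map_one]
    have h2 : a * σinv j = (signChar hp n (σinv j) * (-q⁻¹)) • (a * σinv j) := by
      rw [h1, one_smul]
    rw [h2, mul_smul, ← smul_mul_assoc, ← (ha j).2, mul_assoc, σ_mul_σinv, mul_one]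

section ring

variable {B : Type*} [Ring B] [Algebra ℂ B]

theorem mul_kap_of_absorb {s a : B} (h : a * s = (-q⁻¹) • a) : a * kap q μ s = 0 := by
  rw [← mul_one (a * _), kap]
  have : (q • (1 : B) - s) * (q⁻¹ • 1 + s) = (q⁻¹ • 1 + s) * (q • 1 - s) := by
    simp only [mul_add, add_mul, mul_sub, sub_mul, smul_mul_assoc, mul_smul_comm, one_mul, mul_one]
    module
  rw [this, mul_one, mul_smul_comm, ← mul_assoc, mul_add, h, mul_smul_comm, mul_one, ← add_smul]
  simp

theorem kap_mul_of_absorb {s a : B} (h : s * a = (-q⁻¹) • a) : kap q μ s * a = 0 := by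
  rw [kap, smul_mul_assoc, mul_assoc, add_mul, h, smul_mul_assoc, one_mul, ← add_smul]
  simp

theorem mul_bax_of_absorb {s a : B} (h : a * s = (-q⁻¹) • a) (x : ℂ) :
    a * bax q μ s x = (1 - q⁻¹ * ((x - 1) / (q - q⁻¹))) • a := by
  rw [bax, mul_add, mul_add, mul_one, mul_smul_comm, mul_smul_comm, h, mul_kap_of_absorb h]
  module

theorem bax_mul_of_absorb {s a : B} (h : s * a = (-q⁻¹) • a) (x : ℂ) :
    bax q μ s x * a = (1 - q⁻¹ * ((x - 1) / (q - q⁻¹))) • a := by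
  rw [bax, add_mul, add_mul, one_mul, smul_mul_assoc, smul_mul_assoc, h, kap_mul_of_absorb h]
  module

theorem bax_commute {s a : B} (h : Commute a s) (x : ℂ) : Commute a (bax q μ s x) := by
  have : Commute a (kap q μ s) := (conj_kap h.eq : _)
  rw [bax]
  exact ((Commute.one_right a).add_right (h.smul_right _)).add_right (this.smul_right _)

/-- At x = q⁻² the coefficient of s is -q⁻¹ and the coefficient of κ is just such that s + q⁻¹
annihilates the element: up to a factor this is the antisymmetrizer on two strands. -/
theorem bax_two_mul (hp : Generic q μ) {s : B} (hs : s * kap q μ s = μ • kap q μ s)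
    (hd : q * μ⁻¹ * (q ^ 2)⁻¹ + 1 ≠ 0) :
    s * bax q μ s (q ^ 2)⁻¹ = (-q⁻¹) • bax q μ s (q ^ 2)⁻¹ := by
  have h0 := hp.q_ne
  have h1 := hp.mu_ne
  have h2 := hp.lam_ne
  have e1 : ((q ^ 2)⁻¹ - 1) / (q - q⁻¹) = -q⁻¹ := by
    rw [div_eq_iff h2]
    field_simp
    ring
  have e2 : μ * (((q ^ 2)⁻¹ - 1) / (q * μ⁻¹ * (q ^ 2)⁻¹ + 1)) + q⁻¹ * ((q - q⁻¹) * μ)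
      = -q⁻¹ * (((q ^ 2)⁻¹ - 1) / (q * μ⁻¹ * (q ^ 2)⁻¹ + 1)) := by
    generalize hd' : q * μ⁻¹ * (q ^ 2)⁻¹ + 1 = d at *
    have : (q⁻¹ + μ) = μ * d := by
      rw [← hd']
      field_simp
    have h3 : q⁻¹ * (q - q⁻¹) = 1 - (q ^ 2)⁻¹ := by
      field_simp
    field_simp
    rw [← sub_eq_zero]
    have : q ^ 2 * (μ * d) = q + q ^ 2 * μ := by
      rw [← this]
      field_simp
    have h4 : q * μ * d = 1 + q * μ := by
      apply mul_left_cancel₀ h0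
      linear_combination this
    linear_combination (q ^ 2 - 1) * h4
  rw [bax, e1, mul_add, mul_add, mul_one, mul_smul_comm, mul_smul_comm, mul_self_eq hp, hs]
  linear_combination (norm := module) e2 • kap q μ s - inv_mul_cancel₀ h0 • s

/-- Fusion. Write S, T for the baxterized elements of s, t. Since a absorbs s, a factor S(q⁻²) may
be created next to a; replacing the other a by c b S(x) b and moving b past T prepares the triple
S(q⁻²) T(q⁻²x) S(x). The Yang-Baxter equation turns it into T(x) S(q⁻²x) T(q⁻²), and T(q⁻²), after
commuting with b, stands at the outer end, where it absorbs t by `bax_two_mul`. The mirror argument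
serves the other side. -/
theorem absorb_step (hp : Generic q μ) {s s' t t' a b : B} (h : IsBMW3 q μ s s' t t') {c x : ℂ}
    (hab : a * b = a) (hba : b * a = a) (hbt : Commute b t) (h1 : a * s = (-q⁻¹) • a)
    (h2 : s * a = (-q⁻¹) • a) (ha : a = c • (b * bax q μ s x * b))
    (hv : 1 - q⁻¹ * (((q ^ 2)⁻¹ - 1) / (q - q⁻¹)) ≠ 0)
    (hd : q * μ⁻¹ * (q ^ 2)⁻¹ + 1 ≠ 0) (hx : q * μ⁻¹ * x + 1 ≠ 0)
    (hx' : q * μ⁻¹ * ((q ^ 2)⁻¹ * x) + 1 ≠ 0) :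
    a * bax q μ t ((q ^ 2)⁻¹ * x) * a * t = (-q⁻¹) • (a * bax q μ t ((q ^ 2)⁻¹ * x) * a) ∧
    t * (a * bax q μ t ((q ^ 2)⁻¹ * x) * a) = (-q⁻¹) • (a * bax q μ t ((q ^ 2)⁻¹ * x) * a) := by
  have yb1 := h.yang_baxter hp hd hx hx'
  have yb2 := h.yang_baxter hp hx hd (by rwa [mul_comm x])
  rw [mul_comm x] at yb2
  have hts := (h.symm hp).sk
  have b1 := bax_two_mul hp hts hd
  have b2 : bax q μ t (q ^ 2)⁻¹ * t = (-q⁻¹) • bax q μ t (q ^ 2)⁻¹ := by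
    rw [← b1, (bax_commute (Commute.refl t) _).eq]
  have m1 := mul_bax_of_absorb (μ := μ) h1 (q ^ 2)⁻¹
  have m2 := bax_mul_of_absorb (μ := μ) h2 (q ^ 2)⁻¹
  have c1 := bax_commute (q := q) (μ := μ) hbt
  generalize hT : bax q μ t ((q ^ 2)⁻¹ * x) = T at *
  generalize hv' : 1 - q⁻¹ * (((q ^ 2)⁻¹ - 1) / (q - q⁻¹)) = v at *
  have r1 : a * T * a = (v⁻¹ * c) • (a * bax q μ t x * bax q μ s ((q ^ 2)⁻¹ * x) * b
      * bax q μ t (q ^ 2)⁻¹) := by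
    calc a * T * a = a * T * (c • (b * bax q μ s x * b)) := by rw [← ha]
      _ = c • (a * (T * b) * bax q μ s x * b) := by
        simp only [mul_smul_comm, mul_assoc]
      _ = c • ((v⁻¹ * v) • a * T * bax q μ s x * b) := by
        rw [← hT, ← (c1 _).eq, ← mul_assoc a b, hab, inv_mul_cancel₀ hv, one_smul]
      _ = (v⁻¹ * c) • (a * bax q μ s (q ^ 2)⁻¹ * T * bax q μ s x * b) := by
        rw [m1]
        simp only [smul_mul_assoc, smul_smul]
        congr 1
        ring
      _ = (v⁻¹ * c) • (a * (bax q μ s (q ^ 2)⁻¹ * T * bax q μ s x) * b) := by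
        simp only [mul_assoc]
      _ = (v⁻¹ * c) • (a * bax q μ t x * bax q μ s ((q ^ 2)⁻¹ * x)
            * (bax q μ t (q ^ 2)⁻¹ * b)) := by
        rw [yb1]
        simp only [mul_assoc]
      _ = _ := by
        rw [← (c1 _).eq]
        simp only [mul_assoc]
  have r2 : a * T * a = (v⁻¹ * c) • (bax q μ t (q ^ 2)⁻¹ * (b * bax q μ s ((q ^ 2)⁻¹ * x)
      * bax q μ t x * a)) := by
    calc a * T * a = (c • (b * bax q μ s x * b)) * T * a := by rw [← ha]
      _ = c • (b * bax q μ s x * (b * T) * a) := by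
        simp only [smul_mul_assoc, mul_assoc]
      _ = c • (b * bax q μ s x * T * ((v⁻¹ * v) • a)) := by
        rw [← hT, (c1 _).eq, mul_assoc, mul_assoc _ b, hba, inv_mul_cancel₀ hv, one_smul]
        simp only [mul_assoc]
      _ = (v⁻¹ * c) • (b * (bax q μ s x * T * bax q μ s (q ^ 2)⁻¹) * a) := by
        have : b * (bax q μ s x * T * bax q μ s (q ^ 2)⁻¹) * a
            = b * bax q μ s x * T * (bax q μ s (q ^ 2)⁻¹ * a) := by simp only [mul_assoc]
        rw [this, m2]
        simp only [mul_smul_comm, smul_smul]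
        congr 1
        ring
      _ = (v⁻¹ * c) • ((b * bax q μ t (q ^ 2)⁻¹) * bax q μ s ((q ^ 2)⁻¹ * x)
            * bax q μ t x * a) := by
        rw [yb2]
        simp only [mul_assoc]
      _ = _ := by
        rw [(c1 _).eq]
        simp only [mul_assoc]
  constructor
  · rw [r1, smul_mul_assoc, mul_assoc, b2, mul_smul_comm, smul_comm]
  · rw [r2, mul_smul_comm, ← mul_assoc, b1, smul_mul_assoc, smul_comm]

end ring

/-- The conditions under which the antisymmetrizer `anti k` is well behaved. -/
def AntiOK (q μ : ℂ) (k : ℕ) : Prop :=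
  ∀ i, 1 ≤ i → i ≤ k → qnum q (i + 1) ≠ 0 ∧ q * μ⁻¹ * (q ^ (2 * i))⁻¹ + 1 ≠ 0

theorem AntiOK.mono {k l : ℕ} (h : AntiOK q μ k) (hl : l ≤ k) : AntiOK q μ l :=
  fun i h1 h2 => h i h1 (h2.trans hl)

/-- The bracket is the value of the baxterized element at σ = -q⁻¹, κ = 0. So the prefactor in the
definition of the antisymmetrizer normalizes its image under `signChar` to 1. -/
theorem anti_coeff (hp : Generic q μ) (k : ℕ) (hk : qnum q (k + 2) ≠ 0) :
    q ^ (k + 1) / qnum q (k + 2)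
      * (1 - q⁻¹ * (((q ^ (2 * (k + 1)))⁻¹ - 1) / (q - q⁻¹))) = 1 := by
  have h0 := hp.q_ne
  have h2 := hp.lam_ne
  rw [div_mul_eq_mul_div, div_eq_one_iff_eq hk, qnum, eq_div_iff h2]
  have h3 : q ^ (k + 2) = q * q ^ (k + 1) := by ring
  have h4 : q ^ (2 * (k + 1)) = q ^ (k + 1) * q ^ (k + 1) := by ring
  rw [h3, h4]
  have h5 : q ^ (k + 1) ≠ 0 := pow_ne_zero _ h0
  generalize q ^ (k + 1) = Q at *
  have h6 : (1 - q⁻¹ * (((Q * Q)⁻¹ - 1) / (q - q⁻¹))) * (q - q⁻¹)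
      = (q - q⁻¹) - q⁻¹ * ((Q * Q)⁻¹ - 1) := by
    generalize q - q⁻¹ = l at *
    field_simp
  rw [mul_assoc, h6]
  field_simp
  ring

theorem signChar_anti (hp : Generic q μ) (k : ℕ) (hk : AntiOK q μ k) :
    signChar hp (k + 1) (anti q μ k) = 1 := by
  induction k with
  | zero => exact map_one _
  | succ k ih =>
    rw [anti, map_smul, map_mul, map_mul, signChar_up, ih (hk.mono (by omega)), one_mul, mul_one,
      baxMinus_eq, map_bax, signChar_σ, bax, kap_neg_q_inv, smul_eq_mul, smul_eq_mul, smul_zero,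
      add_zero]
    linear_combination anti_coeff hp k (hk (k + 1) (by omega) le_rfl).1

theorem up_zero_commute_σ (w : W q μ n) (m : ℕ) (h : 0 + n ≤ m) (j : Fin (m - 1))
    (hj : n ≤ j) : Commute (up 0 m h w) (σ j) := by
  have : w ∈ (Subalgebra.centralizer ℂ {(σ j : W q μ m)}).comap (up 0 m h) := by
    refine W_mem _ (fun i => ?_) (fun i => ?_) w
    all_goals rw [Subalgebra.mem_comap, Subalgebra.mem_centralizer_iff]
    · rintro _ rfl
      rw [up_σ]
      refine (σ_far _ _ ?_).symm
      simp only
      omega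
    · rintro _ rfl
      have h1 : Commute (σ j : W q μ m) (up 0 m h (σ i : W q μ n)) := by
        rw [up_σ]
        refine (σ_far _ _ ?_).symm
        simp only
        omega
      have h2 : up 0 m h (σ i : W q μ n) * up 0 m h (σinv i) = 1 := by rw [← map_mul, σ_mul_σinv, map_one]
      have h3 : up 0 m h (σinv i : W q μ n) * up 0 m h (σ i) = 1 := by rw [← map_mul, σinv_mul_σ, map_one]
      exact (Commute.units_inv_right (a := σ j) (u := ⟨_, _, h2, h3⟩) h1)
  rw [Subalgebra.mem_comap, Subalgebra.mem_centralizer_iff] at this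
  exact (this _ rfl).symm

/-- Older generators are absorbed by the outer copies of the preceding antisymmetrizer; the newest
one is absorbed by `absorb_step`, in which b is the antisymmetrizer on one strand less than a. -/
theorem absorbs_anti (hp : Generic q μ) (k : ℕ) (hk : AntiOK q μ k) :
    Absorbs (anti q μ k) := by
  induction k with
  | zero => exact fun j => j.elim0
  | succ k ih =>
    have ih' := ih (hk.mono (by omega))
    intro j
    rw [anti, mul_smul_comm, smul_mul_assoc, smul_comm (-q⁻¹)]
    suffices h : σ j * (up 0 (k + 2) (by omega) (anti q μ k)
        * baxMinus ⟨k, by omega⟩ (q ^ (2 * (k + 1)))⁻¹ * up 0 (k + 2) (by omega) (anti q μ k))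
        = (-q⁻¹) • (up 0 (k + 2) (by omega) (anti q μ k)
        * baxMinus ⟨k, by omega⟩ (q ^ (2 * (k + 1)))⁻¹ * up 0 (k + 2) (by omega) (anti q μ k)) ∧
        (up 0 (k + 2) (by omega) (anti q μ k)
        * baxMinus ⟨k, by omega⟩ (q ^ (2 * (k + 1)))⁻¹ * up 0 (k + 2) (by omega) (anti q μ k)) * σ j
        = (-q⁻¹) • (up 0 (k + 2) (by omega) (anti q μ k)
        * baxMinus ⟨k, by omega⟩ (q ^ (2 * (k + 1)))⁻¹ * up 0 (k + 2) (by omega) (anti q μ k)) by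
      rw [h.1, h.2]
      exact ⟨rfl, rfl⟩
    by_cases hj : (j : ℕ) < k
    · have hj' : σ j = up 0 (k + 2) (by omega) (σ ⟨j, by omega⟩ : W q μ (k + 1)) := by
        rw [up_σ]
        congr 1
        apply Fin.ext
        simp
      have h1 := ih' ⟨j, by omega⟩
      constructor
      · rw [mul_assoc, ← mul_assoc, hj', ← map_mul, h1.1, map_smul, smul_mul_assoc]
      · rw [mul_assoc, hj', ← map_mul, h1.2, map_smul, mul_smul_comm]
    · have hj' : j = ⟨k, by omega⟩ := Fin.ext (by simp only; omega)
      rw [hj']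
      have hd := (hk 1 le_rfl (by omega)).2
      rw [mul_one] at hd
      -- For two strands the antisymmetrizer is a multiple of the baxterized element itself; there
      -- is no triple of strands for the Yang-Baxter equation yet.
      rcases k with _ | k
      · have : (up 0 (0 + 2) (by omega) (anti q μ 0) : W q μ 2) = 1 := map_one _
        rw [this, one_mul, mul_one, baxMinus_eq]
        have h1 := bax_two_mul hp (σ_sk (q := q) (μ := μ) (n := 0 + 2) ⟨0, by omega⟩) hd
        exact ⟨h1, (bax_commute (Commute.refl _) _).eq.symm.trans h1⟩
      · have h3 : IsBMW3 q μ (σ ⟨k, by omega⟩ : W q μ (k + 1 + 2)) (σinv ⟨k, by omega⟩)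
            (σ ⟨k + 1, by omega⟩) (σinv ⟨k + 1, by omega⟩) := isBMW3_σ _ _ rfl
        have hb : up 0 (k + 1 + 2) (by omega) (anti q μ k)
            = up 0 (k + 1 + 2) (by omega) (up 0 (k + 2) (by omega) (anti q μ k)) := by
          rw [up_up]
        have hx : (q ^ (2 * (k + 1 + 1)))⁻¹ = (q ^ 2)⁻¹ * (q ^ (2 * (k + 1)))⁻¹ := by
          rw [← mul_inv]
          congr 1
          ring
        have hs : (σ ⟨k, by omega⟩ : W q μ (k + 1 + 2))
            = up 0 (k + 1 + 2) (by omega) (σ ⟨k, by omega⟩ : W q μ (k + 2)) := by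
          rw [up_σ]
          congr 1
          apply Fin.ext
          simp
        have key := absorb_step hp h3 (a := up 0 (k + 1 + 2) (by omega) (anti q μ (k + 1)))
          (b := up 0 (k + 1 + 2) (by omega) (anti q μ k))
          (c := q ^ (k + 1) / qnum q (k + 2)) (x := (q ^ (2 * (k + 1)))⁻¹)
          (by rw [hb, ← map_mul, ih'.mul_right hp, signChar_up,
                signChar_anti hp k (hk.mono (by omega)), one_smul])
          (by rw [hb, ← map_mul, ih'.mul_left hp, signChar_up,
                signChar_anti hp k (hk.mono (by omega)), one_smul])
          (up_zero_commute_σ _ _ _ _ (by simp))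
          (by rw [hs, ← map_mul, (ih' _).2, map_smul])
          (by rw [hs, ← map_mul, (ih' _).1, map_smul])
          (by rw [anti, map_smul, map_mul, map_mul, ← hb, baxMinus_eq, map_bax, ← hs])
          (by
            have := anti_coeff hp 0 (hk 1 le_rfl (by omega)).1
            rw [Nat.zero_add, mul_one] at this
            exact right_ne_zero_of_mul (this ▸ one_ne_zero))
          hd (hk (k + 1) (by omega) (by omega)).2
          (by rw [← hx]; exact (hk (k + 1 + 1) (by omega) le_rfl).2)
        rw [baxMinus_eq, hx]
        exact ⟨key.2, key.1⟩

/-- The automorphism `σ_i ↦ σ_{n-i}`. -/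
def flip (hp : Generic q μ) (n : ℕ) : W q μ n →ₐ[ℂ] W q μ n :=
  bmwLift (fun j => σ j.rev) (fun j => σinv j.rev) (fun _ => σ_mul_σinv _) (fun _ => σinv_mul_σ _)
    (fun i j h => ((isBMW3_σ j.rev i.rev (by simp only [Fin.val_rev]; omega)).symm hp).braid)
    (fun i j h => (σ_far j.rev i.rev (by simp only [Fin.val_rev]; omega)).symm)
    (fun j => σ_sk _)
    (fun j => by rw [← (kap_commute _).eq, σ_sk])
    (fun i j h => ((isBMW3_σ j.rev i.rev (by simp only [Fin.val_rev]; omega)).symm hp).ksk)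
    (fun i j h => ((isBMW3_σ j.rev i.rev (by simp only [Fin.val_rev]; omega)).symm hp).ksik)

theorem flip_σ (hp : Generic q μ) (j : Fin (n - 1)) : flip hp n (σ j) = σ j.rev :=
  bmwLift_σ _ _ _ _ _ _ _ _ _ _ _

theorem signChar_flip (hp : Generic q μ) (w : W q μ n) :
    signChar hp n (flip hp n w) = signChar hp n w := by
  have : (signChar hp n).comp (flip hp n) = signChar hp n := W_hom_ext fun j => by
    rw [AlgHom.comp_apply, flip_σ, signChar_σ, signChar_σ]
  exact DFunLike.congr_fun this w

theorem flip_up (hp : Generic q μ) {k : ℕ} (w : W q μ (k + 1)) :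
    flip hp (k + 2) (up 0 (k + 2) (by omega) w) = up 1 (k + 2) (by omega) (flip hp (k + 1) w) := by
  have : (flip hp (k + 2)).comp (up 0 (k + 2) (by omega))
      = (up 1 (k + 2) (by omega)).comp (flip hp (k + 1)) := W_hom_ext fun j => by
    rw [AlgHom.comp_apply, AlgHom.comp_apply, up_σ, flip_σ, flip_σ, up_σ]
    congr 1
    apply Fin.ext
    simp only [Fin.val_rev]
    omega
  exact DFunLike.congr_fun this w

theorem absorbs_flip (hp : Generic q μ) {a : W q μ n} (h : Absorbs a) :
    Absorbs (flip hp n a) := by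
  intro j
  have h1 := h j.rev
  have h2 : flip hp n (σ j.rev) = σ j := by rw [flip_σ, Fin.rev_rev]
  rw [← h2, ← map_mul, ← map_mul, h1.1, h1.2, map_smul]
  exact ⟨rfl, rfl⟩

/-- Both elements absorb all generators and have the value 1 under `signChar`, so their product
equals either of them. -/
theorem flip_anti (hp : Generic q μ) (k : ℕ) (hk : AntiOK q μ k) :
    flip hp (k + 1) (anti q μ k) = anti q μ k := by
  have h1 := absorbs_anti hp k hk
  have h2 := h1.mul_right hp (flip hp (k + 1) (anti q μ k))
  have h3 := (absorbs_flip hp h1).mul_left hp (anti q μ k)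
  rw [signChar_flip, signChar_anti hp k hk, one_smul] at h2
  rw [signChar_anti hp k hk, one_smul] at h3
  rw [← h3, h2]

/-- The image of the definition under the reflection of strands. The new strand is now the first
one, the only strand that the traces defining M^α leave open. -/
theorem anti_succ (hp : Generic q μ) (k : ℕ) (hk : AntiOK q μ (k + 1)) :
    anti q μ (k + 1) = (q ^ (k + 1) / qnum q (k + 2)) • (up 1 (k + 2) (by omega) (anti q μ k)
      * bax q μ (σ ⟨0, by omega⟩) (q ^ (2 * (k + 1)))⁻¹
      * up 1 (k + 2) (by omega) (anti q μ k)) := by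
  rw [← flip_anti hp (k + 1) hk, anti, map_smul, map_mul, map_mul, flip_up,
    flip_anti hp k (hk.mono (by omega)), baxMinus_eq, map_bax, flip_σ]
  congr 5
  apply Fin.ext
  simp [Fin.val_rev]

theorem anti_mul_self (hp : Generic q μ) (k : ℕ) (hk : AntiOK q μ k) :
    anti q μ k * anti q μ k = anti q μ k := by
  rw [(absorbs_anti hp k hk).mul_left hp, signChar_anti hp k hk, one_smul]

end antisymmetrizers
end QMA
end

noncomputable section
namespace QMA

/-! ### The weight matrices of compatible pairs -/

section weights

variable {N : ℕ} {A : Type*} [Ring A] [Algebra ℂ A]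

theorem Twists.sum_conj {R F : TMat N 2 ℂ} (T : Twists R F) (a b c c' : Fin N) :
    ∑ t, ∑ s, ∑ u, opD R t s * (F⁻¹ ![a, s] ![c, u] * F ![c', u] ![b, t])
      = if a = b then opD R c' c else 0 := by
  have h := congrFun (congrFun (T.trTail_single c c') a) b
  rw [trTail_one_apply, Matrix.smul_apply, Matrix.one_apply, smul_eq_mul, mul_ite, mul_one,
    mul_zero] at h
  rw [← h]
  refine Finset.sum_congr rfl fun t _ => Finset.sum_congr rfl fun s _ => ?_
  rw [← Finset.mul_sum]
  exact congrArg _ (mul_single_mul_apply F⁻¹ F c c' _ _).symm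

theorem Twists.sum_conj' {R F : TMat N 2 ℂ} (T : Twists R F) (a b c c' : Fin N) :
    ∑ t, ∑ s, ∑ u, opD R t s * (F ![a, s] ![c, u] * F⁻¹ ![c', u] ![b, t])
      = if a = b then opD R c' c else 0 := by
  have h := T.inv.sum_conj a b c c'
  rwa [Matrix.nonsing_inv_nonsing_inv _ ((Matrix.isUnit_iff_isUnit_det _).mp T.isUnit)] at h

/-- Contracting `Twists.sum_conj'` with Ψ_F removes F and leaves D_R next to F⁻¹ alone. -/
theorem Twists.inv_mul_opD {R F : TMat N 2 ℂ} (T : Twists R F) (hF : SkewInvertible F)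
    (c' b p p' : Fin N) :
    ∑ t, opD R t p' * F⁻¹ ![c', p] ![b, t] = ∑ c, opD R c' c * skewInv F ![p, c] ![p', b] := by
  have h1 := (isHalfSkew_iff _ _).1 (skewInv_spec hF).2 p
  calc ∑ t, opD R t p' * F⁻¹ ![c', p] ![b, t]
      = ∑ t, ∑ s, ∑ u, opD R t s * ((∑ c, ∑ a, skewInv F ![p, c] ![p', a] * F ![a, s] ![c, u])
          * F⁻¹ ![c', u] ![b, t]) := by
        refine Finset.sum_congr rfl fun t _ => ?_
        simp only [h1]
        rw [Finset.sum_eq_single p', Finset.sum_eq_single p]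
        · simp
        · intro u _ hu
          simp [hu.symm]
        · simp
        · intro s _ hs
          simp [hs]
        · simp
    _ = ∑ c, ∑ a, skewInv F ![p, c] ![p', a] *
          ∑ t, ∑ s, ∑ u, opD R t s * (F ![a, s] ![c, u] * F⁻¹ ![c', u] ![b, t]) := by
        simp only [Finset.sum_mul, Finset.mul_sum]
        have e : ∀ (f : Fin N → Fin N → Fin N → Fin N → Fin N → ℂ),
            ∑ t, ∑ s, ∑ u, ∑ c, ∑ a, f t s u c a = ∑ c, ∑ a, ∑ t, ∑ s, ∑ u, f t s u c a := by
          intro f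
          simp only [← Fintype.sum_prod_type']
          refine Fintype.sum_bijective (fun x => (⟨x.2.2.2.1, x.2.2.2.2, x.1, x.2.1, x.2.2.1⟩))
            (Function.bijective_iff_has_inverse.2
              ⟨fun x => ⟨x.2.2.1, x.2.2.2.1, x.2.2.2.2, x.1, x.2.1⟩, fun _ => rfl, fun _ => rfl⟩)
            _ _ fun _ => rfl
        rw [e]
        refine Finset.sum_congr rfl fun _ _ => Finset.sum_congr rfl fun _ _ =>
          Finset.sum_congr rfl fun _ _ => Finset.sum_congr rfl fun _ _ =>
          Finset.sum_congr rfl fun _ _ => ?_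
        ring
    _ = _ := by
        refine Finset.sum_congr rfl fun c _ => ?_
        simp only [T.sum_conj', mul_ite, mul_zero, Finset.sum_ite_eq', Finset.mem_univ, if_true]
        ring

theorem Twists.opD_mul_inv {R F : TMat N 2 ℂ} (T : Twists R F) (hF : SkewInvertible F)
    (a c p p' : Fin N) :
    ∑ s, opD R p s * F⁻¹ ![a, s] ![c, p'] = ∑ x, skewInv F ![p, a] ![p', x] * opD R x c := by
  have h1 := (isHalfSkew_iff _ _).1 (skewInv_spec hF).2 p
  calc ∑ s, opD R p s * F⁻¹ ![a, s] ![c, p']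
      = ∑ t, ∑ s, ∑ u, opD R t s * (F⁻¹ ![a, s] ![c, u] *
          (∑ b, ∑ x, skewInv F ![p, b] ![p', x] * F ![x, u] ![b, t])) := by
        simp only [h1]
        symm
        rw [Finset.sum_eq_single p]
        · refine Finset.sum_congr rfl fun s _ => ?_
          rw [Finset.sum_eq_single p']
          · simp
          · intro u _ hu
            simp [hu]
          · simp
        · intro t _ ht
          simp [ht.symm]
        · simp
    _ = ∑ b, ∑ x, skewInv F ![p, b] ![p', x] *
          ∑ t, ∑ s, ∑ u, opD R t s * (F⁻¹ ![a, s] ![c, u] * F ![x, u] ![b, t]) := by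
        simp only [Finset.mul_sum]
        have e : ∀ (f : Fin N → Fin N → Fin N → Fin N → Fin N → ℂ),
            ∑ t, ∑ s, ∑ u, ∑ c, ∑ a, f t s u c a = ∑ c, ∑ a, ∑ t, ∑ s, ∑ u, f t s u c a := by
          intro f
          simp only [← Fintype.sum_prod_type']
          refine Fintype.sum_bijective (fun x => (⟨x.2.2.2.1, x.2.2.2.2, x.1, x.2.1, x.2.2.1⟩))
            (Function.bijective_iff_has_inverse.2
              ⟨fun x => ⟨x.2.2.1, x.2.2.2.1, x.2.2.2.2, x.1, x.2.1⟩, fun _ => rfl, fun _ => rfl⟩)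
            _ _ fun _ => rfl
        rw [e]
        refine Finset.sum_congr rfl fun _ _ => Finset.sum_congr rfl fun _ _ =>
          Finset.sum_congr rfl fun _ _ => Finset.sum_congr rfl fun _ _ =>
          Finset.sum_congr rfl fun _ _ => ?_
        ring
    _ = _ := by
        rw [Finset.sum_comm]
        refine Finset.sum_congr rfl fun x _ => ?_
        simp only [T.sum_conj, mul_ite, mul_zero, Finset.sum_ite_eq, Finset.mem_univ, if_true]

/-- The matrix `D ⊗ D`. -/
def sqr (D : Matrix (Fin N) (Fin N) ℂ) : TMat N 2 ℂ :=
  Matrix.of fun f g => D (f 0) (g 0) * D (f 1) (g 1)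

theorem opS_sqr (D : Matrix (Fin N) (Fin N) ℂ) (j : ℕ) :
    (opS j (sqr D) : Op N A) = opS j (toOne D) * opS (j + 1) (toOne D) := by
  rw [opS_two_eq, opS_one_eq, opS_one_eq]
  simp only [Finset.sum_mul]
  refine Finset.sum_congr rfl fun a _ => ?_
  rw [Finset.sum_comm]
  refine Finset.sum_congr rfl fun a' _ => ?_
  simp only [Finset.mul_sum, sqr, Matrix.of_apply, smul_mul_smul_comm]
  rfl

theorem TMat.sum_two {B : Type*} [AddCommMonoid B] (f : (Fin 2 → Fin N) → B) :
    ∑ x, f x = ∑ a, ∑ b, f ![a, b] := by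
  rw [← Equiv.sum_comp (finTwoArrowEquiv (Fin N)).symm, Fintype.sum_prod_type]
  rfl

/-- By `Twists.inv_mul_opD` and `Twists.opD_mul_inv`, both F⁻¹ (D ⊗ D) and (D ⊗ D) F⁻¹ are the same
contraction of Ψ_F with two copies of D = D_R. -/
theorem Twists.sqr_commute {R F : TMat N 2 ℂ} (T : Twists R F) (hF : SkewInvertible F) :
    Commute F (sqr (opD R)) := by
  have h : F⁻¹ * sqr (opD R) = sqr (opD R) * F⁻¹ := by
    ext f g
    rw [Matrix.mul_apply, Matrix.mul_apply, TMat.sum_two, TMat.sum_two]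
    have hf : ∀ f : Fin 2 → Fin N, f = ![f 0, f 1] := fun f => by
      funext i
      fin_cases i <;> rfl
    rw [hf f, hf g]
    generalize f 0 = c'
    generalize f 1 = p
    generalize g 0 = y
    generalize g 1 = p'
    simp only [sqr, Matrix.of_apply, Matrix.cons_val_zero, Matrix.cons_val_one]
    calc ∑ b, ∑ t, F⁻¹ ![c', p] ![b, t] * (opD R b y * opD R t p')
        = ∑ b, opD R b y * ∑ t, opD R t p' * F⁻¹ ![c', p] ![b, t] := by
          simp only [Finset.mul_sum]
          refine Finset.sum_congr rfl fun _ _ => Finset.sum_congr rfl fun _ _ => ?_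
          ring
      _ = ∑ c, opD R c' c * ∑ b, skewInv F ![p, c] ![p', b] * opD R b y := by
          simp only [T.inv_mul_opD hF, Finset.mul_sum]
          rw [Finset.sum_comm]
          refine Finset.sum_congr rfl fun _ _ => Finset.sum_congr rfl fun _ _ => ?_
          ring
      _ = _ := by
          simp only [← T.opD_mul_inv hF, Finset.mul_sum]
          refine Finset.sum_congr rfl fun _ _ => Finset.sum_congr rfl fun _ _ => ?_
          ring
  calc F * sqr (opD R) = F * (sqr (opD R) * F⁻¹) * F := by
        rw [mul_assoc, mul_assoc, T.inv_mul, mul_one]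
    _ = sqr (opD R) * F := by rw [← h, ← mul_assoc, T.mul_inv, one_mul]

theorem Twists.ptr_cyclic {R F : TMat N 2 ℂ} (T : Twists R F) (hF : SkewInvertible F) (j : ℕ)
    (X : Op N A) : ptr (opD R) j (ptr (opD R) (j + 1) (opS j F * X))
      = ptr (opD R) j (ptr (opD R) (j + 1) (X * opS j F)) := by
  apply ptr_two_comm
  rw [← opS_sqr]
  exact (T.sqr_commute hF).map (opS j)

theorem Twists.trTail_inv {R F : TMat N 2 ℂ} (T : Twists R F) (hF : SkewInvertible F) :
    trTail (opD R) (k := 1) F⁻¹ = opC F * opD R := by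
  ext a b
  rw [trTail_one_apply, Matrix.mul_apply]
  simp only [smul_eq_mul, T.opD_mul_inv hF, opC, Matrix.of_apply, Finset.sum_mul]
  rw [Finset.sum_comm]

/-- The Yang-Baxter equation gives F₂ F₁ = F₁ (F₂ F₁ F₂⁻¹). Take the R-trace over the third factor
and drop the conjugation under it. -/
theorem Twists.weight_mul {R F : TMat N 2 ℂ} (T : Twists R F) (TF : Compatible F F) (j : ℕ) :
    (opS (j + 1) (toOne (trTail (opD R) (k := 1) F)) * opS j F : Op N A)
      = opS j F * opS j (toOne (trTail (opD R) (k := 1) F)) := by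
  have h1 : (opS (j + 1) F * opS j F : Op N A)
      = opS j F * (opS (j + 1) F * opS j F * opS (j + 1) F⁻¹) := by
    have h := congrArg (opS (A := A) j) TF.1
    simp only [map_mul, fst3, snd3, opS_site, Nat.add_zero] at h
    simp only [← mul_assoc]
    rw [h, mul_assoc, T.opS_mul_inv, mul_one]
  rw [← ptr_opS_eq_opS_trTail, ← ptr_opS_eq_opS_trTail,
    ← ptr_mul_right _ (opS_mem_cm (by omega) _), h1, ptr_mul_left _ (opS_mem_cm (by omega) _),
    T.ptr_conj (opS_mem_cm (by omega) _)]

theorem compatible_inv {F : TMat N 2 ℂ} (hF : IsUnit F) (h : Compatible F F) :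
    Compatible F⁻¹ F⁻¹ := by
  have h1 := Matrix.mul_nonsing_inv _ ((Matrix.isUnit_iff_isUnit_det _).mp hF)
  have h2 := Matrix.nonsing_inv_mul _ ((Matrix.isUnit_iff_isUnit_det _).mp hF)
  have key : fst3 F⁻¹ * snd3 F⁻¹ * fst3 F⁻¹ = snd3 F⁻¹ * fst3 F⁻¹ * snd3 F⁻¹ := by
    have e1 : (fst3 F * snd3 F * fst3 F) * (fst3 F⁻¹ * snd3 F⁻¹ * fst3 F⁻¹) = 1 := by
      have e2 : fst3 F * fst3 F⁻¹ = 1 := by rw [fst3, ← site_mul, h1, site_one]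
      have e3 : snd3 F * snd3 F⁻¹ = 1 := by rw [snd3, ← site_mul, h1, site_one]
      simp only [mul_assoc]
      rw [← mul_assoc (fst3 F) (fst3 F⁻¹), e2, one_mul, ← mul_assoc (snd3 F), e3, one_mul, e2]
    have e4 : (snd3 F⁻¹ * fst3 F⁻¹ * snd3 F⁻¹) * (snd3 F * fst3 F * snd3 F) = 1 := by
      have e2 : fst3 F⁻¹ * fst3 F = 1 := by rw [fst3, ← site_mul, h2, site_one]
      have e3 : snd3 F⁻¹ * snd3 F = 1 := by rw [snd3, ← site_mul, h2, site_one]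
      simp only [mul_assoc]
      rw [← mul_assoc (snd3 F⁻¹) (snd3 F), e3, one_mul, ← mul_assoc (fst3 F⁻¹), e2, one_mul, e3]
    rw [← h.1] at e4
    exact (left_inv_eq_right_inv e4 e1).symm
  exact ⟨key, key.symm⟩

theorem site_one_apply (Y : Matrix (Fin N) (Fin N) ℂ) (f g : Fin 2 → Fin N) :
    (site 2 1 (by omega) (toOne Y) : TMat N 2 ℂ) f g = if f 0 = g 0 then Y (f 1) (g 1) else 0 := by
  by_cases h1 : f 0 = g 0
  · rw [site, leg_apply, if_pos h1]
    · rfl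
    · intro j hj
      fin_cases j
      · exact h1
      · exact absurd ⟨0, rfl⟩ hj
  · rw [site, leg_apply_zero, if_neg h1]
    intro h2
    exact h1 (h2 0 (by rintro ⟨i, hi⟩; simpa [shiftEmb_val] using congrArg Fin.val hi))

theorem site_one_mul_apply (Y : Matrix (Fin N) (Fin N) ℂ) (X : TMat N 2 ℂ) (a s : Fin N)
    (g : Fin 2 → Fin N) :
    (site 2 1 (by omega) (toOne Y) * X : TMat N 2 ℂ) ![a, s] g = ∑ d, Y s d * X ![a, d] g := by
  rw [Matrix.mul_apply, TMat.sum_two, Finset.sum_eq_single a]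
  · simp [site_one_apply]
  · intro b _ hb
    simp [site_one_apply, hb.symm]
  · simp

/-- Let E = Tr_{R(2)} F. The D_F-weighted trace of E₂ F = F E₁ over the second factor shows that D_F
E and D_R have the same contraction with F, and such a contraction determines the matrix by
`eq_opD_smul`. -/
theorem Twists.opD_mul_weight {R F : TMat N 2 ℂ} (T : Twists R F) (TF : Compatible F F)
    (hF : SkewInvertible F) : opD F * trTail (opD R) (k := 1) F = opD R := by
  have h1 := congrArg (ptr (opD F) 1) (T.weight_mul (A := ℂ) TF 0)
  have h0 := ptr_opS_self (A := ℂ) hF 0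
  rw [Nat.zero_add] at h0 h1
  rw [ptr_mul_right _ (X := opS 0 (toOne (trTail (opD R) (k := 1) F)))
    (opS_mem_cm (by omega) _), h0, one_mul] at h1
  have e : (opS 1 (toOne (trTail (opD R) (k := 1) F)) : Op N ℂ)
      = opS 0 (site 2 1 (by omega) (toOne (trTail (opD R) (k := 1) F))) := by rw [opS_site]
  rw [e, ← map_mul] at h1
  have h2 := opS_one_injective 0 ((ptr_opS_eq_opS_trTail (A := ℂ) (opD F) 0 _).symm.trans h1)
  have h3 : ∀ a b, ∑ t, ∑ s, opD F t s * ∑ d, trTail (opD R) (k := 1) F s d * F ![a, d] ![b, t]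
      = ∑ t, ∑ s, opD R t s * F ![a, s] ![b, t] := fun a b => by
    have h4 := congrFun (congrFun h2 a) b
    rw [trTail_one_apply] at h4
    conv_rhs at h4 => rw [trTail_one_apply]
    refine Eq.trans ?_ h4
    refine Finset.sum_congr rfl fun t _ => Finset.sum_congr rfl fun s _ => ?_
    exact congrArg _ (site_one_mul_apply _ F a s _).symm
  generalize trTail (opD R) (k := 1) F = E at h3 ⊢
  rw [← sub_eq_zero]
  ext c' c
  have h5 := eq_opD_smul hF (fun c c' => (opD F * E - opD R) c' c) 0 (fun a a' => by
    rw [ite_self]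
    have h6 := sub_eq_zero.2 (h3 a a')
    rw [← h6, Finset.sum_comm, ← Finset.sum_sub_distrib]
    refine Finset.sum_congr rfl fun t _ => ?_
    simp only [Matrix.sub_apply, Matrix.mul_apply, smul_eq_mul, mul_sub, Finset.sum_sub_distrib,
      Finset.mul_sum]
    rw [Finset.sum_comm]
    congr 1
    · refine Finset.sum_congr rfl fun _ _ => Finset.sum_congr rfl fun _ _ => ?_
      ring
    · refine Finset.sum_congr rfl fun _ _ => ?_
      ring) c c'
  simpa using h5

/-- The matrix of `X` for which `IsHalfSkew` is a product of matrices. -/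
def skewMat (X : TMat N 2 ℂ) : Matrix (Fin N × Fin N) (Fin N × Fin N) ℂ :=
  Matrix.of fun f g => X ![f.1, g.2] ![f.2, g.1]

theorem isHalfSkew_iff_skewMat (X Y : TMat N 2 ℂ) :
    IsHalfSkew X Y ↔ skewMat X * skewMat Y = 1 := by
  rw [isHalfSkew_iff]
  have h : ∀ a c a' c', (skewMat X * skewMat Y) (a, a') (c', c)
      = ∑ b, ∑ x, X ![a, b] ![a', x] * Y ![x, c] ![b, c'] := fun a c a' c' => by
    rw [Matrix.mul_apply, Fintype.sum_prod_type, Finset.sum_comm]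
    rfl
  constructor
  · intro h1
    ext ⟨a, a'⟩ ⟨c', c⟩
    rw [h, h1, Matrix.one_apply]
    congr 1
    simp [eq_comm]
  · intro h1 a c a' c'
    rw [← h, h1, Matrix.one_apply]
    congr 1
    simp [eq_comm]

/-- After rearranging indices the condition says that one square matrix is inverse to another, and
one-sided inverses are two-sided. -/
theorem IsHalfSkew.symm {X Y : TMat N 2 ℂ} (h : IsHalfSkew X Y) : IsHalfSkew Y X := by
  rw [isHalfSkew_iff_skewMat] at h ⊢
  exact mul_eq_one_comm.1 h

/-- For the pair (F, F), `Twists.sum_conj` contracts F⁻¹ with F weighted by D_F and leaves D_F.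
Cancelling this by D_F⁻¹ turns a rotated F into a skew inverse. -/
theorem skewInvertible_inv {F : TMat N 2 ℂ} (T : Twists F F) (hD : IsUnit (opD F)) :
    SkewInvertible F⁻¹ := by
  have hD' : (opD F)⁻¹ * opD F = 1 :=
    Matrix.nonsing_inv_mul _ ((Matrix.isUnit_iff_isUnit_det _).mp hD)
  suffices h : IsHalfSkew F⁻¹ (Matrix.of fun f g => ∑ d, ∑ t,
      (opD F)⁻¹ (f 1) d * F ![d, f 0] ![g 1, t] * opD F t (g 0)) from ⟨_, h, h.symm⟩
  rw [isHalfSkew_iff]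
  intro a c a' c'
  simp only [Matrix.of_apply, Matrix.cons_val_zero, Matrix.cons_val_one]
  calc _ = ∑ d, (opD F)⁻¹ c d * ∑ t, ∑ s, ∑ u,
        opD F t s * (F⁻¹ ![a, s] ![a', u] * F ![d, u] ![c', t]) := by
        simp only [Finset.mul_sum]
        have e : ∀ (f : Fin N → Fin N → Fin N → Fin N → ℂ),
            ∑ s, ∑ u, ∑ d, ∑ t, f s u d t = ∑ d, ∑ t, ∑ s, ∑ u, f s u d t := by
          intro f
          simp only [← Fintype.sum_prod_type']
          refine Fintype.sum_bijective (fun x => (⟨x.2.2.1, x.2.2.2, x.1, x.2.1⟩))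
            (Function.bijective_iff_has_inverse.2
              ⟨fun x => ⟨x.2.2.1, x.2.2.2, x.1, x.2.1⟩, fun _ => rfl, fun _ => rfl⟩)
            _ _ fun _ => rfl
        rw [e]
        refine Finset.sum_congr rfl fun _ _ => Finset.sum_congr rfl fun _ _ =>
          Finset.sum_congr rfl fun _ _ => Finset.sum_congr rfl fun _ _ => ?_
        ring
    _ = if a = c' then ((opD F)⁻¹ * opD F) c a' else 0 := by
        simp only [T.sum_conj, Matrix.mul_apply]
        split_ifs <;> simp
    _ = _ := by
        rw [hD', Matrix.one_apply]
        by_cases h1 : a = c' <;> by_cases h2 : c = a' <;> simp [h1, h2]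

/-- The first trace is a right factor of D_R by `Twists.opD_mul_weight`. The second equals C_F D_R;
if instead D_F is invertible, then F⁻¹ is skew invertible and the first argument applies to it. -/
theorem isUnit_weight {R F : TMat N 2 ℂ} (T : Twists R F) (TF : Compatible F F)
    (hF : StrictSkewInvertible F) (hD : IsUnit (opD R)) :
    IsUnit (trTail (opD R) (k := 1) F) ∧ IsUnit (trTail (opD R) (k := 1) F⁻¹) := by
  have key : ∀ {X Y : Matrix (Fin N) (Fin N) ℂ}, X * Y = opD R → IsUnit Y := by
    intro X Y h
    rw [Matrix.isUnit_iff_isUnit_det] at hD ⊢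
    rw [← h, Matrix.det_mul] at hD
    exact isUnit_of_mul_isUnit_right hD
  refine ⟨key (T.opD_mul_weight TF hF.1), ?_⟩
  rcases hF.2 with h | h
  · rw [T.trTail_inv hF.1]
    exact h.mul hD
  · exact key (T.inv.opD_mul_weight (compatible_inv T.isUnit TF)
      (skewInvertible_inv ⟨hF.1, T.isUnit, TF⟩ h))

end weights
end QMA
end

noncomputable section
namespace QMA

/-! ### R-matrices of BMW type -/

section rmatrix

variable {N : ℕ} {A : Type*} [Ring A] [Algebra ℂ A]

theorem opS_two_injective (j : ℕ) : Function.Injective (opS j : TMat N 2 ℂ → Op N ℂ) := by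
  intro X Y h
  ext a b
  have h1 : ∀ Z : TMat N 2 ℂ, (opS j Z : Op N ℂ) (fun f => if f ∘ at' j 2 = b then 1 else 0)
      (Function.extend (at' j 2) a (fun _ => a 0)) = Z a b := by
    intro Z
    rw [opS_apply, opLeg_apply]
    simp only [extend_emb_comp, mul_ite, mul_one, mul_zero, Finset.sum_ite_eq', Finset.mem_univ,
      if_true]
    rfl
  rw [← h1 X, ← h1 Y, h]

/-- Otherwise a monic quadratic polynomial would annihilate R, whose minimal polynomial is cubic. -/
theorem kap_mul_ne_zero_of_minpoly {q μ : ℂ} {R : TMat N 2 ℂ}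
    (hc : (μ⁻¹ * (q - q⁻¹)⁻¹) ≠ 0) (h : minpoly ℂ R
      = (Polynomial.X - Polynomial.C q) * (Polynomial.X + Polynomial.C q⁻¹)
        * (Polynomial.X - Polynomial.C μ)) : kap q μ R ≠ 0 := by
  intro h0
  rw [kap, smul_eq_zero, or_iff_right hc] at h0
  have hm : ((Polynomial.X - Polynomial.C q) * (Polynomial.X + Polynomial.C q⁻¹)).Monic :=
    (Polynomial.monic_X_sub_C q).mul (Polynomial.monic_X_add_C q⁻¹)
  have h1 := minpoly.min ℂ R hm (by
    simp only [map_mul, map_sub, map_add, Polynomial.aeval_X, Polynomial.aeval_C,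
      Algebra.algebraMap_eq_smul_one]
    rw [← neg_sub, neg_mul, add_comm R, h0, neg_zero])
  rw [h, Polynomial.degree_mul, Polynomial.degree_X_sub_C,
    Polynomial.degree_eq_natDegree hm.ne_zero] at h1
  norm_cast at h1
  omega

namespace BMWPair

variable {q μ : ℂ}

theorem lam_ne_zero (D : BMWPair N q μ) : q - q⁻¹ ≠ 0 := by
  intro h
  have h1 : (q - 1) * (q + 1) = 0 := by
    have := congrArg (q * ·) h
    simp only [mul_sub, mul_inv_cancel₀ D.q_ne_zero, mul_zero] at this
    linear_combination this
  rcases mul_eq_zero.1 h1 with h2 | h2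
  · exact D.q_ne_one (sub_eq_zero.1 h2)
  · exact D.q_ne_neg_one (eq_neg_of_add_eq_zero_left h2)

theorem generic (D : BMWPair N q μ) : Generic q μ := ⟨D.q_ne_zero, D.mu_ne_zero, D.lam_ne_zero⟩

theorem eta_ne_zero (D : BMWPair N q μ) : eta q μ ≠ 0 := by
  rw [eta]
  refine div_ne_zero (mul_ne_zero (sub_ne_zero.2 D.mu_ne_q.symm) fun h => ?_)
    (mul_ne_zero D.mu_ne_zero D.lam_ne_zero)
  exact D.mu_ne_neg_q_inv (eq_neg_of_add_eq_zero_right h)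

variable (D : BMWPair N q μ)

theorem compatible_R : Compatible D.R D.R := ⟨D.R_isRMatrix.2, D.R_isRMatrix.2.symm⟩

theorem compatible_F : Compatible D.F D.F := ⟨D.F_isRMatrix.2, D.F_isRMatrix.2.symm⟩

theorem twists : Twists D.R D.F := ⟨D.R_skew, D.F_isRMatrix.1, D.compatible⟩

theorem twists_R : Twists D.R D.R := ⟨D.R_skew, D.R_isRMatrix.1, D.compatible_R⟩

theorem kap_opS (j : ℕ) : kap q μ (opS j D.R : Op N A) = opS j D.K := (map_kap _ _).symm

theorem bmw3 (j : ℕ) : IsBMW3 q μ (opS j D.R : Op N A) (opS j D.R⁻¹) (opS (j + 1) D.R)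
    (opS (j + 1) D.R⁻¹) where
  mul_inv := D.twists_R.opS_mul_inv j
  inv_mul := D.twists_R.opS_inv_mul j
  mul_inv' := D.twists_R.opS_mul_inv (j + 1)
  inv_mul' := D.twists_R.opS_inv_mul (j + 1)
  braid := D.twists_R.opS_up j
  sk := by rw [kap_opS, ← map_mul, R_mul_K, map_smul]
  ksk := by
    have := congrArg (opS (A := A) j) D.KRK
    simpa only [map_mul, map_smul, fst3, snd3, opS_site, Nat.add_zero, kap_opS] using this
  ksik := by
    have := congrArg (opS (A := A) j) D.KRinvK
    simpa only [map_mul, map_smul, fst3, snd3, opS_site, Nat.add_zero, kap_opS] using this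

theorem bmw3' (j : ℕ) : IsBMW3 q μ (opS (j + 1) D.R : Op N A) (opS (j + 1) D.R⁻¹) (opS j D.R)
    (opS j D.R⁻¹) := (D.bmw3 j).symm D.generic

theorem opS_inv_eq (j : ℕ) : (opS j D.R⁻¹ : Op N A)
    = opS j D.R - (q - q⁻¹) • 1 + (q - q⁻¹) • opS j D.K := by
  rw [(D.bmw3 j).inv_eq D.generic, kap_opS]

theorem K_ne_zero : D.K ≠ 0 := kap_mul_ne_zero_of_minpoly
  (mul_ne_zero (inv_ne_zero D.mu_ne_zero) (inv_ne_zero D.lam_ne_zero)) D.R_bmw.1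

theorem opS_K_ne_zero (j : ℕ) : (opS j D.K : Op N ℂ) ≠ 0 := fun h =>
  D.K_ne_zero (opS_two_injective j (h.trans (map_zero _).symm))

/-- R-trace of K₂ K₁ = R₁ R₂ K₁ over the third factor: Tr_R R₂ = I leaves R₁ K₁ = μ K₁. -/
theorem ptr_K_mul_K (j : ℕ) :
    ptr (opD D.R) (j + 1 + 1) (opS (j + 1) D.K : Op N A) * opS j D.K = μ • opS j D.K := by
  have h := D.bmw3 (A := A) j
  have h1 := h.stk D.generic
  have h2 := h.sk
  rw [kap_opS, kap_opS] at h1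
  rw [kap_opS] at h2
  rw [← ptr_mul_right _ (opS_mem_cm (by omega) _), ← h1, ptr_mul_right _ (opS_mem_cm (by omega) _),
    ptr_mul_left _ (opS_mem_cm (by omega) _), ptr_opS_self D.R_skew, mul_one, h2]

/-- Twist by the weight matrix of `R⁻¹`. -/
abbrev weight : Matrix (Fin N) (Fin N) ℂ := trTail (opD D.R) (k := 1) D.R⁻¹

theorem ptr_inv_mul_K_eq (j : ℕ) :
    ptr (opD D.R) (j + 1 + 1) (opS (j + 1) D.R⁻¹ : Op N A) * opS j D.K
      = (1 - (q - q⁻¹) * (opD D.R).trace + (q - q⁻¹) * μ) • opS j D.K := by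
  rw [opS_inv_eq, map_add, map_sub, map_smul, map_smul, ptr_opS_self D.R_skew, ptr_one, add_mul,
    sub_mul]
  simp only [smul_mul_assoc, ptr_K_mul_K, one_mul]
  module

/-- The trace in `ptr_K_mul_K` is computed again, now from K₂ K₁ = R₁⁻¹ R₂⁻¹ K₁. Comparing multiples
of K₁ ≠ 0 determines Tr D_R. -/
theorem trace_aux : 1 - (q - q⁻¹) * (opD D.R).trace + (q - q⁻¹) * μ = μ ^ 2 := by
  have h := D.bmw3 (A := ℂ) 0
  have h1 := h.s't'k D.generic
  have h2 := h.s'k D.generic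
  rw [kap_opS, kap_opS] at h1
  rw [kap_opS] at h2
  have h3 := D.ptr_K_mul_K (A := ℂ) 0
  rw [← ptr_mul_right _ (opS_mem_cm (by omega) _), ← h1, ptr_mul_right _ (opS_mem_cm (by omega) _),
    ptr_mul_left _ (opS_mem_cm (by omega) _), mul_assoc, D.ptr_inv_mul_K_eq, mul_smul_comm, h2,
    smul_smul] at h3
  have h4 := smul_left_injective ℂ (D.opS_K_ne_zero 0) h3
  rw [pow_two, ← (mul_inv_eq_iff_eq_mul₀ D.mu_ne_zero)]
  exact h4

theorem ptr_inv_mul_K (j : ℕ) :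
    ptr (opD D.R) (j + 1 + 1) (opS (j + 1) D.R⁻¹ : Op N A) * opS j D.K = μ ^ 2 • opS j D.K := by
  rw [ptr_inv_mul_K_eq, trace_aux]

theorem trace_opD : (opD D.R).trace = eta q μ * μ := by
  have h := D.trace_aux
  have h1 := D.lam_ne_zero
  have h2 := D.mu_ne_zero
  rw [eta_eq D.generic]
  generalize q - q⁻¹ = l at *
  field_simp
  linear_combination -h

/-- Let w be the weight. It satisfies w₂ R₁⁻¹ = R₁⁻¹ w₁ and w₂ K₁ = μ² K₁, hence also w₁ K₁ = μ² K₁.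
Writing K₁ K₂ = K₁ R₂⁻¹ R₁⁻¹ shows that K₁ K₂ carries (w - μ²)₁ to (w - μ²)₃, so (w - μ²)₃ K₁ = 0 by
K₁ K₂ K₁ = K₁. -/
theorem weight_eq : D.weight = μ ^ 2 • 1 := by
  have hw : ∀ j, (opS (j + 1) (toOne D.weight) * opS j D.R⁻¹ : Op N ℂ)
      = opS j D.R⁻¹ * opS j (toOne D.weight) := fun j =>
    D.twists_R.inv.weight_mul (compatible_inv D.R_isRMatrix.1 D.compatible_R) j
  have h1 : (opS 1 (toOne D.weight) * opS 0 D.K : Op N ℂ) = μ ^ 2 • opS 0 D.K := by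
    rw [weight, ← ptr_opS_eq_opS_trTail]
    exact D.ptr_inv_mul_K 0
  have hb := D.bmw3 (A := ℂ) 0
  have h2 : (opS 0 (toOne D.weight) * opS 0 D.K : Op N ℂ) = μ ^ 2 • opS 0 D.K := by
    have h3 := hb.s'k D.generic
    have h4 := hb.sk
    rw [kap_opS] at h3 h4
    have h5 := congrArg (fun x => opS 0 D.R * (x * opS 0 D.K)) (hw 0)
    simp only [mul_assoc, Nat.zero_add] at h5
    rw [h3, mul_smul_comm, h1, ← mul_assoc (opS 0 D.R) (opS 0 D.R⁻¹), hb.mul_inv, one_mul] at h5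
    rw [← h5, mul_smul_comm, mul_smul_comm, h4, smul_smul, smul_smul, mul_comm μ⁻¹, mul_assoc,
      inv_mul_cancel₀ D.mu_ne_zero, mul_one]
  have hX : ∀ j, (opS j (toOne (D.weight - μ ^ 2 • 1)) : Op N ℂ)
      = opS j (toOne D.weight) - μ ^ 2 • 1 := fun j => by
    have : toOne (D.weight - μ ^ 2 • 1) = toOne D.weight - μ ^ 2 • toOne 1 := rfl
    rw [this, map_sub, map_smul, toOne_one, map_one]
  have hw' : ∀ j, (opS (j + 1) (toOne (D.weight - μ ^ 2 • 1)) * opS j D.R⁻¹ : Op N ℂ)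
      = opS j D.R⁻¹ * opS j (toOne (D.weight - μ ^ 2 • 1)) := fun j => by
    rw [hX, hX, sub_mul, mul_sub, hw, smul_mul_assoc, mul_smul_comm, mul_one, one_mul]
  have h6 := (D.bmw3' (A := ℂ) 0).ls't' D.generic
  have h7 := hb.klk D.generic
  rw [kap_opS, kap_opS] at h6 h7
  have h8 : (opS 2 (toOne (D.weight - μ ^ 2 • 1)) * opS 0 D.K : Op N ℂ) = 0 := by
    have e0 : (opS 0 (toOne (D.weight - μ ^ 2 • 1)) * opS 0 D.K : Op N ℂ) = 0 := by
      rw [hX, sub_mul, h2, smul_mul_assoc, one_mul, sub_self]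
    have e1 : (opS 0 D.K * opS 1 D.K * opS 0 (toOne (D.weight - μ ^ 2 • 1)) : Op N ℂ)
        = opS 2 (toOne (D.weight - μ ^ 2 • 1)) * (opS 0 D.K * opS 1 D.K) := by
      calc _ = opS 0 D.K * opS 1 D.R⁻¹ * (opS 0 D.R⁻¹
              * opS 0 (toOne (D.weight - μ ^ 2 • 1))) := by rw [← h6, mul_assoc]
        _ = opS 0 D.K * (opS 2 (toOne (D.weight - μ ^ 2 • 1)) * opS 1 D.R⁻¹) * opS 0 D.R⁻¹ := by
            rw [← hw', hw' 1]
            simp only [mul_assoc, Nat.zero_add]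
        _ = opS 2 (toOne (D.weight - μ ^ 2 • 1)) * (opS 0 D.K * opS 1 D.R⁻¹ * opS 0 D.R⁻¹) := by
            have := (opS_comm (N := N) (A := ℂ) 0 2 (by omega) D.K
              (toOne (D.weight - μ ^ 2 • 1))).eq
            simp only [← mul_assoc]
            rw [this]
        _ = _ := by rw [h6]
    calc _ = opS 2 (toOne (D.weight - μ ^ 2 • 1)) * (opS 0 D.K * opS 1 D.K * opS 0 D.K) := by
          rw [h7]
      _ = 0 := by rw [← mul_assoc, ← e1, mul_assoc, e0, mul_zero]
  rw [← sub_eq_zero]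
  ext a b
  -- K₁ does not act in the third factor, so every entry of w - μ² multiplies K₁ ≠ 0 separately.
  have h9 := congrArg (coeffAt 2 a b) h8
  rw [opS_one_eq] at h9
  simp only [Finset.sum_mul, smul_mul_assoc, ← mul_smul_comm] at h9
  rw [coeffAt_sum _ (fun a b => (D.weight - μ ^ 2 • 1) a b • opS 0 D.K)
    (fun _ _ => Subalgebra.smul_mem _ (opS_mem_cm (by omega) _) _)] at h9
  have : coeffAt 2 a b (0 : Op N ℂ) = 0 := by simp [coeffAt]
  rw [this] at h9
  exact (smul_eq_zero.1 h9).resolve_right (D.opS_K_ne_zero 0)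

/-- Tr_{R(2)} R⁻¹ equals both C_R D_R and μ² I. -/
theorem isUnit_opD : IsUnit (opD D.R) := by
  have h := D.twists_R.trTail_inv D.R_skew
  have h1 : opC D.R * opD D.R = μ ^ 2 • 1 := by rw [← h, ← D.weight_eq]
  rw [Matrix.isUnit_iff_isUnit_det, isUnit_iff_ne_zero]
  intro h0
  have h2 := congrArg Matrix.det h1
  rw [Matrix.det_mul, h0, mul_zero, Matrix.det_smul, Matrix.det_one, mul_one] at h2
  exact pow_ne_zero _ (pow_ne_zero _ D.mu_ne_zero) h2.symm

theorem ptr_inv (j : ℕ) : ptr (opD D.R) (j + 1) (opS j D.R⁻¹ : Op N A) = μ ^ 2 • 1 := by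
  rw [ptr_opS_eq_opS_trTail]
  change opS j (toOne D.weight) = _
  rw [D.weight_eq]
  have : toOne (μ ^ 2 • (1 : Matrix (Fin N) (Fin N) ℂ)) = μ ^ 2 • toOne 1 := rfl
  rw [this, map_smul, toOne_one, map_one]

theorem ptr_K (j : ℕ) : ptr (opD D.R) (j + 1) (opS j D.K : Op N A) = μ • 1 := by
  have h := D.ptr_inv (A := A) j
  rw [opS_inv_eq, map_add, map_sub, map_smul, map_smul, ptr_opS_self D.R_skew, ptr_one,
    ← D.trace_aux] at h
  have h1 : (q - q⁻¹) • ptr (opD D.R) (j + 1) (opS j D.K : Op N A) = (q - q⁻¹) • μ • 1 := by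
    linear_combination (norm := module) h
  have h2 := congrArg ((q - q⁻¹)⁻¹ • ·) h1
  simpa only [smul_smul, ← mul_assoc, inv_mul_cancel₀ D.lam_ne_zero, one_mul, one_smul] using h2

end BMWPair

end rmatrix
end QMA
end

noncomputable section
namespace QMA

/-! ### The map `φ` -/

section phi

variable {N : ℕ} {A : Type*} [Ring A] [Algebra ℂ A]

/-- `X ↦ Tr₍₂₎ D₂ F₁₂ X₁ F₁₂⁻¹ S₁₂`. -/
def twistTr (D : Matrix (Fin N) (Fin N) ℂ) (F S : TMat N 2 ℂ) (X : Matrix (Fin N) (Fin N) A) :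
    Matrix (Fin N) (Fin N) A :=
  trTail (k := 1) D (scal F * site 2 0 (by omega) (toOne X) * scal F⁻¹ * scal S)

theorem iota_twistTr (D : Matrix (Fin N) (Fin N) ℂ) (F S : TMat N 2 ℂ)
    (X : Matrix (Fin N) (Fin N) A) : iota (twistTr D F S X)
      = ptr D 1 (opS 0 F * iota X * opS 0 F⁻¹ * opS 0 S) := by
  rw [twistTr, iota_trTail, etr_succ, etr_zero, map_mul (opLeg _), map_mul (opLeg _),
    map_mul (opLeg _), opLeg_site]
  rfl

theorem scal_self {n : ℕ} (X : TMat N n ℂ) : (scal X : TMat N n ℂ) = X := by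
  ext
  simp [scal]

theorem opS_zero_toOne (X : Matrix (Fin N) (Fin N) ℂ) :
    (opS 0 (toOne X) : Op N A) = iota (X.map (algebraMap ℂ A)) := rfl

/-- F, S and the weight are complex, so the map has the same complex N² × N² coefficient matrix over
every algebra. This will transfer invertibility from ℂ to the quantum matrix algebra. -/
theorem twistTr_apply (D : Matrix (Fin N) (Fin N) ℂ) (F S : TMat N 2 ℂ)
    (X : Matrix (Fin N) (Fin N) A) (a b : Fin N) : twistTr D F S X a b
      = ∑ c, ∑ d, twistTr D F S (Matrix.single c d (1 : ℂ)) a b • X c d := by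
  have h : iota (twistTr D F S X) = ∑ c, ∑ d,
      opA (X c d) * opS 0 (toOne (twistTr D F S (Matrix.single c d (1 : ℂ)))) := by
    rw [iota_twistTr, iota_eq_sum]
    simp only [Finset.mul_sum, Finset.sum_mul, map_sum]
    refine Finset.sum_congr rfl fun c _ => Finset.sum_congr rfl fun d _ => ?_
    rw [twistTr, scal_self, scal_self, scal_self, ← ptr_opS_eq_opS_trTail,
      ← ptr_mul_left _ (opA_mem_cm _ _), ← mul_assoc, ← (opA_comm_opS _ _ _).eq, map_mul (opS 0),
      map_mul (opS 0), map_mul (opS 0), opS_toOne_single]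
    simp only [mul_assoc, Nat.zero_add]
  have h1 := congrArg (fun Z : Op N A => Z (fun f => if f 0 = b then 1 else 0) (fun _ => a)) h
  simpa [iota_apply, Op.sum_apply, Op.mul_apply, opA_apply, opS_zero_toOne,
    Algebra.smul_def, Algebra.commutes] using h1

/-- Let E' = Tr_{R(2)} F and E = Tr_{R(2)} F⁻¹, both invertible by `isUnit_weight`. For Z =
Tr_{R(2)} F₁₂⁻¹ Y₁ R₁₂⁻¹ F₁₂ the image is E E' Y, so Y = (E E')⁻¹ Q gives a preimage of Q. -/
theorem twistTr_surjective {R F : TMat N 2 ℂ} (TR : Twists R R) (T : Twists R F)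
    (TF : Compatible F F) (hF : StrictSkewInvertible F) (hD : IsUnit (opD R)) :
    Function.Surjective (twistTr (A := A) (opD R) F R) := by
  intro Q
  obtain ⟨h1, h2⟩ := isUnit_weight T TF hF hD
  have hu := h2.mul h1
  set E' := trTail (opD R) (k := 1) F with hE'
  set E := trTail (opD R) (k := 1) F⁻¹ with hE
  have hinv : E * E' * (E * E')⁻¹ = 1 :=
    Matrix.mul_nonsing_inv _ ((Matrix.isUnit_iff_isUnit_det _).mp hu)
  let Y : Matrix (Fin N) (Fin N) A := ((E * E')⁻¹).map (algebraMap ℂ A) * Q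
  let Z : Matrix (Fin N) (Fin N) A := trTail (k := 1) (opD R)
    (scal F⁻¹ * site 2 0 (by omega) (toOne Y) * scal R⁻¹ * scal F)
  refine ⟨Z, iota_injective ?_⟩
  have hZ : iota Z = ptr (opD R) 1 (opS 0 F⁻¹ * iota Y * opS 0 R⁻¹ * opS 0 F) := by
    rw [iota_trTail, etr_succ, etr_zero, map_mul (opLeg _), map_mul (opLeg _),
      map_mul (opLeg _), opLeg_site]
    rfl
  have hY : ∀ X : TMat N 2 ℂ, iota Y * opS 1 X = opS 1 X * iota Y := fun X =>
    (commute_opS_two (iota_mem_cm _ (by omega)) (iota_mem_cm _ (by omega)) X).eq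
  have hW : (opS 0 F⁻¹ * iota Y * opS 0 R⁻¹ * opS 0 F : Op N A) ∈ cm N A 2 :=
    mul_mem (mul_mem (mul_mem (opS_mem_cm (by omega) _) (iota_mem_cm _ (by omega)))
      (opS_mem_cm (by omega) _)) (opS_mem_cm (by omega) _)
  have f1 := T.opS_mul_inv (A := A) 0
  have f2 := T.opS_inv_mul (A := A) 0
  have g1 := T.opS_mul_inv (A := A) 1
  have g2 := T.opS_inv_mul (A := A) 1
  have r1 := TR.opS_mul_inv (A := A) 0
  have s2 := TR.opS_inv_mul (A := A) 1
  have fgf : (opS 0 F * opS 1 F * opS 0 F : Op N A) = opS 1 F * opS 0 F * opS 1 F := by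
    have h := congrArg (opS (A := A) 0) TF.1
    simpa only [map_mul, fst3, snd3, opS_site, Nat.add_zero] using h
  have sfg : (opS 1 R * opS 0 F * opS 1 F : Op N A) = opS 0 F * opS 1 F * opS 0 R := by
    simpa using T.opS_down (A := A) 0
  have fE : (opS 1 (toOne E) * opS 0 F⁻¹ : Op N A) = opS 0 F⁻¹ * opS 0 (toOne E) := by
    simpa using T.inv.weight_mul (A := A) (compatible_inv T.isUnit TF) 0
  have E0 : ptr (opD R) 2 (opS 1 R⁻¹ * opS 0 F⁻¹ * opS 1 R : Op N A) = opS 0 (toOne E) := by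
    rw [TR.ptr_conj_inv (j := 1) (opS_mem_cm (by omega) _), hE]
    exact ptr_opS_eq_opS_trTail (opD R) 0 F⁻¹
  have E1 : ptr (opD R) 1 (opS 0 F : Op N A) = opS 0 (toOne E') :=
    ptr_opS_eq_opS_trTail (opD R) 0 F
  have cyc : ∀ X : Op N A, ptr (opD R) 1 (ptr (opD R) 2 (opS 1 F⁻¹ * X))
      = ptr (opD R) 1 (ptr (opD R) 2 (X * opS 1 F⁻¹)) := fun X => by
    have h := T.ptr_cyclic hF.1 1 (opS 1 F⁻¹ * X * opS 1 F⁻¹)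
    rw [mul_assoc _ _ (opS 1 F), g2, mul_one, ← mul_assoc, ← mul_assoc, g1, one_mul] at h
    exact h.symm
  have m0 : ∀ X : TMat N 2 ℂ, (opS 0 X : Op N A) ∈ cm N A 2 := fun X => opS_mem_cm (by omega) X
  generalize hf : (opS 0 F : Op N A) = f at *
  generalize hf' : (opS 0 F⁻¹ : Op N A) = f' at *
  generalize hg : (opS 1 F : Op N A) = g at *
  generalize hg' : (opS 1 F⁻¹ : Op N A) = g' at *
  generalize hr : (opS 0 R : Op N A) = r at *
  generalize hr' : (opS 0 R⁻¹ : Op N A) = r' at *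
  generalize hs : (opS 1 R : Op N A) = s at *
  generalize hs' : (opS 1 R⁻¹ : Op N A) = s' at *
  have mf := m0 F
  have mf' := m0 F⁻¹
  have mr := m0 R
  rw [hf] at mf
  rw [hf'] at mf'
  rw [hr] at mr
  have Yg := hY F
  have Yg' := hY F⁻¹
  have YE : iota Y * opS 1 (toOne E) = opS 1 (toOne E) * iota Y := by
    rw [opS_one_eq, Finset.mul_sum, Finset.sum_mul]
    refine Finset.sum_congr rfl fun a _ => ?_
    rw [Finset.mul_sum, Finset.sum_mul]
    refine Finset.sum_congr rfl fun b _ => ?_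
    rw [mul_smul_comm, smul_mul_assoc, (iota_comm_eu Y (by omega) a b).eq]
  rw [hg] at Yg
  rw [hg'] at Yg'
  have e1 : f * g * f' = g' * f * g := by
    calc f * g * f' = g' * (g * f * g) * f' := by simp only [← mul_assoc, g2, one_mul]
      _ = g' * f * g * (f * f') := by rw [← fgf]; simp only [mul_assoc]
      _ = _ := by rw [f1, mul_one]
  have e2 : f * g' * f' = g' * f' * g := by
    calc f * g' * f' = g' * f' * (f * g * f) * g' * f' := by
          simp only [← mul_assoc]
          rw [mul_assoc g' f' f, f2, mul_one, g2, one_mul]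
      _ = g' * f' * g * (f * (g * g') * f') := by rw [fgf]; simp only [mul_assoc]
      _ = _ := by rw [g1, mul_one, f1, mul_one]
  have e3 : g * r * g' = f' * s * f := by
    calc g * r * g' = f' * (f * g * r) * g' := by simp only [← mul_assoc, f2, one_mul]
      _ = f' * s * f * (g * g') := by rw [← sfg]; simp only [mul_assoc]
      _ = _ := by rw [g1, mul_one]
  have e4 : g * r' * g' = f' * s' * f := by
    have h1 : (g * r * g') * (g * r' * g') = 1 := by
      calc _ = g * (r * ((g' * g) * r')) * g' := by simp only [mul_assoc]
        _ = 1 := by rw [g2, one_mul, r1, mul_one, g1]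
    have h2 : (f' * s' * f) * (g * r * g') = 1 := by
      rw [e3]
      calc _ = f' * (s' * ((f * f') * s)) * f := by simp only [mul_assoc]
        _ = 1 := by rw [f1, one_mul, s2, mul_one, f2]
    exact (left_inv_eq_right_inv h2 h1).symm
  -- Conjugation by f and g brings everything into a form whose leftmost letter g' can be cycled
  -- through the double trace.
  have e5 : f * (g * (f' * iota Y * r' * f) * g') * f' = g' * f * iota Y * f' * s' * g := by
    calc _ = (f * g * f') * iota Y * r' * (f * g' * f') := by simp only [mul_assoc]
      _ = g' * f * (g * iota Y) * r' * (g' * f' * g) := by rw [e1, e2]; simp only [mul_assoc]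
      _ = g' * f * iota Y * (g * r' * g') * f' * g := by rw [← Yg]; simp only [mul_assoc]
      _ = g' * f * iota Y * f' * s' * (f * f') * g := by rw [e4]; simp only [mul_assoc]
      _ = _ := by rw [f1, mul_one]
  -- The trace defining Z is moved to one factor further on, which frees its original factor for the
  -- trace in the map itself.
  have e6 : ptr (opD R) 1 (f' * iota Y * r' * f)
      = ptr (opD R) 2 (g * (f' * iota Y * r' * f) * g') := by
    have := T.ptr_conj (j := 1) hW
    rw [hg, hg'] at this
    exact this.symm
  have e7 : f * opS 1 (toOne E) = opS 0 (toOne E) * f := by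
    calc f * opS 1 (toOne E) = f * (opS 1 (toOne E) * f') * f := by
          simp only [mul_assoc, f2, mul_one]
      _ = _ := by rw [fE, ← mul_assoc, f1, one_mul]
  rw [iota_twistTr, hf, hf', hr, hZ, e6, ← ptr_mul_left _ mf, ← ptr_mul_right _ mf',
    ← ptr_mul_right _ mr, e5]
  calc _ = ptr (opD R) 1 (ptr (opD R) 2 (g' * (f * iota Y * f' * s' * g * r))) := by
        simp only [mul_assoc]
    _ = ptr (opD R) 1 (ptr (opD R) 2 ((f * iota Y * f') * ((s' * f' * s) * f))) := by
        have : f * iota Y * f' * s' * g * r * g' = (f * iota Y * f') * ((s' * f' * s) * f) := by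
          calc _ = f * iota Y * f' * s' * (g * r * g') := by simp only [mul_assoc]
            _ = _ := by rw [e3]; simp only [mul_assoc]
        rw [cyc, this]
    _ = ptr (opD R) 1 (f * iota Y * (f' * opS 0 (toOne E)) * f) := by
        rw [ptr_mul_left _ (mul_mem (mul_mem mf (iota_mem_cm _ (by omega))) mf'),
          ptr_mul_right _ mf, E0]
        simp only [mul_assoc]
    _ = ptr (opD R) 1 (opS 0 (toOne E) * (f * iota Y)) := by
        rw [← fE]
        congr 1
        calc _ = f * (iota Y * opS 1 (toOne E)) * (f' * f) := by simp only [mul_assoc]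
          _ = _ := by rw [f2, mul_one, YE, ← mul_assoc, e7, mul_assoc]
    _ = opS 0 (toOne (E * E')) * iota Y := by
        rw [ptr_mul_left _ (opS_mem_cm (by omega) _), ptr_mul_right _ (iota_mem_cm _ (by omega)),
          E1, ← mul_assoc, ← map_mul, toOne_mul]
    _ = iota Q := by
        rw [opS_zero_toOne, ← iota_mul, ← mul_assoc, ← Matrix.map_mul, hinv,
          Matrix.map_one _ (map_zero _) (map_one _), one_mul]

/-- Surjectivity over ℂ makes the coefficient matrix invertible, and its inverse provides a left
inverse of the map over any algebra. -/
theorem twistTr_bijective {R F : TMat N 2 ℂ} (TR : Twists R R) (T : Twists R F)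
    (TF : Compatible F F) (hF : StrictSkewInvertible F) (hD : IsUnit (opD R)) :
    Function.Bijective (twistTr (A := A) (opD R) F R) := by
  refine ⟨?_, twistTr_surjective TR T TF hF hD⟩
  let P : Matrix (Fin N × Fin N) (Fin N × Fin N) ℂ := Matrix.of fun x y =>
    twistTr (opD R) F R (Matrix.single y.1 y.2 (1 : ℂ)) x.1 x.2
  have hP : IsUnit P := by
    rw [← Matrix.mulVec_surjective_iff_isUnit]
    intro v
    obtain ⟨X, hX⟩ := twistTr_surjective (A := ℂ) TR T TF hF hD (Matrix.of fun a b => v (a, b))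
    refine ⟨fun y => X y.1 y.2, funext fun x => ?_⟩
    have := congrFun (congrFun hX x.1) x.2
    rw [twistTr_apply] at this
    rw [Matrix.mulVec, dotProduct, Fintype.sum_prod_type]
    exact this
  have hP' : P⁻¹ * P = 1 := Matrix.nonsing_inv_mul _ ((Matrix.isUnit_iff_isUnit_det _).mp hP)
  have key : ∀ (X : Matrix (Fin N) (Fin N) A) (z : Fin N × Fin N),
      X z.1 z.2 = ∑ x, P⁻¹ z x • twistTr (opD R) F R X x.1 x.2 := by
    intro X z
    have h1 : ∀ x : Fin N × Fin N, twistTr (opD R) F R X x.1 x.2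
        = ∑ y, P x y • X y.1 y.2 := fun x => by
      rw [twistTr_apply, Fintype.sum_prod_type]
      rfl
    simp only [h1, Finset.smul_sum, smul_smul]
    rw [Finset.sum_comm]
    simp only [← Finset.sum_smul, ← Matrix.mul_apply, hP', Matrix.one_apply, ite_smul, one_smul,
      zero_smul, Finset.sum_ite_eq, Finset.mem_univ, if_true]
  intro X Y h
  ext a b
  rw [key X (a, b), key Y (a, b), h]

end phi
end QMA
end

/-! ### Cyclicity of iterated R-traces. -/

noncomputable section
namespace QMA

section traces

variable {N : ℕ} {A : Type*} [Ring A] [Algebra ℂ A] (D : Matrix (Fin N) (Fin N) ℂ)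

theorem etr_mul_left {s k : ℕ} {X : Op N A} (hX : ∀ j, s < j → j ≤ s + k → X ∈ cm N A j)
    (Y : Op N A) : etr D s k (X * Y) = X * etr D s k Y := by
  induction k generalizing Y with
  | zero => rfl
  | succ k ih =>
    rw [etr_succ, ptr_mul_left D (hX _ (by omega) (by omega)), ih fun j h1 h2 => hX j h1 (by omega),
      etr_succ]

theorem etr_mul_right {s k : ℕ} {X : Op N A} (hX : ∀ j, s < j → j ≤ s + k → X ∈ cm N A j)
    (Y : Op N A) : etr D s k (Y * X) = etr D s k Y * X := by
  induction k generalizing Y with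
  | zero => rfl
  | succ k ih =>
    rw [etr_succ, ptr_mul_right D (hX _ (by omega) (by omega)),
      ih fun j h1 h2 => hX j h1 (by omega), etr_succ]

theorem etr_add (s k l : ℕ) (X : Op N A) :
    etr D s (k + l) X = etr D s k (etr D (s + k) l X) := by
  induction l generalizing X with
  | zero => rfl
  | succ l ih => rw [← add_assoc, etr_succ, ih, etr_succ, add_assoc s k l]

theorem etr_succ' (s k : ℕ) (X : Op N A) :
    etr D s (k + 1) X = ptr D (s + 1) (etr D (s + 1) k X) := by
  rw [add_comm k, etr_add, etr_succ, etr_zero]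

/-- The operators `y` with `Tr y Z = Tr Z y` for all `Z`, for the trace over the factors
`s + 1, …, s + k`. -/
def cyc (A : Type*) [Ring A] [Algebra ℂ A] (s k : ℕ) : Subalgebra ℂ (Op N A) where
  carrier := {y | ∀ Z, etr D s k (y * Z) = etr D s k (Z * y)}
  mul_mem' := fun {x y} hx hy Z => by rw [mul_assoc, hx, mul_assoc, hy, mul_assoc]
  add_mem' := fun {x y} hx hy Z => by rw [add_mul, mul_add, map_add, map_add, hx, hy]
  algebraMap_mem' := fun c Z => by rw [Algebra.commutes]

theorem inv_mem_cyc {s k : ℕ} {y y' : Op N A} (h : y ∈ cyc D A s k) (h1 : y * y' = 1)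
    (h2 : y' * y = 1) : y' ∈ cyc D A s k := by
  intro Z
  have := h (y' * Z * y')
  rw [← mul_assoc, ← mul_assoc, h1, one_mul, mul_assoc _ y', h2, mul_one] at this
  exact this.symm

theorem kap_mem {B : Type*} [Ring B] [Algebra ℂ B] {S : Subalgebra ℂ B} {x : B} (h : x ∈ S)
    (q μ : ℂ) : kap q μ x ∈ S :=
  S.smul_mem (mul_mem (sub_mem (S.smul_mem (one_mem _) _) h)
    (add_mem (S.smul_mem (one_mem _) _) h)) _

/-- Split the trace into a, 2 and b factors, the middle two being those where S acts. S passes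
through the last b traces and is cycled by the middle two. -/
theorem opS_mem_cyc {S : TMat N 2 ℂ} (hS : ∀ (j : ℕ) (X : Op N A), ptr D j (ptr D (j + 1)
    (opS j S * X)) = ptr D j (ptr D (j + 1) (X * opS j S))) {s k i : ℕ} (h1 : s < i)
    (h2 : i + 1 ≤ s + k) : opS i S ∈ cyc D A s k := by
  intro Z
  obtain ⟨a, rfl⟩ : ∃ a, i = s + a + 1 := ⟨i - s - 1, by omega⟩
  obtain ⟨b, rfl⟩ : ∃ b, k = a + (2 + b) := ⟨k - a - 2, by omega⟩
  have hm : ∀ j, s + a + 2 < j → j ≤ s + a + 2 + b → (opS (s + a + 1) S : Op N A) ∈ cm N A j :=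
    fun j hj _ => opS_mem_cm (by omega) _
  simp only [etr_add D s a, etr_add D (s + a) 2]
  have e : ∀ X : Op N A, etr D (s + a) 2 X = ptr D (s + a + 1) (ptr D (s + a + 1 + 1) X) :=
    fun X => by rw [etr_succ, etr_succ, etr_zero, Nat.add_zero]
  rw [etr_mul_left D hm, etr_mul_right D hm, e, e, hS]

end traces

/-! ### Products of neighbouring operators and matrix copies. -/

section braidProducts

variable {N : ℕ} {A : Type*} [Ring A] [Algebra ℂ A]

/-- `X_s X_{s+1} ⋯ X_{s+n-1}`. -/
def asc (X : TMat N 2 ℂ) (s : ℕ) : ℕ → Op N A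
  | 0 => 1
  | n + 1 => asc X s n * opS (s + n) X

/-- `X_{s+n-1} ⋯ X_{s+1} X_s`. -/
def desc (X : TMat N 2 ℂ) (s : ℕ) : ℕ → Op N A
  | 0 => 1
  | n + 1 => opS (s + n) X * desc X s n

theorem asc_mul_desc {X Y : TMat N 2 ℂ} (h : X * Y = 1) (s n : ℕ) :
    (asc X s n * desc Y s n : Op N A) = 1 := by
  induction n with
  | zero => exact one_mul 1
  | succ n ih =>
    rw [asc, desc, mul_assoc, ← mul_assoc (opS _ X), ← map_mul, h, map_one, one_mul, ih]

theorem desc_mul_asc {X Y : TMat N 2 ℂ} (h : X * Y = 1) (s n : ℕ) :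
    (desc X s n * asc Y s n : Op N A) = 1 := by
  induction n with
  | zero => exact one_mul 1
  | succ n ih =>
    have h1 : (opS (s + n) X * opS (s + n) Y : Op N A) = 1 := by rw [← map_mul, h, map_one]
    rw [asc, desc, mul_assoc, ← mul_assoc (desc _ _ _), ih, one_mul, h1]

theorem asc_mem (S : Subalgebra ℂ (Op N A)) (X : TMat N 2 ℂ) (s n : ℕ)
    (h : ∀ j, s ≤ j → j < s + n → opS j X ∈ S) : asc X s n ∈ S := by
  induction n with
  | zero => exact one_mem _
  | succ n ih =>
    exact mul_mem (ih fun j h1 h2 => h j h1 (by omega)) (h _ (by omega) (by omega))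

theorem desc_mem (S : Subalgebra ℂ (Op N A)) (X : TMat N 2 ℂ) (s n : ℕ)
    (h : ∀ j, s ≤ j → j < s + n → opS j X ∈ S) : desc X s n ∈ S := by
  induction n with
  | zero => exact one_mem _
  | succ n ih =>
    exact mul_mem (h _ (by omega) (by omega)) (ih fun j h1 h2 => h j h1 (by omega))

theorem commute_of_mem_cm {j : ℕ} {Y : Op N A} (h : ∀ i, j ≤ i → i < j + 2 → Y ∈ cm N A i)
    (X : TMat N 2 ℂ) : Commute Y (opS j X) :=
  commute_opS_two (h j le_rfl (by omega)) (h (j + 1) (by omega) (by omega)) X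

theorem commute_asc {Y : Op N A} (X : TMat N 2 ℂ) (s n : ℕ)
    (h : ∀ j, s ≤ j → j < s + n → Commute Y (opS j X)) : Commute Y (asc X s n) := by
  induction n with
  | zero => exact Commute.one_right _
  | succ n ih =>
    exact (ih fun j h1 h2 => h j h1 (by omega)).mul_right (h _ (by omega) (by omega))

theorem commute_desc {Y : Op N A} (X : TMat N 2 ℂ) (s n : ℕ)
    (h : ∀ j, s ≤ j → j < s + n → Commute Y (opS j X)) : Commute Y (desc X s n) := by
  induction n with
  | zero => exact Commute.one_right _
  | succ n ih =>
    exact (h _ (by omega) (by omega)).mul_right (ih fun j h1 h2 => h j h1 (by omega))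

/-- The operator `X` moves the operator `Y` past two neighbouring copies of it. -/
theorem asc_mul_opS {X Y : TMat N 2 ℂ} (h : ∀ j, (opS (j + 1) Y * opS j X * opS (j + 1) X : Op N A)
      = opS j X * opS (j + 1) X * opS j Y) {s n i : ℕ} (h1 : s ≤ i) (h2 : i + 1 < s + n) :
    (asc X s n * opS i Y : Op N A) = opS (i + 1) Y * asc X s n := by
  induction n with
  | zero => omega
  | succ n ih =>
    by_cases hi : i + 1 < s + n
    · rw [asc, mul_assoc, (opS_comm (s + n) i (by omega) X Y).eq, ← mul_assoc, ih hi, mul_assoc]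
    · obtain ⟨m, rfl⟩ : ∃ m, n = m + 1 := ⟨n - 1, by omega⟩
      obtain rfl : i = s + m := by omega
      have hc : Commute (opS (s + m + 1) Y : Op N A) (asc X s m) :=
        commute_asc X s m fun j _ _ => opS_comm _ _ (by omega) _ _
      rw [asc, asc, ← add_assoc, mul_assoc, mul_assoc, ← mul_assoc (opS (s + m) X), ← h, mul_assoc,
        ← mul_assoc (asc X s m), ← hc.eq]
      simp only [mul_assoc]

/-- A matrix copy: `X_{\overline{j+1}}`. -/
def cp (F : TMat N 2 ℂ) (X : Matrix (Fin N) (Fin N) A) : ℕ → Op N A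
  | 0 => iota X
  | j + 1 => opS j F * cp F X j * opS j F⁻¹

/-- The product `X_{\overline{s+1}} ⋯ X_{\overline{s+k}}`. -/
def str (F : TMat N 2 ℂ) (X : Matrix (Fin N) (Fin N) A) (s : ℕ) : ℕ → Op N A
  | 0 => 1
  | k + 1 => str F X s k * cp F X (s + k)

variable {F : TMat N 2 ℂ} (X : Matrix (Fin N) (Fin N) A)

theorem cp_mem_cm {i j : ℕ} (h : j < i) : cp F X j ∈ cm N A i := by
  induction j with
  | zero => exact iota_mem_cm X (by omega)
  | succ j ih =>
    exact mul_mem (mul_mem (opS_mem_cm (by omega) _) (ih (by omega))) (opS_mem_cm (by omega) _)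

theorem str_mem_cm {i s k : ℕ} (h : s + k ≤ i) : str F X s k ∈ cm N A i := by
  induction k with
  | zero => exact one_mem _
  | succ k ih => exact mul_mem (ih (by omega)) (cp_mem_cm X (by omega))

theorem str_add (s k l : ℕ) : str F X s (k + l) = str F X s k * str F X (s + k) l := by
  induction l with
  | zero => exact (mul_one _).symm
  | succ l ih => rw [← add_assoc, str, ih, str, mul_assoc, add_assoc]

theorem str_one (s : ℕ) : str F X s 1 = cp F X s := one_mul _

theorem str_succ' (s k : ℕ) : str F X s (k + 1) = cp F X s * str F X (s + 1) k := by
  rw [add_comm, str_add, str_one]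

/-- The two outermost conjugations of the copy carry S_i to S_{i+1}, which acts outside the factors
of the copy inside; the decisive case is j = i + 2, and further conjugations commute with S_i. -/
theorem Twists.commute_cp {S : TMat N 2 ℂ} (T : Twists S F) {i j : ℕ} (h : i + 1 < j) :
    Commute (opS i S) (cp F X j) := by
  induction j with
  | zero => omega
  | succ j ih =>
    by_cases hi : i + 1 < j
    · have h1 : ∀ Y : TMat N 2 ℂ, Commute (opS i S : Op N A) (opS j Y) := fun Y =>
        opS_comm _ _ (by omega) _ _
      exact ((h1 _).mul_right (ih hi)).mul_right (h1 _)
    · obtain rfl : j = i + 1 := by omega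
      have h1 := T.opS_up (A := A) i
      have h2 : (opS (i + 1) S * opS i F⁻¹ * opS (i + 1) F⁻¹ : Op N A)
          = opS i F⁻¹ * opS (i + 1) F⁻¹ * opS i S := T.inv.opS_down i
      have h3 : Commute (cp F X i) (opS (i + 1) S) :=
        commute_of_mem_cm (fun l _ _ => cp_mem_cm X (by omega)) S
      calc opS i S * cp F X (i + 1 + 1)
          = (opS i S * opS (i + 1) F * opS i F) * cp F X i * opS i F⁻¹ * opS (i + 1) F⁻¹ := by
            rw [cp, cp]
            simp only [mul_assoc]
        _ = opS (i + 1) F * opS i F * (cp F X i * opS (i + 1) S) * opS i F⁻¹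
              * opS (i + 1) F⁻¹ := by
            rw [h1, h3.eq]
            simp only [mul_assoc]
        _ = opS (i + 1) F * opS i F * cp F X i * (opS (i + 1) S * opS i F⁻¹
              * opS (i + 1) F⁻¹) := by
            simp only [mul_assoc]
        _ = _ := by
            rw [h2, cp, cp]
            simp only [mul_assoc]

theorem Twists.opS_mul_cp {S : TMat N 2 ℂ} (T : Twists S F) (j : ℕ) :
    opS j F * cp F X j = cp F X (j + 1) * opS j F := by
  rw [cp, mul_assoc _ (opS j F⁻¹), T.opS_inv_mul, mul_one]

/-- Only one of the factors of F_s ⋯ F_{s+n-1} raises the copy. Those to its right act outside the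
copy, and those to its left commute with the raised copy by `Twists.commute_cp`. -/
theorem Twists.asc_mul_cp (T : Twists F F) {s n j : ℕ} (h1 : s ≤ j) (h2 : j < s + n) :
    asc F s n * cp F X j = cp F X (j + 1) * asc F s n := by
  induction n with
  | zero => omega
  | succ n ih =>
    by_cases hj : j < s + n
    · have h : Commute (cp F X j) (opS (s + n) F) :=
        commute_of_mem_cm (fun l _ _ => cp_mem_cm X (by omega)) F
      rw [asc, mul_assoc, ← h.eq, ← mul_assoc, ih hj, mul_assoc]
    · obtain rfl : j = s + n := by omega
      have h : Commute (cp F X (s + n + 1)) (asc F s n) :=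
        commute_asc F s n fun l _ _ => (T.commute_cp X (by omega)).symm
      rw [asc, mul_assoc, T.opS_mul_cp, ← mul_assoc, ← h.eq, mul_assoc]

theorem Twists.asc_mul_str (T : Twists F F) {s n k : ℕ} (h : k ≤ n) :
    asc F s n * str F X s k = str F X (s + 1) k * asc F s n := by
  induction k with
  | zero => rw [str, str, one_mul, mul_one]
  | succ k ih =>
    rw [str, str, ← mul_assoc, ih (by omega), mul_assoc, T.asc_mul_cp X (by omega) (by omega),
      mul_assoc]
    congr 3
    omega

/-- Each trace may be replaced by the trace of a conjugate over the next factor (`Twists.ptr_conj`);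
the conjugations collect into the product of neighbouring F. -/
theorem Twists.conj_etr {R : TMat N 2 ℂ} (T : Twists R F) {s k : ℕ} {Z : Op N A}
    (hZ : Z ∈ cm N A (s + k + 1)) : opS s F * etr (opD R) s k Z * opS s F⁻¹
      = etr (opD R) (s + 1) k (asc F s (k + 1) * Z * desc F⁻¹ s (k + 1)) := by
  induction k generalizing Z with
  | zero => simp [etr_zero, asc, desc]
  | succ k ih =>
    have h1 := T.ptr_conj hZ
    have h2 : (asc F s (k + 1) : Op N A) ∈ cm N A (s + k + 2) :=
      asc_mem _ _ _ _ fun j _ _ => opS_mem_cm (by omega) _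
    have h3 : (desc F⁻¹ s (k + 1) : Op N A) ∈ cm N A (s + k + 2) :=
      desc_mem _ _ _ _ fun j _ _ => opS_mem_cm (by omega) _
    rw [etr_succ, ih (ptr_mem_cm_self _ _ _), etr_succ]
    have e : s + 1 + k + 1 = s + (k + 1) + 1 := by omega
    have e' : s + k + 2 = s + (k + 1) + 1 := by omega
    rw [e'] at h2 h3
    have e1 : (asc F s (k + 1 + 1) : Op N A) = asc F s (k + 1) * opS (s + (k + 1)) F := rfl
    have e2 : (desc F⁻¹ s (k + 1 + 1) : Op N A) = opS (s + (k + 1)) F⁻¹ * desc F⁻¹ s (k + 1) := rfl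
    rw [e, e1, e2]
    have h4 : asc F s (k + 1) * opS (s + (k + 1)) F * Z
        * (opS (s + (k + 1)) F⁻¹ * desc F⁻¹ s (k + 1))
        = asc F s (k + 1) * (opS (s + (k + 1)) F * Z * opS (s + (k + 1)) F⁻¹)
          * desc F⁻¹ s (k + 1) := by
      simp only [mul_assoc]
    rw [h4, ptr_mul_right _ h3, ptr_mul_left _ h2, h1]
    rfl

end braidProducts
end QMA
end

/-! ### The R-matrix representation and the relations of the quantum matrix algebra. -/

noncomputable section
namespace QMA

/-- The elements intertwined by x form a subalgebra, and it contains σ_j⁻¹ along with σ_j. -/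
theorem W_semiconj {q μ : ℂ} {n : ℕ} {B : Type*} [Ring B] [Algebra ℂ B] {f g : W q μ n →ₐ[ℂ] B}
    {x : B} (h : ∀ j, x * f (σ j) = g (σ j) * x) (w : W q μ n) : x * f w = g w * x := by
  let S : Subalgebra ℂ (W q μ n) :=
    { carrier := {w | x * f w = g w * x}
      mul_mem' := fun {v w} hv hw => by
        simp only [Set.mem_ofPred_eq] at hv hw ⊢
        rw [map_mul, map_mul, ← mul_assoc, hv, mul_assoc, hw, mul_assoc]
      add_mem' := fun {v w} hv hw => by
        simp only [Set.mem_ofPred_eq] at hv hw ⊢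
        rw [map_add, map_add, mul_add, add_mul, hv, hw]
      algebraMap_mem' := fun r => by
        simp only [Set.mem_ofPred_eq]
        rw [AlgHom.commutes, AlgHom.commutes, Algebra.commutes] }
  refine W_mem S h (fun j => ?_) w
  change x * f (σinv j) = g (σinv j) * x
  have h1 : f (σ j) * f (σinv j) = 1 := by rw [← map_mul, σ_mul_σinv, map_one]
  have h2 : g (σinv j) * g (σ j) = 1 := by rw [← map_mul, σinv_mul_σ, map_one]
  calc x * f (σinv j) = g (σinv j) * (g (σ j) * x) * f (σinv j) := by
        rw [← mul_assoc, h2, one_mul]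
    _ = g (σinv j) * x * (f (σ j) * f (σinv j)) := by rw [← h j]; simp only [mul_assoc]
    _ = _ := by rw [h1, mul_one]

theorem W_map_mem {q μ : ℂ} {n : ℕ} {B : Type*} [Ring B] [Algebra ℂ B] (f : W q μ n →ₐ[ℂ] B)
    (S : Subalgebra ℂ B) (h : ∀ j, f (σ j) ∈ S) (h' : ∀ j, f (σinv j) ∈ S) (w : W q μ n) :
    f w ∈ S := W_mem (S.comap f) h h' w

namespace BMWPair

variable {N : ℕ} {q μ : ℂ} (D : BMWPair N q μ)

/-- Operators on infinitely many factors with entries in the quantum matrix algebra. -/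
abbrev Ops := Op N D.Alg

/-- The R-matrix representation, on the factors `s + 1, …, s + n`. -/
def rep (s : ℕ) {n : ℕ} : W q μ n →ₐ[ℂ] D.Ops := (opS s).comp (D.rho n)

theorem rep_apply (s : ℕ) {n : ℕ} (w : W q μ n) : D.rep s w = opS s (D.rho n w) := rfl

theorem rep_σ (s : ℕ) {n : ℕ} (j : Fin (n - 1)) :
    D.rep s (σ j : W q μ n) = opS (s + j) D.R := by
  have h : D.rho n (σ j) = site n j (by omega) D.R := bmwLift_σ _ _ _ _ _ _ _ _ _ _ _
  rw [rep_apply, h, opS_site]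

theorem rep_σinv (s : ℕ) {n : ℕ} (j : Fin (n - 1)) :
    D.rep s (σinv j : W q μ n) = opS (s + j) D.R⁻¹ := by
  have h1 : D.rep s (σinv j : W q μ n) * D.rep s (σ j) = 1 := by
    rw [← map_mul, σinv_mul_σ, map_one]
  have h2 : D.rep s (σ j : W q μ n) * opS (s + j) D.R⁻¹ = 1 := by
    rw [rep_σ, D.twists_R.opS_mul_inv]
  exact left_inv_eq_right_inv h1 h2

theorem rep_κ (s : ℕ) {n : ℕ} (j : Fin (n - 1)) :
    D.rep s (κ j : W q μ n) = opS (s + j) D.K := by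
  rw [κ, map_kap, rep_σ, kap_opS]

theorem rep_up (s t : ℕ) {n m : ℕ} (h : t + n ≤ m) (w : W q μ n) :
    D.rep s (up t m h w) = D.rep (s + t) w := by
  have : (D.rep s).comp (up t m h) = D.rep (s + t) (n := n) := W_hom_ext fun j => by
    rw [AlgHom.comp_apply, up_σ, rep_σ, rep_σ, add_assoc]
  exact DFunLike.congr_fun this w

theorem rep_mem_cm {s n i : ℕ} (h : i < s ∨ s + n ≤ i) (w : W q μ n) :
    D.rep s w ∈ cm N D.Alg i := opS_mem_cm h _

theorem rep_comm_opS {s n t k : ℕ} (h : s + n ≤ t ∨ t + k ≤ s) (w : W q μ n) (X : TMat N k ℂ) :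
    Commute (D.rep s w) (opS t X) := opS_comm _ _ h _ _

theorem rep_comm_rep {s n t k : ℕ} (h : s + n ≤ t ∨ t + k ≤ s) (w : W q μ n) (v : W q μ k) :
    Commute (D.rep s w) (D.rep t v) := opS_comm _ _ h _ _

/-- The matrix copies. -/
abbrev cp (X : D.Mat) (j : ℕ) : D.Ops := QMA.cp D.F X j

/-- The products of copies of the matrix of generators. -/
abbrev str (s k : ℕ) : D.Ops := QMA.str D.F D.M s k

/-- The traces over the factors `s + 1, …, s + k`. -/
abbrev tr (s k : ℕ) : D.Ops →ₗ[ℂ] D.Ops := etr (opD D.R) s k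

/-- The R-trace in the factor `j`. -/
abbrev pt (j : ℕ) : D.Ops →ₗ[ℂ] D.Ops := ptr (opD D.R) j

theorem twists_F : Twists D.F D.F := ⟨D.F_strict.1, D.F_isRMatrix.1, D.compatible_F⟩

theorem opLeg_copy (X : D.Mat) (n i : ℕ) (h : i < n) :
    opLeg (at' 0 n) (copy D.F X n i h) = D.cp X i := by
  induction i with
  | zero => rw [copy, opLeg_site]; rfl
  | succ i ih =>
    rw [copy, map_mul, map_mul, ih, ← opS_apply, ← opS_apply, opS_site, opS_site, Nat.zero_add]
    rfl

theorem opLeg_copies (s n k : ℕ) (h : s + n ≤ k) :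
    opLeg (at' 0 k) (List.ofFn fun i : Fin n => copy D.F D.M k (s + i) (by omega)).prod
      = D.str s n := by
  induction n with
  | zero => rw [List.ofFn_zero, List.prod_nil, map_one]; rfl
  | succ n ih =>
    rw [List.ofFn_succ_last, List.prod_append, map_mul, List.prod_singleton, opLeg_copy]
    exact congrArg (· * _) (ih (by omega))

theorem iota_matPow {k : ℕ} (α : W q μ (k + 1)) :
    iota (D.matPow α) = D.tr 0 k (D.str 0 (k + 1) * D.rep 0 α) := by
  have h := D.opLeg_copies 0 (k + 1) (k + 1) (by omega)
  have h' : (fun i : Fin (k + 1) => copy D.F D.M (k + 1) (0 + i) (by omega))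
      = fun i : Fin (k + 1) => copy D.F D.M (k + 1) i i.2 := by
    funext i
    congr 1
    omega
  rw [h'] at h
  rw [matPow, iota_trTail, map_mul (opLeg _), string, h]
  rfl

theorem iota_tail {k : ℕ} (α : W q μ (k + 1)) :
    iota (trTail (opD D.R) (D.stringTail k * scal (D.rho (k + 1) α)))
      = D.tr 0 k (D.str 1 k * D.rep 0 α) := by
  have h := D.opLeg_copies 1 k (k + 1) (by omega)
  have h' : (fun i : Fin k => copy D.F D.M (k + 1) (1 + i) (by omega))
      = fun i : Fin k => copy D.F D.M (k + 1) (i + 1) (by omega) := by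
    funext i
    congr 1
    omega
  rw [h'] at h
  rw [iota_trTail, map_mul (opLeg _), stringTail, h]
  rfl

theorem map_leg {A B : Type*} [Ring A] [Ring B] (f : A →+* B) {k n : ℕ} (e : Fin k ↪ Fin n)
    (X : TMat N k A) : (leg e X).map f = leg e (X.map f) := by
  ext x y
  simp only [leg, Matrix.map_apply, Matrix.of_apply]
  split_ifs <;> simp

theorem map_copy {A B : Type*} [Ring A] [Algebra ℂ A] [Ring B] [Algebra ℂ B] (f : A →ₐ[ℂ] B)
    (F : TMat N 2 ℂ) (X : Matrix (Fin N) (Fin N) A) (n i : ℕ) (h : i < n) :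
    (copy F X n i h).map f = copy F (X.map f) n i h := by
  have hs : ∀ Y : TMat N n ℂ, (scal Y : TMat N n A).map f = scal Y := fun Y => by
    ext x y
    simp [scal]
  induction i with
  | zero => exact map_leg (f : A →+* B) _ _
  | succ i ih => rw [copy, copy, Matrix.map_mul, Matrix.map_mul, ih, hs, hs]

theorem opS_mul_M_M_zero :
    opS 0 D.R * (D.cp D.M 0 * D.cp D.M 1) = D.cp D.M 0 * D.cp D.M 1 * opS 0 D.R := by
  have hs : ∀ Y : TMat N 2 ℂ, (scal Y : TMat N 2 _).map (RingQuot.mkAlgHom ℂ (QMRel D.R D.F))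
      = scal Y := fun Y => by
    ext x y
    simp [scal]
  have h : (scal D.R * copy D.F D.M 2 0 (by omega) * copy D.F D.M 2 1 (by omega) : TMat N 2 D.Alg)
      = copy D.F D.M 2 0 (by omega) * copy D.F D.M 2 1 (by omega) * scal D.R := by
    have h1 : (scal D.R * copy D.F (freeM N) 2 0 (by omega) * copy D.F (freeM N) 2 1 (by omega) :
        TMat N 2 _).map (RingQuot.mkAlgHom ℂ (QMRel D.R D.F))
        = (copy D.F (freeM N) 2 0 (by omega) * copy D.F (freeM N) 2 1 (by omega) * scal D.R).map
          (RingQuot.mkAlgHom ℂ (QMRel D.R D.F)) := by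
      ext x y
      exact RingQuot.mkAlgHom_rel ℂ (QMRel.entry x y)
    simp only [Matrix.map_mul, map_copy, hs] at h1
    exact h1
  have h2 := congrArg (opLeg (at' 0 2)) h
  rw [map_mul, map_mul, map_mul, map_mul, opLeg_copy, opLeg_copy, ← opS_apply] at h2
  rw [← mul_assoc, h2]

/-- The defining relation is shifted along the factors: F_j F_{j+1} carries R_j to R_{j+1} by the
twist relation and raises both copies of M. -/
theorem commute_M_M (j : ℕ) : Commute (opS j D.R) (D.cp D.M j * D.cp D.M (j + 1)) := by
  induction j with
  | zero => exact D.opS_mul_M_M_zero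
  | succ j ih =>
    have h1 := asc_mul_opS (A := D.Alg) (X := D.F) (Y := D.R) (s := j) (n := 2) (i := j)
      (fun l => D.twists.opS_down l) le_rfl (by omega)
    have h2 := D.twists_F.asc_mul_cp D.M (s := j) (n := 2) (j := j) le_rfl (by omega)
    have h3 := D.twists_F.asc_mul_cp D.M (s := j) (n := 2) (j := j + 1) (by omega) (by omega)
    have h4 := asc_mul_desc (A := D.Alg) D.twists.mul_inv j 2
    have key : ∀ {x x' a b a' b' r r' : D.Ops}, x * x' = 1 → x * a = a' * x → x * b = b' * x →
        x * r = r' * x → Commute r (a * b) → Commute r' (a' * b') := by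
      intro x x' a b a' b' r r' hx ha hb hr h
      have e : r' * (a' * b') * x = a' * b' * r' * x := by
        calc _ = r' * a' * (b' * x) := by simp only [mul_assoc]
          _ = r' * (a' * x) * b := by rw [← hb]; simp only [mul_assoc]
          _ = (r' * x) * a * b := by rw [← ha]; simp only [mul_assoc]
          _ = x * (r * (a * b)) := by rw [← hr]; simp only [mul_assoc]
          _ = (x * a) * b * r := by rw [h.eq]; simp only [mul_assoc]
          _ = a' * (x * b) * r := by rw [ha]; simp only [mul_assoc]
          _ = a' * b' * (x * r) := by rw [hb]; simp only [mul_assoc]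
          _ = _ := by rw [hr]; simp only [mul_assoc]
      have := congrArg (· * x') e
      rw [Commute, SemiconjBy]
      simpa only [mul_assoc, hx, mul_one] using this
    exact key h4 h2 h3 h1 ih

theorem commute_str {s k i : ℕ} (h1 : s ≤ i) (h2 : i + 2 ≤ s + k) :
    Commute (opS i D.R) (D.str s k) := by
  induction k with
  | zero => omega
  | succ k ih =>
    by_cases hi : i + 2 ≤ s + k
    · exact (ih hi).mul_right (D.twists.commute_cp D.M (by omega))
    · obtain ⟨m, rfl⟩ : ∃ m, k = m + 1 := ⟨k - 1, by omega⟩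
      obtain rfl : i = s + m := by omega
      have h3 : Commute (opS (s + m) D.R) (D.str s m) :=
        (commute_of_mem_cm (fun l _ _ => str_mem_cm D.M (by omega)) _).symm
      have h4 := h3.mul_right (D.commute_M_M (s + m))
      rw [← mul_assoc] at h4
      exact h4

end BMWPair
end QMA
end

/-! ### The maps φ and ξ on the matrices M^α, and the rank of K. -/

noncomputable section
namespace QMA

section copies

variable {N : ℕ} {A : Type*} [Ring A] [Algebra ℂ A] (F : TMat N 2 ℂ)

theorem cp_add (X Y : Matrix (Fin N) (Fin N) A) (j : ℕ) : cp F (X + Y) j = cp F X j + cp F Y j := by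
  induction j with
  | zero => exact iota_add X Y
  | succ j ih => rw [cp, ih, mul_add, add_mul, cp, cp]

theorem cp_smul (c : ℂ) (X : Matrix (Fin N) (Fin N) A) (j : ℕ) :
    cp F (c • X) j = c • cp F X j := by
  induction j with
  | zero => exact iota_smul c X
  | succ j ih => rw [cp, ih, mul_smul_comm, smul_mul_assoc, cp]

theorem cp_rmul (X : Matrix (Fin N) (Fin N) A) (c : A) (j : ℕ) :
    cp F (rmul X c) j = cp F X j * opA c := by
  induction j with
  | zero => exact iota_rmul X c
  | succ j ih =>
    rw [cp, ih, ← mul_assoc, mul_assoc _ (opA c), (opA_comm_opS _ _ _).eq, ← mul_assoc, cp]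

theorem Twists.cp_one {R : TMat N 2 ℂ} {F : TMat N 2 ℂ} (T : Twists R F) (j : ℕ) :
    cp F (1 : Matrix (Fin N) (Fin N) A) j = 1 := by
  induction j with
  | zero => exact iota_one
  | succ j ih => rw [cp, ih, mul_one, T.opS_mul_inv]

theorem Twists.ptr_cp {R : TMat N 2 ℂ} {F : TMat N 2 ℂ} (T : Twists R F)
    (X : Matrix (Fin N) (Fin N) A) (j : ℕ) :
    ptr (opD R) j (cp F X j) = opA (wTr (opD R) X) := by
  induction j with
  | zero => exact ptr_iota _ X
  | succ j ih => rw [← ih, cp, T.ptr_conj (cp_mem_cm X (by omega))]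

end copies

namespace BMWPair

variable {N : ℕ} {q μ : ℂ} (D : BMWPair N q μ)

theorem commute_inv {i : ℕ} {Y : D.Ops} (h : Commute (opS i D.R) Y) : Commute (opS i D.R⁻¹) Y := by
  have h1 := D.twists_R.opS_mul_inv (A := D.Alg) i
  have h2 := D.twists_R.opS_inv_mul (A := D.Alg) i
  exact Commute.units_inv_left (u := ⟨_, _, h1, h2⟩) h

theorem commute_K {i : ℕ} {Y : D.Ops} (h : Commute (opS i D.R) Y) : Commute (opS i D.K) Y := by
  rw [← kap_opS]
  exact (show Y * kap q μ (opS i D.R) = kap q μ (opS i D.R) * Y from conj_kap h.eq.symm).symm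

theorem commute_rep_str {s s' n k : ℕ} (h1 : s ≤ s') (h2 : s' + n ≤ s + k) (w : W q μ n) :
    Commute (D.rep s' w) (D.str s k) :=
  (W_semiconj (f := D.rep s') (g := D.rep s') (x := D.str s k) (fun j => by
    rw [rep_σ]
    exact (D.commute_str (by omega) (by omega)).symm.eq) w).symm

theorem ptr_cyclic (j : ℕ) (X : D.Ops) : ptr (opD D.R) j (ptr (opD D.R) (j + 1) (opS j D.R * X))
    = ptr (opD D.R) j (ptr (opD D.R) (j + 1) (X * opS j D.R)) :=
  D.twists_R.ptr_cyclic D.R_skew j X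

theorem R_mem_cyc {s k i : ℕ} (h1 : s < i) (h2 : i + 1 ≤ s + k) :
    opS i D.R ∈ cyc (opD D.R) D.Alg s k := opS_mem_cyc _ D.ptr_cyclic h1 h2

theorem Rinv_mem_cyc {s k i : ℕ} (h1 : s < i) (h2 : i + 1 ≤ s + k) :
    opS i D.R⁻¹ ∈ cyc (opD D.R) D.Alg s k :=
  inv_mem_cyc _ (D.R_mem_cyc h1 h2) (D.twists_R.opS_mul_inv i) (D.twists_R.opS_inv_mul i)

theorem K_mem_cyc {s k i : ℕ} (h1 : s < i) (h2 : i + 1 ≤ s + k) :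
    opS i D.K ∈ cyc (opD D.R) D.Alg s k := by
  rw [← kap_opS]
  exact kap_mem (D.R_mem_cyc h1 h2) _ _

theorem rep_mem_cyc {s k s' n : ℕ} (h1 : s < s') (h2 : s' + n ≤ s + k + 1) (w : W q μ n) :
    D.rep s' w ∈ cyc (opD D.R) D.Alg s k := by
  refine W_map_mem _ _ (fun j => ?_) (fun j => ?_) w
  · rw [rep_σ]
    exact D.R_mem_cyc (by omega) (by omega)
  · rw [rep_σinv]
    exact D.Rinv_mem_cyc (by omega) (by omega)

theorem asc_mul_rep (s : ℕ) {n : ℕ} (w : W q μ n) :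
    asc D.F s n * D.rep s w = D.rep (s + 1) w * asc D.F s n := by
  refine W_semiconj (fun j => ?_) w
  rw [rep_σ, rep_σ, asc_mul_opS (fun l => D.twists.opS_down l) (by omega) (by omega)]
  congr 3
  omega

/-- Induction on s: conjugation by F extends over the traced factors by `Twists.conj_etr`, and there
the product of the F raises the string of copies and the R-matrices together. -/
theorem cp_matPow (s : ℕ) {k : ℕ} (α : W q μ (k + 1)) :
    D.cp (D.matPow α) s = D.tr s k (D.str s (k + 1) * D.rep s α) := by
  induction s with
  | zero => exact D.iota_matPow α
  | succ s ih =>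
    have hm : D.str s (k + 1) * D.rep s α ∈ cm N D.Alg (s + k + 1) :=
      mul_mem (str_mem_cm _ (by omega)) (D.rep_mem_cm (by omega) _)
    have h1 : D.cp (D.matPow α) (s + 1) = opS s D.F * D.cp (D.matPow α) s * opS s D.F⁻¹ := rfl
    rw [h1, ih, D.twists.conj_etr hm, ← mul_assoc, D.twists_F.asc_mul_str D.M le_rfl,
      mul_assoc (QMA.str _ _ _ _), asc_mul_rep, mul_assoc, mul_assoc,
      asc_mul_desc D.twists.mul_inv, mul_one]

theorem pt_cp_mul (j : ℕ) {k : ℕ} (α : W q μ (k + 1)) {Y : D.Ops}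
    (hY : ∀ i, j + 1 < i → Y ∈ cm N D.Alg i) :
    D.pt (j + 1) (D.cp (D.matPow α) (j + 1) * Y)
      = D.tr j (k + 1) (D.str (j + 1) (k + 1) * D.rep (j + 1) α * Y) := by
  rw [cp_matPow, tr, ← etr_mul_right _ (fun i h _ => hY i h), tr, etr_succ']

theorem iota_phi (X : D.Mat) : iota (D.phi X) = D.pt 1 (D.cp X 1 * opS 0 D.R) :=
  iota_twistTr _ _ _ X

theorem iota_xi (X : D.Mat) : iota (D.xi X) = D.pt 1 (D.cp X 1 * opS 0 D.K) :=
  iota_twistTr _ _ _ X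

theorem phi_bijective : Function.Bijective D.phi :=
  twistTr_bijective D.twists_R D.twists D.compatible_F D.F_strict D.isUnit_opD

theorem phi_phiInv (X : D.Mat) : D.phi (D.phiInv X) = X :=
  Function.rightInverse_invFun D.phi_bijective.2 X

theorem phiInv_eq {X Y : D.Mat} (h : D.phi X = Y) : D.phiInv Y = X :=
  D.phi_bijective.1 ((D.phi_phiInv Y).trans h.symm)

theorem iota_phi_matPow {k : ℕ} (α : W q μ (k + 1)) : iota (D.phi (D.matPow α))
    = D.tr 0 (k + 1) (D.str 1 (k + 1) * D.rep 1 α * opS 0 D.R) := by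
  rw [iota_phi]
  exact D.pt_cp_mul 0 α fun i hi => opS_mem_cm (by omega) _

theorem iota_xi_matPow {k : ℕ} (α : W q μ (k + 1)) : iota (D.xi (D.matPow α))
    = D.tr 0 (k + 1) (D.str 1 (k + 1) * D.rep 1 α * opS 0 D.K) := by
  rw [iota_xi]
  exact D.pt_cp_mul 0 α fun i hi => opS_mem_cm (by omega) _

theorem iota_M_mul_tr (k : ℕ) (Y : D.Ops) :
    iota D.M * D.tr 0 k (D.str 1 k * Y) = D.tr 0 k (D.str 0 (k + 1) * Y) := by
  have hM : ∀ i, 0 < i → i ≤ 0 + k → iota D.M ∈ cm N D.Alg i := fun i h _ =>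
    iota_mem_cm _ (by omega)
  rw [tr, ← etr_mul_left _ hM, ← mul_assoc]
  congr 2
  exact (str_succ' D.M 0 k).symm

/-- The map `X ↦ M · φ(X)`, which is the `⋆`-multiplication by `M` from the left. -/
def mulM (X : D.Mat) : D.Mat := D.M * D.phi X

theorem iota_mulM_matPow {k : ℕ} (α : W q μ (k + 1)) : iota (D.mulM (D.matPow α))
    = D.tr 0 (k + 1) (D.str 0 (k + 2) * (D.rep 1 α * opS 0 D.R)) := by
  rw [mulM, iota_mul, iota_phi_matPow, mul_assoc, iota_M_mul_tr]

theorem iota_Mt_matPow {k : ℕ} (α : W q μ (k + 1)) : iota (D.Mt (D.matPow α))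
    = D.tr 0 (k + 1) (D.str 0 (k + 2) * (D.rep 1 α * opS 0 D.K)) := by
  rw [Mt, iota_mul, iota_xi_matPow, mul_assoc, iota_M_mul_tr]

theorem phi_add (X Y : D.Mat) : D.phi (X + Y) = D.phi X + D.phi Y := by
  apply iota_injective
  rw [iota_add, iota_phi, iota_phi, iota_phi, cp, cp_add, add_mul, map_add]

theorem phi_smul (c : ℂ) (X : D.Mat) : D.phi (c • X) = c • D.phi X := by
  apply iota_injective
  rw [iota_smul, iota_phi, iota_phi, cp, cp_smul, smul_mul_assoc, map_smul]

theorem phi_rmul (X : D.Mat) (c : D.Alg) : D.phi (rmul X c) = rmul (D.phi X) c := by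
  apply iota_injective
  rw [iota_rmul, iota_phi, iota_phi, cp, cp_rmul, mul_assoc, (opA_comm_opS _ _ _).eq, ← mul_assoc,
    ptr_mul_right _ (opA_mem_cm _ _)]

theorem xi_rmul (X : D.Mat) (c : D.Alg) : D.xi (rmul X c) = rmul (D.xi X) c := by
  apply iota_injective
  rw [iota_rmul, iota_xi, iota_xi, cp, cp_rmul, mul_assoc, (opA_comm_opS _ _ _).eq, ← mul_assoc,
    ptr_mul_right _ (opA_mem_cm _ _)]

theorem phi_one : D.phi 1 = 1 := by
  apply iota_injective
  rw [iota_one, iota_phi, cp, D.twists.cp_one, one_mul]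
  exact ptr_opS_self D.R_skew 0

theorem mulM_add (X Y : D.Mat) : D.mulM (X + Y) = D.mulM X + D.mulM Y := by
  rw [mulM, phi_add, mul_add, mulM, mulM]

theorem mulM_smul (c : ℂ) (X : D.Mat) : D.mulM (c • X) = c • D.mulM X := by
  rw [mulM, phi_smul, Matrix.mul_smul, mulM]

theorem mul_rmul (X Y : D.Mat) (c : D.Alg) : X * rmul Y c = rmul (X * Y) c := by
  apply iota_injective
  rw [iota_mul, iota_rmul, iota_rmul, iota_mul, mul_assoc]

theorem mulM_rmul (X : D.Mat) (c : D.Alg) : D.mulM (rmul X c) = rmul (D.mulM X) c := by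
  rw [mulM, phi_rmul, mul_rmul, mulM]

theorem mulM_phiInv (X : D.Mat) : D.mulM (D.phiInv X) = D.M * X := by
  rw [mulM, phi_phiInv]

/-- The operator `K` has rank one. -/
theorem K_rank_one : ∃ u w : (Fin 2 → Fin N) → ℂ, ∀ x y, D.K x y = u x * w y := by
  obtain ⟨x0, y0, h0⟩ : ∃ x y, D.K x y ≠ 0 := by
    by_contra h
    push Not at h
    exact D.K_ne_zero (by ext x y; exact h x y)
  -- A matrix unit e between two copies of K gives a multiple of K. This is seen by computing the
  -- R-trace over the third factor of K₁ R₂⁻¹ R₁⁻¹ e₁ R₁ R₂ K₁ twice: by conjugation invariance, and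
  -- by K₁ R₂⁻¹ R₁⁻¹ = K₁ K₂ with R₁ R₂ K₁ = K₂ K₁.
  have key : ∀ (a b c c' : Fin N) (y : Fin 2 → Fin N),
      ∑ d, D.K ![a, b] ![c, d] * D.K ![c', d] y = μ⁻¹ * opD D.R c' c * D.K ![a, b] y := by
    intro a b c c' y
    have hb := D.bmw3 (A := ℂ) 0
    have hb' := D.bmw3' (A := ℂ) 0
    have hη := D.eta_ne_zero
    have e1 := hb'.ls't' D.generic
    have e2 := hb.stk D.generic
    have e3 := hb'.kk D.generic
    rw [kap_opS, kap_opS] at e1 e2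
    rw [kap_opS] at e3
    have e4 := hb.kk D.generic
    rw [kap_opS] at e4
    rw [Nat.zero_add] at e1 e2 e3
    have hY : Commute (eu 0 c c' : Op N ℂ) (opS 1 D.K) := opS_comm 0 1 (by omega) _ _
    have m0 : ∀ Z : TMat N 2 ℂ, (opS 0 Z : Op N ℂ) ∈ cm N ℂ 2 := fun Z => opS_mem_cm (by omega) Z
    have me : (eu 0 c c' : Op N ℂ) ∈ cm N ℂ 2 := eu_mem_cm (by omega) _ _
    have h1 : (opS 0 D.K * (opS 1 D.R⁻¹ * (opS 0 D.R⁻¹ * eu 0 c c' * opS 0 D.R) * opS 1 D.R)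
        * opS 0 D.K : Op N ℂ) = eta q μ • (opS 0 D.K * eu 0 c c' * opS 1 D.K * opS 0 D.K) := by
      calc _ = (opS 0 D.K * opS 1 D.R⁻¹ * opS 0 D.R⁻¹) * eu 0 c c' * (opS 0 D.R * opS 1 D.R
            * opS 0 D.K) := by simp only [mul_assoc]
        _ = opS 0 D.K * (opS 1 D.K * eu 0 c c') * opS 1 D.K * opS 0 D.K := by
            rw [e1, e2]
            simp only [mul_assoc]
        _ = opS 0 D.K * eu 0 c c' * (opS 1 D.K * opS 1 D.K) * opS 0 D.K := by
            rw [← hY.eq]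
            simp only [mul_assoc]
        _ = _ := by
            rw [e3]
            simp only [mul_smul_comm, smul_mul_assoc]
    have h2 := congrArg (ptr (opD D.R) 2) h1
    have hc : ptr (opD D.R) 2 (opS 1 D.R⁻¹ * (opS 0 D.R⁻¹ * eu 0 c c' * opS 0 D.R) * opS 1 D.R
        : Op N ℂ) = opD D.R c' c • 1 := by
      rw [D.twists_R.ptr_conj_inv (j := 1) (mul_mem (mul_mem (m0 _) me) (m0 _)),
        D.twists_R.ptr_conj_inv (j := 0) (eu_mem_cm (by omega) _ _), ptr_eu]
    have hk : ptr (opD D.R) 2 (opS 1 D.K : Op N ℂ) = μ • 1 := D.ptr_K 1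
    rw [ptr_mul_right _ (m0 _), ptr_mul_left _ (m0 _), hc, map_smul, ptr_mul_right _ (m0 _),
      ptr_mul_left _ (mul_mem (m0 _) me), hk] at h2
    simp only [mul_smul_comm, smul_mul_assoc, mul_one, e4, smul_smul] at h2
    have h3 : (opS 0 (D.K * site 2 0 (by omega) (toOne (Matrix.single c c' (1 : ℂ))) * D.K)
        : Op N ℂ) = opS 0 ((μ⁻¹ * opD D.R c' c) • D.K) := by
      rw [map_mul, map_mul, opS_toOne_single, map_smul]
      have h4 := congrArg (((eta q μ)⁻¹ * μ⁻¹) • ·) h2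
      simp only [smul_smul] at h4
      have hμ := D.mu_ne_zero
      have c1 : (eta q μ)⁻¹ * μ⁻¹ * (eta q μ * μ) = 1 := by field_simp
      have c2 : (eta q μ)⁻¹ * μ⁻¹ * (opD D.R c' c * eta q μ) = μ⁻¹ * opD D.R c' c := by field_simp
      rw [c1, c2, one_smul] at h4
      exact h4.symm
    have h5 := congrFun (congrFun (opS_two_injective 0 h3) ![a, b]) y
    exact (mul_single_mul_apply D.K D.K c c' _ _).symm.trans h5
  have eta2 : ∀ x : Fin 2 → Fin N, ![x 0, x 1] = x := fun x => by
    funext i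
    fin_cases i <;> rfl
  -- The rows of K, read as N × N matrices, become multiples of the transpose of D_R after
  -- multiplication by one invertible V, so all of them are proportional to the row of x0.
  let U : (Fin 2 → Fin N) → Matrix (Fin N) (Fin N) ℂ := fun x => Matrix.of fun c d => D.K x ![c, d]
  let V : Matrix (Fin N) (Fin N) ℂ := Matrix.of fun d c' => D.K ![c', d] y0
  have hUV : ∀ x, U x * V = (μ⁻¹ * D.K x y0) • (opD D.R).transpose := by
    intro x
    ext c c'
    rw [Matrix.mul_apply]
    have := key (x 0) (x 1) c c' y0
    rw [eta2] at this
    simp only [U, V, Matrix.of_apply, this, Matrix.smul_apply, Matrix.transpose_apply, smul_eq_mul]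
    ring
  have hV : IsUnit V.det := by
    have h1 := congrArg Matrix.det (hUV x0)
    rw [Matrix.det_mul, Matrix.det_smul, Matrix.det_transpose] at h1
    refine isUnit_of_mul_isUnit_right (x := (U x0).det) ?_
    rw [h1, isUnit_iff_ne_zero]
    exact mul_ne_zero (pow_ne_zero _ (mul_ne_zero (inv_ne_zero D.mu_ne_zero) h0))
      (isUnit_iff_ne_zero.1 ((Matrix.isUnit_iff_isUnit_det _).1 D.isUnit_opD))
  have hU : ∀ x, U x = (D.K x y0 / D.K x0 y0) • U x0 := by
    intro x
    have h1 : U x * V = ((D.K x y0 / D.K x0 y0) • U x0) * V := by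
      rw [Matrix.smul_mul, hUV, hUV, smul_smul]
      congr 1
      field_simp
    have h2 := congrArg (· * V⁻¹) h1
    simpa only [Matrix.mul_assoc, Matrix.mul_nonsing_inv _ hV, Matrix.mul_one] using h2
  refine ⟨fun x => D.K x y0 / D.K x0 y0, fun y => D.K x0 y, fun x y => ?_⟩
  have h1 := congrFun (congrFun (hU x) (y 0)) (y 1)
  simp only [U, Matrix.of_apply, Matrix.smul_apply, eta2, smul_eq_mul] at h1
  exact h1

end BMWPair
end QMA
end

/-! ### Braids in which blocks of strands cross, and the exponent of the ⋆-product. -/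

noncomputable section
namespace QMA

section braids

variable {N : ℕ} {A : Type*} [Ring A] [Algebra ℂ A] (R : TMat N 2 ℂ)

theorem desc_succ' (s n : ℕ) : (desc R s (n + 1) : Op N A) = desc R (s + 1) n * opS s R := by
  induction n with
  | zero => rw [desc, desc, desc, mul_one, one_mul, Nat.add_zero]
  | succ n ih =>
    rw [desc, ih, desc, mul_assoc]
    congr 3
    omega

/-- The product of `l` neighbouring descending products of length `n`: the braid in which `l`
strands pass `n` strands. -/
def cross (s n : ℕ) : ℕ → Op N A
  | 0 => 1
  | l + 1 => cross s n l * desc R (s + l) n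

/-- The inverse of `cross`. -/
def crossInv (s n : ℕ) : ℕ → Op N A
  | 0 => 1
  | l + 1 => asc R⁻¹ (s + l) n * crossInv s n l

/-- The conjugate of `R_s` by `R_{s+1} ⋯ R_{s+l}`. -/
def rot (s : ℕ) : ℕ → Op N A
  | 0 => opS s R
  | l + 1 => opS (s + l + 1) R⁻¹ * rot s l * opS (s + l + 1) R

theorem cross_succ' (s n l : ℕ) :
    (cross R s n (l + 1) : Op N A) = desc R s n * cross R (s + 1) n l := by
  induction l with
  | zero => rw [cross, cross, cross, mul_one, one_mul, Nat.add_zero]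
  | succ l ih =>
    rw [cross, ih, cross, mul_assoc]
    congr 3
    omega

variable {R}

theorem cross_mul_inv (h : R * R⁻¹ = 1) (s n l : ℕ) :
    (cross R s n l * crossInv R s n l : Op N A) = 1 := by
  induction l with
  | zero => exact one_mul 1
  | succ l ih =>
    rw [cross, crossInv, mul_assoc, ← mul_assoc (desc _ _ _), desc_mul_asc h, one_mul, ih]

theorem crossInv_mul (h : R⁻¹ * R = 1) (s n l : ℕ) :
    (crossInv R s n l * cross R s n l : Op N A) = 1 := by
  induction l with
  | zero => exact one_mul 1
  | succ l ih =>
    rw [cross, crossInv, mul_assoc, ← mul_assoc (crossInv _ _ _ _), ih, one_mul, asc_mul_desc h]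

theorem desc_mul_opS {s n i : ℕ}
    (hb : ∀ j, (opS j R * opS (j + 1) R * opS j R : Op N A)
      = opS (j + 1) R * opS j R * opS (j + 1) R) (h1 : s ≤ i) (h2 : i + 1 < s + n) :
    (desc R s n * opS (i + 1) R : Op N A) = opS i R * desc R s n := by
  induction n with
  | zero => omega
  | succ n ih =>
    by_cases hi : i + 1 < s + n
    · have hc := (opS_comm (A := A) (s + n) i (by omega) R R).eq
      rw [desc, mul_assoc, ih hi, ← mul_assoc, hc, mul_assoc]
    · obtain ⟨m, rfl⟩ : ∃ m, n = m + 1 := ⟨n - 1, by omega⟩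
      obtain rfl : i = s + m := by omega
      have hc : Commute (opS (s + m + 1) R : Op N A) (desc R s m) :=
        commute_desc R s m fun j _ _ => opS_comm _ _ (by omega) _ _
      rw [desc, desc, ← add_assoc, mul_assoc, mul_assoc, ← hc.eq, ← mul_assoc (opS (s + m) R),
        ← mul_assoc, ← mul_assoc, ← hb]
      simp only [mul_assoc]

theorem desc_desc_mul_opS
    (hb : ∀ j, (opS j R * opS (j + 1) R * opS j R : Op N A)
      = opS (j + 1) R * opS j R * opS (j + 1) R) (j n : ℕ) :
    (desc R j n * desc R (j + 1) n * opS j R : Op N A)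
      = opS (j + n) R * (desc R j n * desc R (j + 1) n) := by
  induction n with
  | zero => simp [desc]
  | succ n ih =>
    have e : j + 1 + n = j + n + 1 := by omega
    have hc : Commute (opS (j + n + 1) R : Op N A) (desc R j n) :=
      commute_desc R j n fun i _ _ => opS_comm _ _ (by omega) _ _
    calc (desc R j (n + 1) * desc R (j + 1) (n + 1) * opS j R : Op N A)
        = opS (j + n) R * (desc R j n * opS (j + n + 1) R) * desc R (j + 1) n * opS j R := by
          rw [desc, desc, e]
          simp only [mul_assoc]
      _ = opS (j + n) R * opS (j + n + 1) R * (desc R j n * desc R (j + 1) n * opS j R) := by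
          rw [← hc.eq]
          simp only [mul_assoc]
      _ = (opS (j + n) R * opS (j + n + 1) R * opS (j + n) R) * desc R j n
            * desc R (j + 1) n := by
          rw [ih]
          simp only [mul_assoc]
      _ = opS (j + n + 1) R * opS (j + n) R * (opS (j + n + 1) R * desc R j n)
            * desc R (j + 1) n := by
          rw [hb]
          simp only [mul_assoc]
      _ = _ := by
          rw [hc.eq, desc, desc, e, ← add_assoc]
          simp only [mul_assoc]

theorem cross_mul_opS
    (hb : ∀ j, (opS j R * opS (j + 1) R * opS j R : Op N A)
      = opS (j + 1) R * opS j R * opS (j + 1) R) {s n l j : ℕ} (hj : j + 1 < l) :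
    (cross R s n l * opS (s + j) R : Op N A) = opS (s + n + j) R * cross R s n l := by
  induction l with
  | zero => omega
  | succ l ih =>
    by_cases h : j + 1 < l
    · have hc : Commute (opS (s + j) R : Op N A) (desc R (s + l) n) :=
        commute_desc R _ n fun i _ _ => opS_comm _ _ (by omega) _ _
      rw [cross, mul_assoc, ← hc.eq, ← mul_assoc, ih h, mul_assoc]
    · obtain rfl : l = j + 1 := by omega
      have hc : Commute (opS (s + n + j) R : Op N A) (cross R s n j) := by
        have : ∀ m, m ≤ j → Commute (opS (s + n + j) R : Op N A) (cross R s n m) := by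
          intro m hm
          induction m with
          | zero => exact Commute.one_right _
          | succ m ih' =>
            exact (ih' (by omega)).mul_right
              (commute_desc R _ n fun i _ _ => opS_comm _ _ (by omega) _ _)
        exact this j le_rfl
      have e : s + n + j = s + j + n := by omega
      rw [cross, cross, ← add_assoc, mul_assoc, mul_assoc, ← mul_assoc (desc _ _ _),
        desc_desc_mul_opS hb, ← e, ← mul_assoc (cross _ _ _ _), ← hc.eq]
      simp only [mul_assoc]

theorem rot_mem (S : Subalgebra ℂ (Op N A)) (s l : ℕ)
    (h : ∀ j, s ≤ j → j ≤ s + l → opS j R ∈ S ∧ opS j R⁻¹ ∈ S) : rot R s l ∈ S := by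
  induction l with
  | zero => exact (h s le_rfl le_rfl).1
  | succ l ih =>
    have h1 := h (s + l + 1) (by omega) (by omega)
    exact mul_mem (mul_mem h1.2 (ih fun j h2 h3 => h j h2 (by omega))) h1.1

theorem rot_commute {s l i : ℕ} (h : s + l + 1 < i) :
    Commute (rot R s l : Op N A) (opS i R) := by
  have := rot_mem (A := A) (R := R) (Subalgebra.centralizer ℂ {opS i R}) s l fun j _ _ => by
    simp only [Subalgebra.mem_centralizer_iff, Set.mem_singleton_iff, forall_eq]
    exact ⟨opS_comm _ _ (by omega) _ _, opS_comm _ _ (by omega) _ _⟩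
  rw [Subalgebra.mem_centralizer_iff] at this
  exact (this _ rfl).symm

/-- Each further descending product has R_{s+l+1} as its last letter. The rest commutes with `rot R
s l`, and moving `rot` past that letter conjugates it, which is the recursion of `rot`. -/
theorem opS_mul_cross (h : R * R⁻¹ = 1) (s n l : ℕ) :
    (opS s R * cross R (s + 1) (n + 1) l : Op N A) = cross R (s + 1) (n + 1) l * rot R s l := by
  induction l with
  | zero => rw [cross, rot, mul_one, one_mul]
  | succ l ih =>
    have e : s + 1 + l = s + l + 1 := by omega
    have hc : Commute (rot R s l : Op N A) (desc R (s + l + 1 + 1) n) :=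
      commute_desc R _ n fun i _ _ => rot_commute (by omega)
    have h1 : (opS (s + l + 1) R * opS (s + l + 1) R⁻¹ : Op N A) = 1 := by
      rw [← map_mul, h, map_one]
    rw [cross, ← mul_assoc, ih, e, desc_succ', rot, mul_assoc, mul_assoc]
    congr 1
    rw [← mul_assoc, hc.eq, mul_assoc, mul_assoc (desc _ _ _) (opS _ R), mul_assoc (opS _ R⁻¹),
      ← mul_assoc (opS _ R) (opS _ R⁻¹), h1, one_mul]

end braids

theorem ofFn_desc {N : ℕ} {A : Type*} [Ring A] [Algebra ℂ A] (X : TMat N 2 ℂ) (s n : ℕ) :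
    (List.ofFn fun j : Fin (n + 1) => (opS (s + (n - j)) X : Op N A)).prod = desc X s (n + 1) := by
  induction n with
  | zero => simp [desc]
  | succ n ih =>
    rw [List.ofFn_succ, List.prod_cons, desc, ← ih]
    congr 4
    funext j
    congr 2
    simp only [Fin.val_succ]
    omega

theorem ofFn_asc {N : ℕ} {A : Type*} [Ring A] [Algebra ℂ A] (X : TMat N 2 ℂ) (s n : ℕ) :
    (List.ofFn fun j : Fin n => (opS (s + (j + 1)) X : Op N A)).prod = asc X (s + 1) n := by
  induction n with
  | zero => simp [asc]
  | succ n ih =>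
    rw [List.ofFn_succ_last, List.prod_append, List.prod_singleton, asc, Fin.val_last,
      add_assoc s 1 n, add_comm 1 n]
    exact congrArg (· * _) ih

namespace BMWPair

variable {N : ℕ} {q μ : ℂ} (D : BMWPair N q μ)

/-- The element `σ_{a+1} ⋯ σ_2 σ_1 σ_2⁻¹ ⋯ σ_{a+1}⁻¹` in the R-matrix representation. -/
def loop (s a : ℕ) : D.Ops := desc D.R s (a + 1) * asc D.R⁻¹ (s + 1) a

theorem rep_starExp (s : ℕ) {a b : ℕ} (α : W q μ (a + 1)) (β : W q μ (b + 1)) :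
    D.rep s (starExp α β) = D.rep s α * D.rep (s + (a + 1)) β * D.loop s a := by
  have h1 : (⇑(D.rep s) ∘ fun j : Fin (a + 1) => (σ ⟨a - j, by omega⟩ : W q μ (a + 1 + b + 1)))
      = fun j : Fin (a + 1) => opS (s + (a - j)) D.R := by
    funext j
    rw [Function.comp_apply, rep_σ]
  have h2 : (⇑(D.rep s) ∘ fun j : Fin a => (σinv ⟨j + 1, by omega⟩ : W q μ (a + 1 + b + 1)))
      = fun j : Fin a => opS (s + (j + 1)) D.R⁻¹ := by
    funext j
    rw [Function.comp_apply, rep_σinv]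
  rw [starExp, map_mul, map_mul, rep_up, rep_up, map_mul, map_list_prod, map_list_prod,
    List.map_ofFn, List.map_ofFn, h1, h2, ofFn_desc, ofFn_asc, loop]
  rfl

/-- The operators that act on the factors behind the first one, commute with the string of matrix
copies, and can be moved around the trace. -/
def inner (k : ℕ) : Subalgebra ℂ D.Ops :=
  cyc (opD D.R) D.Alg 0 k ⊓ Subalgebra.centralizer ℂ {D.str 0 (k + 1)}

theorem tr_inner {k : ℕ} {y : D.Ops} (h : y ∈ D.inner k) (x : D.Ops) :
    D.tr 0 k (D.str 0 (k + 1) * (y * x)) = D.tr 0 k (D.str 0 (k + 1) * (x * y)) := by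
  have h1 := (Subalgebra.mem_centralizer_iff ℂ).1 h.2 _ rfl
  rw [← mul_assoc, h1, mul_assoc, h.1, mul_assoc]

theorem mem_inner {k : ℕ} {y : D.Ops} (h : y ∈ cyc (opD D.R) D.Alg 0 k)
    (h' : Commute y (D.str 0 (k + 1))) : y ∈ D.inner k := by
  refine ⟨h, (Subalgebra.mem_centralizer_iff ℂ).2 ?_⟩
  rintro _ rfl
  exact h'.eq.symm

theorem Rinv_mem_inner {k i : ℕ} (h1 : 0 < i) (h2 : i + 1 ≤ k) : opS i D.R⁻¹ ∈ D.inner k :=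
  D.mem_inner (D.Rinv_mem_cyc h1 (by omega)) (D.commute_inv (D.commute_str (by omega) (by omega)))

theorem K_mem_inner {k i : ℕ} (h1 : 0 < i) (h2 : i + 1 ≤ k) : opS i D.K ∈ D.inner k :=
  D.mem_inner (D.K_mem_cyc h1 (by omega)) (D.commute_K (D.commute_str (by omega) (by omega)))

theorem rep_mem_inner {k s n : ℕ} (h1 : 0 < s) (h2 : s + n ≤ k + 1) (w : W q μ n) :
    D.rep s w ∈ D.inner k :=
  D.mem_inner (D.rep_mem_cyc h1 (by omega) w) (D.commute_rep_str (by omega) (by omega) w)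

theorem opS_braid (j : ℕ) : (opS j D.R * opS (j + 1) D.R * opS j D.R : D.Ops)
    = opS (j + 1) D.R * opS j D.R * opS (j + 1) D.R := D.twists_R.opS_up j

theorem rep_mul_cross (s : ℕ) {n : ℕ} (l : ℕ) (w : W q μ n) :
    D.rep s w * cross D.R s n l = cross D.R s n l * D.rep (s + l) w := by
  induction l with
  | zero => rw [cross, mul_one, one_mul, Nat.add_zero]
  | succ l ih =>
    have h : desc D.R (s + l) n * D.rep (s + l + 1) w = D.rep (s + l) w * desc D.R (s + l) n := by
      refine W_semiconj (fun j => ?_) w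
      rw [rep_σ, rep_σ, ← desc_mul_opS D.opS_braid (by omega) (by omega)]
      congr 3
      omega
    rw [cross, ← mul_assoc, ih, mul_assoc, ← h, mul_assoc, add_assoc]

theorem cross_mul_rep (s n : ℕ) {l : ℕ} (w : W q μ l) :
    cross D.R s n l * D.rep s w = D.rep (s + n) w * cross D.R s n l := by
  refine W_semiconj (fun j => ?_) w
  rw [rep_σ, rep_σ, cross_mul_opS D.opS_braid (by omega)]

/-- The `⋆`-multiplication by `M^β` from the right. -/
theorem iota_matPow_starExp {a b : ℕ} (α : W q μ (a + 1)) (β : W q μ (b + 1)) :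
    iota (D.matPow (starExp α β))
      = D.tr 0 (b + 1) (D.str 0 (b + 1) * D.cp (D.matPow α) (b + 1)
          * (rot D.R 0 b * D.rep 0 β)) := by
  have hr : ∀ i, b + 1 < i → rot D.R 0 b * D.rep 0 β ∈ cm N D.Alg i := fun i hi =>
    mul_mem (rot_mem _ _ _ fun j _ _ => ⟨opS_mem_cm (by omega) _, opS_mem_cm (by omega) _⟩)
      (D.rep_mem_cm (by omega) _)
  have hs : ∀ i, b + 1 < i → D.str 0 (b + 1) ∈ cm N D.Alg i := fun i hi =>
    str_mem_cm _ (by omega)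
  rw [cp_matPow, tr, ← etr_mul_left _ fun i h _ => hs i h, ← etr_mul_right _ fun i h _ => hr i h]
  have e1 := etr_add (opD D.R) 0 (b + 1) a (D.str 0 (b + 1) * (D.str (b + 1) (a + 1)
    * D.rep (b + 1) α) * (rot D.R 0 b * D.rep 0 β))
  have e2 : D.str 0 (b + 1 + (a + 1)) = D.str 0 (b + 1) * D.str (b + 1) (a + 1) := by
    have := str_add (F := D.F) D.M 0 (b + 1) (a + 1)
    rwa [Nat.zero_add] at this
  rw [Nat.zero_add] at e1
  have e4 : D.str 0 (b + 1) * (D.str (b + 1) (a + 1) * D.rep (b + 1) α)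
      * (rot D.R 0 b * D.rep 0 β)
      = D.str 0 (b + 1 + (a + 1)) * (D.rep (b + 1) α * (rot D.R 0 b * D.rep 0 β)) := by
    rw [e2]
    simp only [mul_assoc]
  rw [mul_assoc (D.str 0 (b + 1))] at e4
  rw [← e1, mul_assoc (D.str 0 (b + 1)), e4, iota_matPow, rep_starExp, Nat.zero_add, ← add_assoc (b + 1)]
  have e3 : a + 1 + b = b + 1 + a := by omega
  rw [e3]
  have hinv := D.twists_R.mul_inv
  have hinv' := D.twists_R.inv_mul
  -- `hu` and `hv`: these braids act behind the first factor and commute with the string of copies,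
  -- so they may be carried around the trace.
  have hu : asc D.R⁻¹ 1 a ∈ D.inner (b + 1 + a) :=
    asc_mem _ _ _ _ fun j _ _ => D.Rinv_mem_inner (by omega) (by omega)
  have hv : crossInv D.R 1 (a + 1) b ∈ D.inner (b + 1 + a) := by
    have : ∀ l, l ≤ b → crossInv D.R 1 (a + 1) l ∈ D.inner (b + 1 + a) := by
      intro l hl
      induction l with
      | zero => exact one_mem _
      | succ l ih =>
        exact mul_mem (asc_mem _ _ _ _ fun j _ _ => D.Rinv_mem_inner (by omega) (by omega))
          (ih (by omega))
    exact this b le_rfl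
  have c1 := D.rep_mul_cross 0 (b + 1) α
  have c2 := D.cross_mul_rep 0 (a + 1) β
  rw [Nat.zero_add] at c1 c2
  -- The crossing of the two blocks carries α and β to each other's place. It replaces the first
  -- half of the loop at the cost of a braid that can be cycled; by `c4` what is left after cycling
  -- is `rot`.
  have c3 : (cross D.R 0 (a + 1) (b + 1) : D.Ops) * crossInv D.R 1 (a + 1) b
      = desc D.R 0 (a + 1) := by
    rw [cross_succ', mul_assoc, cross_mul_inv hinv, mul_one]
  have c4 : crossInv D.R 1 (a + 1) b * (asc D.R⁻¹ 1 a * cross D.R 0 (a + 1) (b + 1))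
      = (rot D.R 0 b : D.Ops) := by
    rw [cross_succ', desc_succ', ← mul_assoc, ← mul_assoc, ← mul_assoc,
      mul_assoc (crossInv _ _ _ _), asc_mul_desc hinv', mul_one, mul_assoc, opS_mul_cross hinv,
      ← mul_assoc, crossInv_mul hinv', one_mul]
  have hα : D.rep (b + 1) α ∈ D.inner (b + 1 + a) := D.rep_mem_inner (by omega) (by omega) α
  have hαβ := D.rep_comm_rep (s := b + 1) (t := 0) (by omega) α β
  calc D.tr 0 (b + 1 + a) (D.str 0 (b + 1 + a + 1)
        * (D.rep 0 α * D.rep (a + 1) β * D.loop 0 a))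
      = D.tr 0 (b + 1 + a) (D.str 0 (b + 1 + a + 1)
        * (cross D.R 0 (a + 1) (b + 1) * D.rep (b + 1) α * D.rep 0 β
          * (crossInv D.R 1 (a + 1) b * asc D.R⁻¹ 1 a))) := by
        congr 2
        rw [loop, ← c3, ← c1, mul_assoc (D.rep 0 α) (cross _ _ _ _), c2]
        simp only [mul_assoc]
    _ = D.tr 0 (b + 1 + a) (D.str 0 (b + 1 + a + 1)
        * (rot D.R 0 b * D.rep 0 β * D.rep (b + 1) α)) := by
        rw [← D.tr_inner (mul_mem hv hu), ← c4, mul_assoc _ (D.rep 0 β), ← hαβ.eq]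
        simp only [mul_assoc]
    _ = _ := by
        rw [← D.tr_inner hα]

end BMWPair
end QMA
end

/-! ### Independence of the ⋆-product from presentations; ⋆-powers of M. -/

noncomputable section
namespace QMA

namespace BMWPair

variable {N : ℕ} {q μ : ℂ} (D : BMWPair N q μ)

theorem opA_comm_rep (c : D.Alg) (s : ℕ) {n : ℕ} (w : W q μ n) :
    Commute (opA c) (D.rep s w) := opA_comm_opS _ _ _

/-- `rot` arises from R by successive conjugations, which the R-trace removes one at a time;
Tr_{R(2)} R = I remains. -/
theorem pt_rot (b : ℕ) : D.pt (b + 1) (rot D.R 0 b) = 1 := by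
  induction b with
  | zero => exact ptr_opS_self D.R_skew 0
  | succ b ih =>
    rw [← ih, rot, Nat.zero_add]
    exact D.twists_R.ptr_conj_inv (rot_mem _ _ _ fun j _ _ =>
      ⟨opS_mem_cm (by omega) _, opS_mem_cm (by omega) _⟩)

/-- The `⋆`-multiplication by `M^β` from the right, as a map on all matrices. -/
def starRight {b : ℕ} (β : W q μ (b + 1)) : D.Mat →+ D.Ops where
  toFun X := D.tr 0 (b + 1) (D.str 0 (b + 1) * D.cp X (b + 1) * (rot D.R 0 b * D.rep 0 β))
  map_zero' := by
    have h : D.cp 0 (b + 1) = 0 := by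
      have := cp_smul D.F (0 : ℂ) (0 : D.Mat) (b + 1)
      rwa [zero_smul, zero_smul] at this
    rw [h, mul_zero, zero_mul, map_zero]
  map_add' X Y := by rw [cp, cp_add, mul_add, add_mul, map_add]

theorem starRight_matPow {a b : ℕ} (α : W q μ (a + 1)) (β : W q μ (b + 1)) :
    D.starRight β (D.matPow α) = iota (D.matPow (starExp α β)) :=
  (D.iota_matPow_starExp α β).symm

theorem starRight_rmul (X : D.Mat) (c : D.Alg) {b : ℕ} (β : W q μ (b + 1)) :
    D.starRight β (rmul X c) = D.starRight β X * opA c := by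
  change etr (opD D.R) 0 (b + 1) _ = etr (opD D.R) 0 (b + 1) _ * _
  have hr : Commute (opA c) (rot D.R 0 b * D.rep 0 β) := by
    have := rot_mem (A := D.Alg) (R := D.R) (Subalgebra.centralizer ℂ {opA c}) 0 b fun j _ _ => by
      simp only [Subalgebra.mem_centralizer_iff, Set.mem_singleton_iff, forall_eq]
      exact ⟨opA_comm_opS _ _ _, opA_comm_opS _ _ _⟩
    rw [Subalgebra.mem_centralizer_iff] at this
    exact (show Commute _ _ from this _ rfl).mul_right (D.opA_comm_rep c 0 β)
  rw [← etr_mul_right _ fun i _ _ => opA_mem_cm _ _, cp, cp_rmul, ← mul_assoc (D.str _ _),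
    mul_assoc _ (opA c), hr.eq, ← mul_assoc _ _ (opA c)]

theorem starRight_one {b : ℕ} (β : W q μ (b + 1)) :
    D.starRight β 1 = iota (D.matPow β) := by
  change etr (opD D.R) 0 (b + 1) _ = _
  rw [cp, D.twists.cp_one, mul_one, etr_succ, Nat.zero_add, ← mul_assoc (D.str _ _),
    ptr_mul_right _ (D.rep_mem_cm (by omega) _), ptr_mul_left _ (str_mem_cm _ (by omega)),
    show ptr (opD D.R) (b + 1) (rot D.R 0 b) = 1 from D.pt_rot b, mul_one, iota_matPow]

theorem iota_list_sum {N : ℕ} {A : Type*} [Ring A] [Algebra ℂ A] {ι : Type*} (l : List ι)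
    (f : ι → Matrix (Fin N) (Fin N) A) :
    iota (l.map f).sum = (l.map fun x => iota (f x)).sum := by
  induction l with
  | nil => exact iota_zero
  | cons x l ih => rw [List.map_cons, List.sum_cons, iota_add, ih, List.map_cons, List.sum_cons]

/-- The right side contains x only through its value. Hence presentations of the left factor of a
⋆-product may be exchanged. -/
theorem iota_starValue (x y : D.Expr) : iota (D.starValue x y)
    = (y.1.map fun β => D.starRight β.2 (D.value x)).sum + iota (D.value x) * opA y.2 := by
  have h1 : ∀ l : List (Σ k : ℕ, W q μ (k + 1)),
      iota (l.map fun α => (y.1.map fun β => D.matPow (starExp α.2 β.2)).sum).sum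
        = (y.1.map fun β => D.starRight β.2 (l.map fun α => D.matPow α.2).sum).sum := by
    intro l
    induction l with
    | nil => simp [iota_zero]
    | cons α l ih =>
      simp only [List.map_cons, List.sum_cons, map_add, List.sum_map_add]
      rw [iota_add, ih, iota_list_sum]
      simp only [starRight_matPow]
  have h2 : (y.1.map fun β => D.starRight β.2 (D.value x)).sum
      = (y.1.map fun β => D.starRight β.2 (x.1.map fun α => D.matPow α.2).sum).sum
        + (y.1.map fun β => iota (rmul (D.matPow β.2) x.2)).sum := by
    rw [← List.sum_map_add]
    simp only [value, map_add, starRight_rmul, starRight_one, iota_rmul]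
  have h3 : iota (x.1.map fun α => rmul (D.matPow α.2) y.2).sum
      = iota (x.1.map fun α => D.matPow α.2).sum * opA y.2 := by
    simp only [iota_list_sum, iota_rmul, List.sum_map_mul_right]
  rw [starValue, iota_add, iota_add, iota_add, h1, h3, iota_list_sum y.1, h2, value, iota_add, add_mul,
    iota_rmul, iota_rmul, iota_one, one_mul, one_mul, map_mul]
  abel

theorem matPow_eq_of_rep {k l : ℕ} (h : k = l) {α : W q μ (k + 1)} {β : W q μ (l + 1)}
    (h' : D.rep 0 α = D.rep 0 β) : D.matPow α = D.matPow β := by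
  subst h
  apply iota_injective
  rw [iota_matPow, iota_matPow, h']

theorem asc_succ' {N : ℕ} {A : Type*} [Ring A] [Algebra ℂ A] (X : TMat N 2 ℂ) (s n : ℕ) :
    (asc X s (n + 1) : Op N A) = opS s X * asc X (s + 1) n := by
  induction n with
  | zero => rw [asc, asc, asc, one_mul, mul_one, Nat.add_zero]
  | succ n ih =>
    rw [asc, ih, asc, mul_assoc, add_assoc s 1 n, add_comm 1 n]

/-- R_s commutes with all letters of index at least s + 2, and the braid relation turns R_s R_{s+1}
R_s R_{s+1}⁻¹ into R_{s+1} R_s. -/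
theorem R_mul_loop (s b : ℕ) : opS s D.R * D.loop s (b + 1) = D.loop (s + 1) b * opS s D.R := by
  have h1 : Commute (opS s D.R : D.Ops) (desc D.R (s + 1 + 1) b) :=
    commute_desc _ _ _ fun j _ _ => opS_comm _ _ (by omega) _ _
  have h2 : Commute (opS s D.R : D.Ops) (asc D.R⁻¹ (s + 1 + 1) b) :=
    commute_asc _ _ _ fun j _ _ => opS_comm _ _ (by omega) _ _
  have h3 : (asc D.R⁻¹ (s + 1) (b + 1) : D.Ops)
      = opS (s + 1) D.R⁻¹ * asc D.R⁻¹ (s + 1 + 1) b := by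
    exact asc_succ' _ _ _
  calc opS s D.R * D.loop s (b + 1)
      = (opS s D.R * desc D.R (s + 1 + 1) b) * (opS (s + 1) D.R * opS s D.R * opS (s + 1) D.R⁻¹)
          * asc D.R⁻¹ (s + 1 + 1) b := by
        rw [loop, h3, desc_succ', desc_succ']
        simp only [mul_assoc]
    _ = desc D.R (s + 1 + 1) b * (opS s D.R * opS (s + 1) D.R * opS s D.R) * opS (s + 1) D.R⁻¹
          * asc D.R⁻¹ (s + 1 + 1) b := by
        rw [h1.eq]
        simp only [mul_assoc]
    _ = desc D.R (s + 1 + 1) b * opS (s + 1) D.R * opS s D.R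
          * (opS (s + 1) D.R * opS (s + 1) D.R⁻¹) * asc D.R⁻¹ (s + 1 + 1) b := by
        rw [D.opS_braid]
        simp only [mul_assoc]
    _ = _ := by
        rw [D.twists_R.opS_mul_inv, mul_one, loop, desc_succ', mul_assoc, h2.eq]
        simp only [mul_assoc]

theorem loop_zero (s : ℕ) : D.loop s 0 = opS s D.R := by
  rw [loop, desc, desc, asc, mul_one, mul_one, Nat.add_zero]

theorem matPow_one_starExp {b : ℕ} (β : W q μ (b + 1)) :
    D.matPow (starExp (1 : W q μ (0 + 1)) β) = D.mulM (D.matPow β) := by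
  apply iota_injective
  rw [iota_mulM_matPow, iota_matPow, rep_starExp, map_one, one_mul, loop_zero, Nat.zero_add,
    add_comm 1 b]

/-- Already the exponents agree in the R-matrix representation, by `R_mul_loop`. Only this instance
of associativity, with M on the left, is needed for the ⋆-powers. -/
theorem matPow_starExp_assoc {b c : ℕ} (β : W q μ (b + 1)) (γ : W q μ (c + 1)) :
    D.matPow (starExp (starExp (1 : W q μ (0 + 1)) β) γ)
      = D.matPow (starExp (1 : W q μ (0 + 1)) (starExp β γ)) := by
  refine D.matPow_eq_of_rep (by omega) ?_
  have e : 0 + (0 + 1 + b + 1) = b + 1 + 1 := by omega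
  have e' : 0 + 1 + b = b + 1 := by omega
  have e'' : 1 + (b + 1) = b + 1 + 1 := by omega
  have h := D.rep_starExp 0 (starExp (1 : W q μ (0 + 1)) β) γ
  rw [h, rep_starExp, rep_starExp, map_one, one_mul, one_mul, loop_zero, rep_starExp, e, Nat.zero_add,
    Nat.zero_add, e'', mul_assoc _ (D.loop 1 b), ← D.R_mul_loop 0 b, e', mul_assoc (D.rep 1 β),
    ← (D.rep_comm_opS (by omega) γ D.R).eq]
  simp only [mul_assoc]

/-- The exponent of the `⋆`-power `M^{m+1}`. -/
def powExp (q μ : ℂ) : ℕ → Σ k : ℕ, W q μ (k + 1)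
  | 0 => ⟨0, 1⟩
  | m + 1 => ⟨_, starExp (1 : W q μ (0 + 1)) (powExp q μ m).2⟩

theorem matPow_one : D.matPow (1 : W q μ (0 + 1)) = D.M := by
  apply iota_injective
  rw [iota_matPow, map_one, mul_one, tr, etr_zero, str, str_one]
  rfl

theorem mulM_one : D.mulM 1 = D.M := by rw [mulM, phi_one, mul_one]

theorem matPow_powExp (m : ℕ) : D.matPow (powExp q μ m).2 = D.mulM^[m + 1] 1 := by
  induction m with
  | zero => exact D.matPow_one.trans D.mulM_one.symm
  | succ m ih => rw [Function.iterate_succ_apply', ← ih, powExp, matPow_one_starExp]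

theorem matPow_powExp_starExp (m : ℕ) {b : ℕ} (β : W q μ (b + 1)) :
    D.matPow (starExp (powExp q μ m).2 β) = D.mulM^[m + 1] (D.matPow β) := by
  induction m with
  | zero => exact D.matPow_one_starExp β
  | succ m ih =>
    rw [Function.iterate_succ_apply', ← ih, powExp, matPow_starExp_assoc, matPow_one_starExp]

theorem mulM_iterate_add (m : ℕ) (X Y : D.Mat) :
    D.mulM^[m] (X + Y) = D.mulM^[m] X + D.mulM^[m] Y := by
  induction m with
  | zero => rfl
  | succ m ih => simp only [Function.iterate_succ_apply', ih, mulM_add]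

theorem mulM_iterate_smul (m : ℕ) (c : ℂ) (X : D.Mat) :
    D.mulM^[m] (c • X) = c • D.mulM^[m] X := by
  induction m with
  | zero => rfl
  | succ m ih => simp only [Function.iterate_succ_apply', ih, mulM_smul]

theorem mulM_iterate_rmul (m : ℕ) (X : D.Mat) (c : D.Alg) :
    D.mulM^[m] (rmul X c) = rmul (D.mulM^[m] X) c := by
  induction m with
  | zero => rfl
  | succ m ih => simp only [Function.iterate_succ_apply', ih, mulM_rmul]

theorem mulM_iterate_sub (m : ℕ) (X Y : D.Mat) :
    D.mulM^[m] (X - Y) = D.mulM^[m] X - D.mulM^[m] Y := by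
  rw [eq_sub_iff_add_eq, ← mulM_iterate_add, sub_add_cancel]

theorem mulM_iterate_zero (m : ℕ) : D.mulM^[m] 0 = 0 := by
  have := D.mulM_iterate_smul m 0 0
  rwa [zero_smul, zero_smul] at this

/-- A presentation of the `⋆`-power `M^m`. -/
def powExpr (D : BMWPair N q μ) : ℕ → D.Expr
  | 0 => ([], 1)
  | m + 1 => ([powExp q μ m], 0)

theorem rmul_zero_right (X : D.Mat) : rmul X (0 : D.Alg) = 0 := by
  ext i j
  simp [rmul]

theorem rmul_one_right (X : D.Mat) : rmul X (1 : D.Alg) = X := by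
  ext i j
  simp [rmul]

theorem presents_powExpr (m : ℕ) : D.Presents (D.powExpr m) (D.mulM^[m] 1) := by
  cases m with
  | zero =>
    refine ⟨Submodule.subset_span (Or.inl rfl), ?_⟩
    simp [value, powExpr, rmul_one_right]
  | succ m =>
    refine ⟨zero_mem _, ?_⟩
    simp [value, powExpr, rmul_zero_right, ← matPow_powExp]

theorem starValue_powExpr (m : ℕ) (y : D.Expr) :
    D.starValue (D.powExpr m) y = D.mulM^[m] (D.value y) := by
  cases m with
  | zero => simp [starValue, powExpr, rmul_one_right, value]
  | succ m =>
    have h : ∀ l : List (Σ k : ℕ, W q μ (k + 1)),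
        (l.map fun β => D.matPow (starExp (powExp q μ m).2 β.2)).sum
          = D.mulM^[m + 1] (l.map fun β => D.matPow β.2).sum := by
      intro l
      induction l with
      | nil => exact (D.mulM_iterate_zero (m + 1)).symm
      | cons β l ih =>
        rw [List.map_cons, List.sum_cons, ih, matPow_powExp_starExp, ← mulM_iterate_add,
          List.map_cons, List.sum_cons]
    rw [value, mulM_iterate_add, mulM_iterate_rmul, ← h, ← matPow_powExp]
    simp [starValue, powExpr, rmul_zero_right]

/-- `iota_starValue` allows the standard presentation of the ⋆-power on the left, and for that one
`starValue_powExpr` gives a result that depends on the right presentation only through its value. -/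
theorem star_eq {m : ℕ} {Y : D.Mat} (y : D.Expr) (hy : D.Presents y Y) :
    D.star (D.mulM^[m] 1) Y = D.mulM^[m] Y := by
  have h : ∀ x y, D.Presents x (D.mulM^[m] 1) → D.Presents y Y →
      D.starValue x y = D.mulM^[m] Y := by
    intro x y hx hy
    rw [← hy.2, ← starValue_powExpr]
    apply iota_injective
    rw [iota_starValue, iota_starValue, hx.2, (D.presents_powExpr m).2]
  have hex : ∃ Z, ∀ x y, D.Presents x (D.mulM^[m] 1) → D.Presents y Y →
      D.starValue x y = Z := ⟨_, h⟩
  rw [star, dif_pos hex, ← hex.choose_spec _ _ (D.presents_powExpr m) hy,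
    h _ _ (D.presents_powExpr m) hy]

theorem starPow_eq (m : ℕ) : D.starPow m = D.mulM^[m] 1 := by
  induction m with
  | zero => rfl
  | succ m ih =>
    rw [starPow, ih, ← mulM_one]
    have h := D.star_eq (m := 1) _ (D.presents_powExpr m)
    rw [Function.iterate_succ_apply']
    exact h

theorem star_starPow_matPow (m : ℕ) {k : ℕ} (α : W q μ (k + 1)) :
    D.star (D.starPow m) (D.matPow α) = D.mulM^[m] (D.matPow α) := by
  rw [starPow_eq]
  refine D.star_eq ([⟨k, α⟩], 0) ⟨zero_mem _, ?_⟩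
  simp [value, rmul_zero_right]

/-- This places M^⊤(M^α) in the span on which ⋆ is meaningful. -/
theorem Mt_matPow {k : ℕ} (α : W q μ (k + 1)) : D.Mt (D.matPow α)
    = D.matPow (up 1 (k + 1 + 1) (by omega) α * κ ⟨0, by omega⟩) := by
  apply iota_injective
  rw [iota_Mt_matPow, iota_matPow, map_mul (D.rep 0), rep_up, rep_κ,
    Nat.zero_add]
  rfl

end BMWPair
end QMA
end

/-! ### Contractions with K and the element g. -/

noncomputable section
namespace QMA

namespace BMWPair

variable {N : ℕ} {q μ : ℂ} (D : BMWPair N q μ)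

theorem opLeg_map_mul {A : Type*} [Ring A] [Algebra ℂ A] (c : A) (X : TMat N 2 A) :
    opLeg (at' 0 2) (X.map (c * ·)) = opA c * opLeg (at' 0 2) X := by
  refine Op.ext fun v f => ?_
  simp only [Op.mul_apply, opA_apply, opLeg_apply, Matrix.map_apply, mul_assoc, Finset.mul_sum]

/-- With K = u ⊗ w of rank one, K Z K is K times the contraction of Z with w and u. -/
theorem exists_K_mul_K (Z : TMat N 2 D.Alg) : ∃ c : D.Alg,
    opS 0 D.K * opLeg (at' 0 2) Z * opS 0 D.K = opA c * opS 0 D.K := by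
  obtain ⟨u, w, h⟩ := D.K_rank_one
  refine ⟨∑ b, ∑ a, (w a * u b) • Z a b, ?_⟩
  rw [opS_apply, ← map_mul, ← map_mul, ← opLeg_map_mul]
  congr 1
  ext x y
  simp only [Matrix.mul_apply, Matrix.map_apply, scal, h, Finset.sum_mul,
    Algebra.algebraMap_eq_smul_one, smul_mul_assoc, mul_smul_comm, mul_one, one_mul, smul_smul]
  refine Finset.sum_congr rfl fun b _ => ?_
  rw [Finset.smul_sum]
  refine Finset.sum_congr rfl fun a _ => ?_
  rw [smul_smul]
  congr 1
  ring

theorem K_mul_K_self : opS 0 D.K * opS 0 D.K = eta q μ • (opS 0 D.K : D.Ops) := by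
  have hk := (D.bmw3 (A := D.Alg) 0).kk D.generic
  rwa [kap_opS] at hk

/-- K commutes with M_{\bar 1} M_{\bar 2} and K² = η K, so the product is η⁻¹ K M_{\bar 1} M_{\bar
2} K. -/
theorem exists_M_M_K : ∃ c : D.Alg, D.str 0 2 * opS 0 D.K = opA c * opS 0 D.K := by
  obtain ⟨c, h⟩ := D.exists_K_mul_K (copy D.F D.M 2 0 (by omega) * copy D.F D.M 2 1 (by omega))
  have hs : D.str 0 2 = opLeg (at' 0 2) (copy D.F D.M 2 0 (by omega)
      * copy D.F D.M 2 1 (by omega)) := by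
    rw [map_mul, opLeg_copy, opLeg_copy, str, str_succ', str_one]
  have hc : Commute (opS 0 D.K) (D.str 0 2) := D.commute_K (D.commute_str le_rfl le_rfl)
  rw [← hs, hc.eq, mul_assoc, K_mul_K_self, mul_smul_comm] at h
  refine ⟨(eta q μ)⁻¹ • c, ?_⟩
  rw [map_smul, smul_mul_assoc, ← h, smul_smul, inv_mul_cancel₀ D.eta_ne_zero, one_smul]

theorem opA_ch {k : ℕ} (α : W q μ (k + 1)) : opA (D.ch α) = D.pt 0 (iota (D.matPow α)) :=
  (ptr_iota _ _).symm

/-- The relation which expresses the product of two copies of `M`, multiplied by `K`, through the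
2-contraction. -/
theorem M_M_K : D.str 0 2 * opS 0 D.K = (μ ^ 2)⁻¹ • (opA D.g * opS 0 D.K) := by
  obtain ⟨c, h⟩ := D.exists_M_M_K
  have h1 : (opA (D.ch (κ (0 : Fin (2 - 1)) : W q μ (1 + 1))) : D.Ops) = (eta q μ * μ ^ 2) • opA c := by
    rw [opA_ch, iota_matPow, rep_κ]
    change D.pt 0 (etr (opD D.R) 0 1 (D.str 0 2 * opS 0 D.K)) = _
    rw [h, etr_succ, etr_zero, ptr_mul_left _ (opA_mem_cm _ _), D.ptr_K 0, mul_smul_comm, mul_one,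
      map_smul, ptr_of_mem _ (opA_mem_cm _ _), trace_opD, smul_smul]
    congr 1
    ring
  have hη := D.eta_ne_zero
  have hμ := D.mu_ne_zero
  rw [h, g, map_smul, h1, smul_smul, smul_mul_assoc, smul_smul,
    show (μ ^ 2)⁻¹ * ((eta q μ)⁻¹ * (eta q μ * μ ^ 2)) = 1 by field_simp, one_smul]

theorem iota_matPow_κ :
    iota (D.matPow (κ (0 : Fin (2 - 1)) : W q μ (1 + 1))) = μ⁻¹ • opA D.g := by
  rw [iota_matPow, rep_κ]
  change etr (opD D.R) 0 1 (D.str 0 2 * opS 0 D.K) = _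
  have hμ := D.mu_ne_zero
  rw [M_M_K, etr_succ, etr_zero, map_smul, ptr_mul_left _ (opA_mem_cm _ _), D.ptr_K 0,
    mul_smul_comm, mul_one, smul_smul, show (μ ^ 2)⁻¹ * μ = μ⁻¹ by field_simp]

theorem matPow_κ :
    D.matPow (κ (0 : Fin (2 - 1)) : W q μ (1 + 1)) = μ⁻¹ • rmul 1 D.g := by
  apply iota_injective
  rw [iota_matPow_κ, iota_smul, iota_rmul, iota_one, one_mul]

/-- M^{κ_1} ⋆ M^α in two ways. Since M^{κ_1} = μ⁻¹ g I, it is μ⁻¹ M^α g; in its exponent κ_1 σ_2 σ_1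
σ_2⁻¹ = κ_1 κ_2 σ_2⁻¹ = μ⁻¹ κ_1 κ_2. -/
theorem tr_str_κκ {k : ℕ} (α : W q μ (k + 1)) :
    D.tr 0 (k + 2) (D.str 0 (k + 3) * (D.rep 2 α * (opS 0 D.K * opS 1 D.K)))
      = iota (D.matPow α) * opA D.g := by
  have hμ := D.mu_ne_zero
  have h1 : D.starRight α (D.matPow (κ (0 : Fin (2 - 1)) : W q μ (1 + 1)))
      = μ⁻¹ • (iota (D.matPow α) * opA D.g) := by
    rw [← D.starRight_one, ← D.starRight_rmul, matPow_κ]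
    change etr (opD D.R) 0 (k + 1) _ = _ • etr (opD D.R) 0 (k + 1) _
    rw [cp, cp_smul, mul_smul_comm, smul_mul_assoc, map_smul]
  have hl := (D.bmw3' (A := D.Alg) 0).lst D.generic
  have hk := (D.bmw3' (A := D.Alg) 0).ks' D.generic
  rw [kap_opS, kap_opS] at hl
  rw [kap_opS] at hk
  have h2 : (opS 0 D.K * D.loop 0 1 : D.Ops) = μ⁻¹ • (opS 0 D.K * opS 1 D.K) := by
    rw [loop, desc, desc, desc, asc, asc, one_mul, mul_one, ← mul_assoc, ← mul_assoc]
    rw [hl, mul_assoc, hk, mul_smul_comm]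
  rw [starRight_matPow, iota_matPow, rep_starExp, rep_κ] at h1
  have hc := D.rep_comm_opS (s := 0 + (1 + 1)) (t := 0) (by omega) α D.K
  have e : 1 + 1 + k = k + 2 := by omega
  have e' : opS (0 + ((0 : Fin (1 + 1 - 1)) : ℕ)) D.K = (opS 0 D.K : D.Ops) := rfl
  rw [e', ← hc.eq, mul_assoc, h2, mul_smul_comm, mul_smul_comm, map_smul, e] at h1
  have h3 := congrArg (μ • ·) h1
  simpa only [smul_smul, mul_inv_cancel₀ hμ, one_smul] using h3

theorem tr_str_κκ' {k : ℕ} (α : W q μ (k + 1)) :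
    D.tr 0 (k + 2) (D.str 0 (k + 3) * (D.rep 2 α * (opS 1 D.K * opS 0 D.K)))
      = iota (D.matPow α) * opA D.g := by
  have hc := D.rep_comm_opS (s := 2) (t := 0) (by omega) α D.K
  rw [← tr_str_κκ, D.tr_inner (D.rep_mem_inner (by omega) (by omega) α), mul_assoc, ← hc.eq,
    D.tr_inner (D.K_mem_inner (by omega) (by omega)), mul_assoc]

/-- The trace of a copy of `M^α` behind two other ones. -/
theorem tr_str_rep (s : ℕ) {k : ℕ} (α : W q μ (k + 1)) :
    D.pt s (D.tr s k (D.str s (k + 1) * D.rep s α)) = opA (D.ch α) := by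
  rw [← cp_matPow]
  exact D.twists.ptr_cp _ _

theorem commute_str_of_lt {i s : ℕ} (h : i + 1 < s) (k : ℕ) :
    Commute (opS i D.R) (D.str s k) := by
  induction k with
  | zero => exact Commute.one_right _
  | succ k ih => exact ih.mul_right (D.twists.commute_cp D.M (by omega))

/-- The operator of two copies of `M` multiplied by `K`, with a full copy of `M^α` behind. -/
theorem tr_str_κ {k : ℕ} (α : W q μ (k + 1)) :
    D.tr 0 (k + 2) (D.str 0 (k + 3) * (D.rep 2 α * opS 0 D.K))
      = μ⁻¹ • (opA D.g * opA (D.ch α)) := by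
  have hμ := D.mu_ne_zero
  have hc := D.rep_comm_opS (s := 2) (t := 0) (by omega) α D.K
  have hs : Commute (opS 0 D.K) (D.str 2 (k + 1)) := D.commute_K (D.commute_str_of_lt (by omega) _)
  have e : D.str 0 (k + 3) = D.str 0 2 * D.str 2 (k + 1) := by
    have := str_add (F := D.F) D.M 0 2 (k + 1)
    rw [show 2 + (k + 1) = k + 3 by omega] at this
    exact this
  have e2 : D.str 0 (k + 3) * (D.rep 2 α * opS 0 D.K)
      = (μ ^ 2)⁻¹ • (opA D.g * opS 0 D.K * (D.str 2 (k + 1) * D.rep 2 α)) := by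
    rw [e, hc.eq, mul_assoc, ← mul_assoc (D.str 2 _), ← hs.eq, ← smul_mul_assoc, ← M_M_K]
    simp only [mul_assoc]
  rw [e2, map_smul]
  change _ • etr (opD D.R) 0 (k + 2) _ = _
  rw [etr_succ', etr_succ', etr_mul_left _ fun i h _ => mul_mem (opA_mem_cm _ _)
      (opS_mem_cm (by omega) _), ptr_mul_left _ (mul_mem (opA_mem_cm _ _)
      (opS_mem_cm (by omega) _)), tr_str_rep, ptr_mul_right _ (opA_mem_cm _ _),
      ptr_mul_left _ (opA_mem_cm _ _), D.ptr_K 0, mul_smul_comm, mul_one, smul_mul_assoc, smul_smul,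
      show (μ ^ 2)⁻¹ * μ = μ⁻¹ by field_simp]

/-- Take the full R-trace with exponent α^{↑2} κ_1 κ_2. By `tr_str_κκ` it is ch(α) g. Doubling κ_1
by κ_1² = η κ_1, cycling one copy and using κ_1 κ_2 κ_1 = κ_1 reduces it to the trace of `tr_str_κ`,
which gives g ch(α). -/
theorem commute_g_ch {k : ℕ} (α : W q μ (k + 1)) :
    Commute (opA D.g : D.Ops) (opA (D.ch α)) := by
  have hη := D.eta_ne_zero
  have hμ := D.mu_ne_zero
  have hc := D.rep_comm_opS (s := 2) (t := 0) (by omega) α D.K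
  have hs : Commute (opS 0 D.K) (D.str 0 (k + 3)) :=
    D.commute_K (D.commute_str (by omega) (by omega))
  have hkk := (D.bmw3 (A := D.Alg) 0).klk D.generic
  rw [kap_opS, kap_opS, Nat.zero_add] at hkk
  have hcyc : ∀ X : D.Ops, D.pt 0 (D.tr 0 (k + 2) (opS 0 D.K * X))
      = D.pt 0 (D.tr 0 (k + 2) (X * opS 0 D.K)) := by
    intro X
    have h0 : ∀ i, 1 < i → i ≤ 1 + (k + 1) → opS 0 D.R ∈ cm N D.Alg i := fun i hi _ =>
      opS_mem_cm (by omega) _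
    have hR : ∀ X : D.Ops, D.pt 0 (D.tr 0 (k + 2) (opS 0 D.R * X))
        = D.pt 0 (D.tr 0 (k + 2) (X * opS 0 D.R)) := by
      intro X
      have e : ∀ Y, D.tr 0 (k + 2) Y = D.pt 1 (etr (opD D.R) 1 (k + 1) Y) :=
        etr_succ' (opD D.R) 0 (k + 1)
      rw [e, e, etr_mul_left _ h0, etr_mul_right _ h0]
      exact D.ptr_cyclic 0 _
    rw [← kap_opS, kap_eq D.generic]
    simp only [smul_mul_assoc, mul_smul_comm, map_smul, sub_mul, mul_sub, add_mul, mul_add, map_sub,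
      map_add, one_mul, mul_one, hR]
    rw [mul_assoc (opS 0 D.R), hR, mul_assoc (opS 0 D.R), hR, mul_assoc]
  have h1 : D.pt 0 (D.tr 0 (k + 2) (D.str 0 (k + 3) * (D.rep 2 α * (opS 0 D.K * opS 1 D.K))))
      = (eta q μ)⁻¹ • D.pt 0 (D.tr 0 (k + 2) (D.str 0 (k + 3) * (D.rep 2 α * opS 0 D.K))) := by
    have h2 : D.str 0 (k + 3) * (D.rep 2 α * (opS 0 D.K * opS 1 D.K))
        = (eta q μ)⁻¹ • (opS 0 D.K * (D.str 0 (k + 3) * D.rep 2 α * opS 0 D.K * opS 1 D.K)) := by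
      have h3 : opS 0 D.K * (D.str 0 (k + 3) * D.rep 2 α * opS 0 D.K * opS 1 D.K)
          = D.str 0 (k + 3) * D.rep 2 α * (opS 0 D.K * opS 0 D.K) * opS 1 D.K := by
        rw [← mul_assoc, ← mul_assoc, ← mul_assoc, hs.eq, mul_assoc (D.str _ _), ← hc.eq]
        simp only [mul_assoc]
      rw [h3, K_mul_K_self]
      simp only [mul_smul_comm, smul_mul_assoc, smul_smul, inv_mul_cancel₀ hη, one_smul, mul_assoc]
    rw [h2, map_smul, map_smul, hcyc, mul_assoc, mul_assoc, ← mul_assoc (opS 0 D.K), hkk, mul_assoc]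
  rw [tr_str_κκ, tr_str_κ, ptr_mul_right _ (opA_mem_cm _ _), ← opA_ch, map_smul,
    ptr_of_mem _ (mul_mem (opA_mem_cm _ _) (opA_mem_cm _ _)), trace_opD, smul_smul, smul_smul,
    show (eta q μ)⁻¹ * μ⁻¹ * (eta q μ * μ) = 1 by field_simp, one_smul] at h1
  exact h1.symm

theorem matPow_up_κ {k : ℕ} (α : W q μ (k + 1)) :
    D.matPow (up 2 (k + 2 + 1) (by omega) α * κ ⟨0, by omega⟩)
      = μ⁻¹ • rmul (rmul 1 (D.ch α)) D.g := by
  apply iota_injective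
  rw [iota_matPow, map_mul (D.rep 0), rep_up, rep_κ, Nat.zero_add]
  change D.tr 0 (k + 2) (D.str 0 (k + 3) * (D.rep 2 α * opS 0 D.K)) = _
  rw [tr_str_κ, (D.commute_g_ch α).eq, iota_smul, iota_rmul, iota_rmul, iota_one, one_mul]

theorem matPow_up_κκ {k : ℕ} (α : W q μ (k + 1)) :
    D.matPow (up 2 (k + 2 + 1) (by omega) α * (κ ⟨0, by omega⟩ * κ ⟨1, by omega⟩))
      = rmul (D.matPow α) D.g := by
  apply iota_injective
  rw [iota_matPow, map_mul (D.rep 0), map_mul (D.rep 0), rep_up, rep_κ, rep_κ, iota_rmul]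
  exact D.tr_str_κκ α

theorem matPow_up_κκ' {k : ℕ} (α : W q μ (k + 1)) :
    D.matPow (up 2 (k + 2 + 1) (by omega) α * (κ ⟨1, by omega⟩ * κ ⟨0, by omega⟩))
      = rmul (D.matPow α) D.g := by
  apply iota_injective
  rw [iota_matPow, map_mul (D.rep 0), map_mul (D.rep 0), rep_up, rep_κ, rep_κ, iota_rmul]
  exact D.tr_str_κκ' α

/-- The factor g is first absorbed into an exponent by `matPow_up_κκ`. Then σ_3⁻¹ κ_2 = σ_2 κ_3 κ_2,
cycling σ_2 to the end forms κ_2 σ_1 σ_2 = κ_2 κ_1, and cycling κ_3 matches the two traces. It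
identifies the σ⁻¹-term in the expansion of B^{(1,i+1)} with B^{(0,i)} g. -/
theorem phi_matPow_up_σinv_κ {k : ℕ} (α : W q μ (k + 1)) :
    D.phi (D.matPow (up 2 (k + 2 + 1) (by omega) α * (σinv ⟨1, by omega⟩ * κ ⟨0, by omega⟩)))
      = rmul (D.xi (D.matPow α)) D.g := by
  rw [← xi_rmul, ← matPow_up_κκ]
  apply iota_injective
  rw [iota_phi_matPow, iota_xi_matPow]
  simp only [map_mul (D.rep 1), rep_up, rep_κ, rep_σinv]
  change D.tr 0 (k + 3) (D.str 1 (k + 3) * (D.rep 3 α * (opS 2 D.R⁻¹ * opS 1 D.K)) * opS 0 D.R)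
    = D.tr 0 (k + 3) (D.str 1 (k + 3) * (D.rep 3 α * (opS 1 D.K * opS 2 D.K)) * opS 0 D.K)
  have e1 := (D.bmw3 (A := D.Alg) 1).t'k D.generic
  have e2 := (D.bmw3 (A := D.Alg) 0).lst D.generic
  rw [kap_opS, kap_opS] at e1 e2
  rw [Nat.zero_add] at e2
  have hα := D.rep_mem_cyc (s := 0) (k := k + 3) (s' := 3) (by omega) (by omega) α
  have hR := D.R_mem_cyc (s := 0) (k := k + 3) (i := 1) (by omega) (by omega)
  have hK := D.K_mem_cyc (s := 0) (k := k + 3) (i := 2) (by omega) (by omega)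
  have sα := D.commute_rep_str (s := 1) (s' := 3) (k := k + 3) (by omega) (by omega) α
  have sR := D.commute_str (s := 1) (k := k + 3) (i := 1) (by omega) (by omega)
  have sK := D.commute_K (D.commute_str (s := 1) (k := k + 3) (i := 2) (by omega) (by omega))
  have cR := D.rep_comm_opS (s := 3) (t := 1) (by omega) α D.R
  have c1 := D.rep_comm_opS (s := 3) (t := 1) (by omega) α D.K
  have c0 := D.rep_comm_opS (s := 3) (t := 0) (by omega) α D.K
  have ck : Commute (opS 0 D.K) (opS 2 D.K : D.Ops) := opS_comm 0 2 (by omega) _ _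
  have cyc : ∀ {y : D.Ops}, y ∈ cyc (opD D.R) D.Alg 0 (k + 3) → Commute y (D.str 1 (k + 3)) →
      ∀ x, D.tr 0 (k + 3) (D.str 1 (k + 3) * (y * x))
        = D.tr 0 (k + 3) (D.str 1 (k + 3) * (x * y)) := by
    intro y h h' x
    rw [← mul_assoc, ← h'.eq, mul_assoc, h, mul_assoc]
  calc _ = D.tr 0 (k + 3) (D.str 1 (k + 3) * (opS 1 D.R * (D.rep 3 α * opS 2 D.K
          * opS 1 D.K * opS 0 D.R))) := by
        rw [e1, ← mul_assoc (opS 1 D.R), ← mul_assoc (opS 1 D.R), ← mul_assoc (opS 1 D.R), ← cR.eq]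
        simp only [mul_assoc]
    _ = D.tr 0 (k + 3) (D.str 1 (k + 3) * (D.rep 3 α * (opS 2 D.K * opS 1 D.K * opS 0 D.K))) := by
        rw [cyc hR sR, mul_assoc (opS 2 D.K), ← e2]
        simp only [mul_assoc]
    _ = D.tr 0 (k + 3) (D.str 1 (k + 3) * (opS 2 D.K * (opS 1 D.K * opS 0 D.K * D.rep 3 α))) := by
        rw [cyc hα sα]
        simp only [mul_assoc]
    _ = _ := by
        rw [cyc hK sK, mul_assoc (opS 1 D.K), ← c0.eq, ← mul_assoc (opS 1 D.K), ← c1.eq,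
          mul_assoc _ (opS 0 D.K), ck.eq]
        simp only [mul_assoc]

end BMWPair
end QMA
end

/-! ### The recursions for the descendants. -/

noncomputable section
namespace QMA

/-- For j = i + 1 the excluded value -q^{3-2j} is -q^{1-2i}, exactly where the denominator q μ⁻¹
q^{-2i} + 1 vanishes. -/
theorem antiOK_of {q μ : ℂ} (hp : Generic q μ) {n k : ℕ}
    (hq : ∀ j ∈ Finset.Icc 2 n, qnum q j ≠ 0)
    (hμ : ∀ j ∈ Finset.Icc 2 n, μ ≠ -q ^ (3 - 2 * (j : ℤ))) (hk : k + 1 ≤ n) : AntiOK q μ k := by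
  intro i h1 h2
  have hm : i + 1 ∈ Finset.Icc 2 n := Finset.mem_Icc.2 ⟨by omega, by omega⟩
  refine ⟨hq _ hm, fun h => hμ _ hm ?_⟩
  have hq0 := hp.q_ne
  have hμ0 := hp.mu_ne
  have e : q ^ (3 - 2 * ((i + 1 : ℕ) : ℤ)) = q * (q ^ (2 * i))⁻¹ := by
    rw [← zpow_natCast q (2 * i), ← zpow_neg, ← zpow_one_add₀ hq0]
    congr 1
    push_cast
    ring
  rw [e]
  field_simp at h ⊢
  linear_combination h

/-- The coefficients of the baxterized element in the recursion for the antisymmetrizers. -/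
theorem coeff_identities {q μ : ℂ} (hp : Generic q μ) (i : ℕ)
    (h : q * μ⁻¹ * (q ^ (2 * i))⁻¹ + 1 ≠ 0) :
    q ^ i * (((q ^ (2 * i))⁻¹ - 1) / (q - q⁻¹)) = -qnum q i ∧
    q ^ i * (((q ^ (2 * i))⁻¹ - 1) / (q * μ⁻¹ * (q ^ (2 * i))⁻¹ + 1))
      = -(μ * q ^ (2 * (i : ℤ) - 1) * (q - q⁻¹) / (1 + μ * q ^ (2 * (i : ℤ) - 1)) * qnum q i) ∧
    q ^ i * (1 + (q - q⁻¹) * (((q ^ (2 * i))⁻¹ - 1) / (q - q⁻¹))) = (q ^ i)⁻¹ ∧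
    q ^ i * (((q ^ (2 * i))⁻¹ - 1) / (q * μ⁻¹ * (q ^ (2 * i))⁻¹ + 1)
        - (q - q⁻¹) * (((q ^ (2 * i))⁻¹ - 1) / (q - q⁻¹)))
      = (q - q⁻¹) / (1 + μ * q ^ (2 * (i : ℤ) - 1)) * qnum q i := by
  have hq0 := hp.q_ne
  have hμ0 := hp.mu_ne
  have hl := hp.lam_ne
  have e : q ^ (2 * (i : ℤ) - 1) = q ^ i * q ^ i * q⁻¹ := by
    rw [sub_eq_add_neg, zpow_add₀ hq0, two_mul, zpow_add₀ hq0, zpow_natCast, zpow_neg_one]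
  have e2 : q ^ (2 * i) = q ^ i * q ^ i := by rw [two_mul, pow_add]
  have hQ : q ^ i ≠ 0 := pow_ne_zero _ hq0
  rw [e2] at h ⊢
  rw [e, qnum]
  generalize q ^ i = Q at *
  have h1 : q + μ * Q ^ 2 ≠ 0 := by
    intro h'
    apply h
    field_simp
    linear_combination h'
  have h3 : 1 + μ * (Q * Q * q⁻¹) ≠ 0 := by
    intro h'
    apply h1
    field_simp at h'
    linear_combination h'
  have h4 : q * μ⁻¹ * (Q * Q)⁻¹ + 1 = (q + μ * Q ^ 2) / (μ * Q ^ 2) := by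
    field_simp
  have h5 : 1 + μ * (Q * Q * q⁻¹) = (q + μ * Q ^ 2) / q := by
    field_simp
  rw [h4, h5]
  generalize q - q⁻¹ = l at *
  refine ⟨?_, ?_, ?_, ?_⟩
  · field_simp
    ring
  · field_simp
    ring
  · field_simp
    ring
  · generalize hW : q + μ * Q ^ 2 = W at *
    field_simp
    linear_combination (1 - Q ^ 2) * hW

namespace BMWPair

variable {N : ℕ} {q μ : ℂ} (D : BMWPair N q μ)

/-- The matrix `Tr_{R(2,…,k+1)} M_{\overline 2} ⋯ M_{\overline{k+1}} ρ_R(α)`. -/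
def tail {k : ℕ} (α : W q μ (k + 1)) : D.Mat :=
  trTail (opD D.R) (D.stringTail k * scal (D.rho (k + 1) α))

theorem iota_tail' {k : ℕ} (α : W q μ (k + 1)) :
    iota (D.tail α) = D.tr 0 k (D.str 1 k * D.rep 0 α) := D.iota_tail α

theorem M_mul_tail {k : ℕ} (α : W q μ (k + 1)) : D.M * D.tail α = D.matPow α := by
  apply iota_injective
  rw [iota_mul, iota_tail', iota_M_mul_tr, iota_matPow]

theorem mulM_phiInv_tail {k : ℕ} (α : W q μ (k + 1)) :
    D.mulM (D.phiInv (D.tail α)) = D.matPow α := by rw [mulM_phiInv, M_mul_tail]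

theorem mulM_phiInv_xi (X : D.Mat) : D.mulM (D.phiInv (D.xi X)) = D.Mt X := D.mulM_phiInv _

theorem phi_sub (X Y : D.Mat) : D.phi (X - Y) = D.phi X - D.phi Y := by
  rw [eq_sub_iff_add_eq, ← phi_add, sub_add_cancel]

theorem rep_anti_succ (s : ℕ) {k : ℕ} (hk : AntiOK q μ (k + 1)) :
    D.rep s (anti q μ (k + 1)) = (q ^ (k + 1) / qnum q (k + 2)) • (D.rep (s + 1) (anti q μ k)
      * (1 + (((q ^ (2 * (k + 1)))⁻¹ - 1) / (q - q⁻¹)) • opS s D.R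
        + (((q ^ (2 * (k + 1)))⁻¹ - 1) / (q * μ⁻¹ * (q ^ (2 * (k + 1)))⁻¹ + 1)) • opS s D.K)
      * D.rep (s + 1) (anti q μ k)) := by
  rw [anti_succ D.generic k hk, map_smul, map_mul, map_mul, rep_up, map_bax, rep_σ, bax, kap_opS]
  rfl

theorem rep_anti_mul_self (s : ℕ) {k : ℕ} (hk : AntiOK q μ k) :
    D.rep s (anti q μ k) * D.rep s (anti q μ k) = D.rep s (anti q μ k) := by
  rw [← map_mul, anti_mul_self D.generic k hk]

/-- Cyclicity moves one of the outer antisymmetrizers around the trace to the other, and idempotency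
merges them. The terms 1, σ_1, κ_1 of the baxterized element then give the ordinary trace, φ and ξ.
-/
theorem tail_anti_succ {k : ℕ} (hk : AntiOK q μ (k + 1)) :
    D.tail (anti q μ (k + 1)) = (q ^ (k + 1) / qnum q (k + 2)) •
      (rmul 1 (D.ch (anti q μ k))
        + (((q ^ (2 * (k + 1)))⁻¹ - 1) / (q - q⁻¹)) • D.phi (D.matPow (anti q μ k))
        + (((q ^ (2 * (k + 1)))⁻¹ - 1) / (q * μ⁻¹ * (q ^ (2 * (k + 1)))⁻¹ + 1)) •
          D.xi (D.matPow (anti q μ k))) := by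
  apply iota_injective
  have ha := D.rep_mem_cyc (s := 0) (k := k + 1) (s' := 1) (by omega) (by omega) (anti q μ k)
  have hs := D.commute_rep_str (s := 1) (s' := 1) (k := k + 1) le_rfl (by omega) (anti q μ k)
  have h1 : D.tr 0 (k + 1) (D.str 1 (k + 1) * D.rep 1 (anti q μ k)) = opA (D.ch (anti q μ k)) := by
    rw [← tr_str_rep D 1]
    exact etr_succ' (opD D.R) 0 k _
  rw [iota_tail', D.rep_anti_succ 0 hk, iota_smul, iota_add, iota_add, iota_smul, iota_smul,
    iota_phi_matPow, iota_xi_matPow, iota_rmul, iota_one, one_mul, ← h1, mul_smul_comm, map_smul,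
    Nat.zero_add]
  have h2 : ∀ Z, D.tr 0 (k + 1) (D.str 1 (k + 1) * (D.rep 1 (anti q μ k) * Z
      * D.rep 1 (anti q μ k))) = D.tr 0 (k + 1) (D.str 1 (k + 1) * (D.rep 1 (anti q μ k) * Z)) := by
    intro Z
    rw [← mul_assoc, ← ha, ← mul_assoc, hs.eq, mul_assoc, ← mul_assoc (D.rep 1 _),
      D.rep_anti_mul_self 1 (hk.mono (by omega))]
  rw [h2]
  simp only [mul_add, mul_one, mul_smul_comm, map_add, map_smul, mul_assoc]

/-- The same expansion one strand further on, where a^{(k+1)↑2} commutes with κ_1. The skein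
relation is used to trade σ_2 for σ_2⁻¹, because the image under φ of the resulting term is known.
-/
theorem Mt_matPow_anti_succ {k : ℕ} (hk : AntiOK q μ (k + 1)) :
    D.Mt (D.matPow (anti q μ (k + 1))) = (q ^ (k + 1) / qnum q (k + 2)) •
      (D.matPow (up 2 (k + 2 + 1) (by omega) (anti q μ k) * κ ⟨0, by omega⟩)
        + (((q ^ (2 * (k + 1)))⁻¹ - 1) / (q - q⁻¹)) •
          (D.matPow (up 2 (k + 2 + 1) (by omega) (anti q μ k)
              * (σinv ⟨1, by omega⟩ * κ ⟨0, by omega⟩))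
            + (q - q⁻¹) • D.matPow (up 2 (k + 2 + 1) (by omega) (anti q μ k) * κ ⟨0, by omega⟩)
            - (q - q⁻¹) • rmul (D.matPow (anti q μ k)) D.g)
        + (((q ^ (2 * (k + 1)))⁻¹ - 1) / (q * μ⁻¹ * (q ^ (2 * (k + 1)))⁻¹ + 1)) •
          rmul (D.matPow (anti q μ k)) D.g) := by
  rw [← matPow_up_κκ']
  apply iota_injective
  have ha := D.rep_mem_inner (k := k + 2) (s := 2) (by omega) (by omega) (anti q μ k)
  have hc := D.rep_comm_opS (s := 2) (t := 0) (by omega) (anti q μ k) D.K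
  have h2 : ∀ Z, D.tr 0 (k + 2) (D.str 0 (k + 3) * (D.rep 2 (anti q μ k) * Z
      * D.rep 2 (anti q μ k) * opS 0 D.K))
      = D.tr 0 (k + 2) (D.str 0 (k + 3) * (D.rep 2 (anti q μ k) * (Z * opS 0 D.K))) := by
    intro Z
    rw [mul_assoc _ _ (opS 0 D.K), hc.eq, ← mul_assoc _ (opS 0 D.K), ← D.tr_inner ha]
    simp only [mul_assoc]
    rw [← mul_assoc (D.rep 2 (anti q μ k)) (D.rep 2 (anti q μ k)),
      D.rep_anti_mul_self 2 (hk.mono (by omega))]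
  have h3 : (opS 1 D.R : D.Ops) = opS 1 D.R⁻¹ + (q - q⁻¹) • 1 - (q - q⁻¹) • opS 1 D.K := by
    rw [D.opS_inv_eq 1]
    abel
  have h4 : iota (D.Mt (D.matPow (anti q μ (k + 1)))) = D.tr 0 (k + 2) (D.str 0 (k + 3)
      * (D.rep 1 (anti q μ (k + 1)) * opS 0 D.K)) := D.iota_Mt_matPow _
  rw [h4, D.rep_anti_succ 1 hk, smul_mul_assoc, mul_smul_comm, map_smul, h2, h3]
  simp only [iota_smul, iota_add, iota_sub, iota_matPow, map_mul (D.rep 0), rep_up, rep_κ, rep_σinv,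
    Nat.zero_add]
  change _ • D.tr 0 (k + 2) (D.str 0 (k + 3) * _) = _
  simp only [mul_add, add_mul, mul_sub, sub_mul, one_mul, mul_smul_comm, smul_mul_assoc, map_add,
    map_sub, map_smul]

theorem phiInv_eq_smul {X Y : D.Mat} {c : ℂ} (h : D.phi X = c • Y) :
    c • D.phiInv Y = X := by
  apply D.phi_bijective.1
  rw [phi_smul, phi_phiInv, h]

theorem qnum_one (hp : Generic q μ) : qnum q 1 = 1 := by
  rw [qnum, pow_one, div_self hp.lam_ne]

theorem smul_phiInv_tail {k : ℕ} (hk : AntiOK q μ (k + 1)) :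
    qnum q (k + 2) • D.phiInv (D.tail (anti q μ (k + 1)))
      = q ^ (k + 1) • rmul 1 (D.ch (anti q μ k)) - qnum q (k + 1) • D.matPow (anti q μ k)
        - (μ * q ^ (2 * ((k + 1 : ℕ) : ℤ) - 1) * (q - q⁻¹)
            / (1 + μ * q ^ (2 * ((k + 1 : ℕ) : ℤ) - 1))) •
          qnum q (k + 1) • D.phiInv (D.xi (D.matPow (anti q μ k))) := by
  have hq : qnum q (k + 2) ≠ 0 := (hk (k + 1) (by omega) le_rfl).1
  obtain ⟨c1, c2, -, -⟩ := coeff_identities D.generic (k + 1) (hk (k + 1) (by omega) le_rfl).2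
  refine D.phiInv_eq_smul ?_
  rw [tail_anti_succ D hk, smul_smul (qnum q (k + 2)), mul_div_cancel₀ _ hq, smul_add, smul_add,
    smul_smul (q ^ (k + 1)), smul_smul (q ^ (k + 1)), c1, c2, phi_sub, phi_sub, phi_smul, phi_smul, phi_smul, phi_smul, phi_rmul, phi_one,
    phi_phiInv]
  apply iota_injective
  simp only [iota_smul, iota_add, iota_sub]
  module

theorem smul_Mt_matPow {k : ℕ} (hk : AntiOK q μ (k + 1)) :
    qnum q (k + 2) • D.Mt (D.matPow (anti q μ (k + 1)))
      = rmul ((μ⁻¹ * (q ^ (k + 1))⁻¹) • rmul 1 (D.ch (anti q μ k))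
          + ((q - q⁻¹) / (1 + μ * q ^ (2 * ((k + 1 : ℕ) : ℤ) - 1))) •
            qnum q (k + 1) • D.matPow (anti q μ k)
          - qnum q (k + 1) • D.phiInv (D.xi (D.matPow (anti q μ k)))) D.g := by
  have hq : qnum q (k + 2) ≠ 0 := (hk (k + 1) (by omega) le_rfl).1
  obtain ⟨c1, -, c3, c4⟩ := coeff_identities D.generic (k + 1) (hk (k + 1) (by omega) le_rfl).2
  have h : D.matPow (up 2 (k + 2 + 1) (by omega) (anti q μ k)
      * (σinv ⟨1, by omega⟩ * κ ⟨0, by omega⟩))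
      = rmul (D.phiInv (D.xi (D.matPow (anti q μ k)))) D.g := by
    -- Injectivity of φ turns `phi_matPow_up_σinv_κ` into a formula for the matrix itself.
    apply D.phi_bijective.1
    rw [phi_matPow_up_σinv_κ, phi_rmul, phi_phiInv]
  rw [Mt_matPow_anti_succ D hk, h, matPow_up_κ, smul_smul, mul_div_cancel₀ _ hq]
  apply iota_injective
  simp only [iota_smul, iota_add, iota_sub, iota_rmul, add_mul, sub_mul, smul_mul_assoc]
  generalize iota 1 * opA (D.ch (anti q μ k)) * opA D.g = X
  generalize iota (D.phiInv (D.xi (D.matPow (anti q μ k)))) * opA D.g = Y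
  generalize iota (D.matPow (anti q μ k)) * opA D.g = Z
  generalize ((q ^ (2 * (k + 1)))⁻¹ - 1) / (q - q⁻¹) = s at *
  generalize ((q ^ (2 * (k + 1)))⁻¹ - 1) / (q * μ⁻¹ * (q ^ (2 * (k + 1)))⁻¹ + 1) = t at *
  rw [smul_smul _ (qnum q (k + 1)), ← c4, ← c3]
  have hY : qnum q (k + 1) • Y = -(q ^ (k + 1) * s) • Y := by rw [c1, neg_neg]
  rw [hY]
  module

/-- M · φ cancels the φ⁻¹ in the member with m = -1, so iterating `mulM` from there produces the
whole family, without a case distinction in m. -/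
theorem descA_sub_one (m k : ℕ) : D.descA ((m : ℤ) - 1) (k + 1)
    = D.mulM^[m] (qnum q (k + 1) • D.phiInv (D.tail (anti q μ k))) := by
  cases m with
  | zero => rfl
  | succ m =>
    have e : ((m + 1 : ℕ) : ℤ) - 1 = Int.ofNat m := by
      simp
    rw [e, Function.iterate_succ_apply, mulM_smul, mulM_phiInv_tail, mulM_iterate_smul, descA,
      star_starPow_matPow]

theorem descA_natCast (m k : ℕ) : D.descA m (k + 1)
    = D.mulM^[m] (qnum q (k + 1) • D.matPow (anti q μ k)) := by
  rw [mulM_iterate_smul, ← star_starPow_matPow]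
  rfl

theorem descB_succ (m k : ℕ) : D.descB (m + 1) (k + 1)
    = D.mulM^[m] (qnum q (k + 1) • D.Mt (D.matPow (anti q μ k))) := by
  rw [mulM_iterate_smul, Mt_matPow, ← star_starPow_matPow, ← Mt_matPow]
  rfl

theorem descB_eq (m k : ℕ) : D.descB m (k + 1)
    = D.mulM^[m] (qnum q (k + 1) • D.phiInv (D.xi (D.matPow (anti q μ k)))) := by
  cases m with
  | zero => rfl
  | succ m => rw [descB_succ, Function.iterate_succ_apply, mulM_smul, mulM_phiInv_xi]

theorem tail_one : D.tail (1 : W q μ (0 + 1)) = 1 := by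
  apply iota_injective
  rw [iota_tail', map_one, mul_one, iota_one]
  rfl

theorem phiInv_one : D.phiInv 1 = 1 := D.phiInv_eq D.phi_one

theorem Mt_matPow_one : D.Mt (D.matPow (1 : W q μ (0 + 1))) = μ⁻¹ • rmul 1 D.g := by
  rw [Mt_matPow, map_one, one_mul, ← matPow_κ]
  rfl

theorem starPow_rmul (m : ℕ) (c : D.Alg) : rmul (D.starPow m) c = D.mulM^[m] (rmul 1 c) := by
  rw [mulM_iterate_rmul, starPow_eq]

theorem descA_recursion {i : ℕ} (h : AntiOK q μ i) (m : ℕ) :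
    D.descA ((m : ℤ) - 1) (i + 1)
      = q ^ i • rmul (D.starPow m) (D.a i) - D.descA m i
        - (μ * q ^ (2 * (i : ℤ) - 1) * (q - q⁻¹) / (1 + μ * q ^ (2 * (i : ℤ) - 1))) •
          D.descB m i := by
  rw [descA_sub_one, starPow_rmul]
  cases i with
  -- For i = 0 the antisymmetrizer is 1, its trace without the first copy of M is I, and φ⁻¹(I) = I;
  -- both sides are the ⋆-power itself.
  | zero =>
    rw [descA, descB, smul_zero, sub_zero, sub_zero, pow_zero, one_smul, zero_add,
      qnum_one D.generic, one_smul, a, rmul_one_right, anti, tail_one, phiInv_one]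
  | succ k =>
    rw [descA_natCast, descB_eq, ← mulM_iterate_smul, ← mulM_iterate_smul, ← mulM_iterate_sub,
      ← mulM_iterate_sub, smul_phiInv_tail D h]
    rfl

theorem descB_recursion {i : ℕ} (h : AntiOK q μ i) (m : ℕ) :
    D.descB (m + 1) (i + 1)
      = rmul ((μ⁻¹ * (q ^ i)⁻¹) • rmul (D.starPow m) (D.a i)
          + ((q - q⁻¹) / (1 + μ * q ^ (2 * (i : ℤ) - 1))) • D.descA m i
          - D.descB m i) D.g := by
  rw [descB_succ, starPow_rmul]
  cases i with
  -- For i = 0 the formula rests on M^⊤(M) = M^{κ_1} = μ⁻¹ g I.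
  | zero =>
    rw [descA, descB, smul_zero, sub_zero, add_zero, pow_zero, inv_one, mul_one, zero_add,
      qnum_one D.generic, one_smul, a, rmul_one_right, anti, Mt_matPow_one, ← mulM_iterate_smul,
      ← mulM_iterate_rmul]
    congr 1
    apply iota_injective
    simp only [iota_smul, iota_rmul, smul_mul_assoc]
  | succ k =>
    rw [descA_natCast, descB_eq, ← mulM_iterate_smul, ← mulM_iterate_smul, ← mulM_iterate_add,
      ← mulM_iterate_sub, ← mulM_iterate_rmul, smul_Mt_matPow D h]
    rfl

end BMWPair
end QMA
end

theorem lemma5p1 {N : ℕ} {q μ : ℂ} (D : QMA.BMWPair N q μ) (n : ℕ)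
    (hq : ∀ j ∈ Finset.Icc 2 n, QMA.qnum q j ≠ 0)
    (hμ : ∀ j ∈ Finset.Icc 2 n, μ ≠ -q ^ (3 - 2 * (j : ℤ)))
    (i : ℕ) (hi : i < n) (m : ℕ) :
    D.descA ((m : ℤ) - 1) (i + 1)
      = q ^ i • QMA.rmul (D.starPow m) (D.a i) - D.descA m i
        - (μ * q ^ (2 * (i : ℤ) - 1) * (q - q⁻¹) / (1 + μ * q ^ (2 * (i : ℤ) - 1))) •
          D.descB m i ∧
    D.descB (m + 1) (i + 1)
      = QMA.rmul ((μ⁻¹ * (q ^ i)⁻¹) • QMA.rmul (D.starPow m) (D.a i)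
          + ((q - q⁻¹) / (1 + μ * q ^ (2 * (i : ℤ) - 1))) • D.descA m i
          - D.descB m i) D.g := by
  have h : QMA.AntiOK q μ i := QMA.antiOK_of D.generic hq hμ (by omega)
  exact ⟨D.descA_recursion h m, D.descB_recursion h m⟩
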